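/- Model. A program over a field $K$ keeps field elements in registers. It may load constants of $K$, add, subtract, multiply and divide the contents of registers, and branch on whether a register contains $0$; it has no other access to field elements. Each executed instruction (arithmetic operation, constant or zero test) counts as one field operation; moving and permuting entries is free. Definitions. The left triangular part $\mathrm{Left}(A)$ of an $m\times n$ matrix $A$ keeps the entries $A_{i,j}$ with $i\le n-j$ and replaces all others by $0$. The quasiseparable order of an $n\times n$ left triangular matrix is the maximal rank of its leading $k\times(n-k)$ submatrices, $1\le k\le n-1$ (and $0$ if $n\le 1$). The rank profile matrix of $A$ is the $0$-$1$ matrix $\mathcal R_A$ with at most one $1$ in each row and column such that each leading submatrix of $\mathcal R_A$ has the same rank as the corresponding one of $A$. A PLUQ decomposition $A=PLUQ$ of an $m\times n$ matrix of rank $r$ ($P,Q$ permutation matrices, $L$ an $m\times r$ unit lower triangular and $U$ an $r\times n$ upper triangular matrix with nonzero diagonal) *reveals the rank profile matrix* if $\mathcal R_A=P\begin{bmatrix}I_r&0\\0&0\end{bmatrix}Q$, the $m\times m$ matrix $P\begin{bmatrix}L&0\end{bmatrix}P^T$ is lower triangular and the $n\times n$ matrix $Q^T\begin{bmatrix}U\\0\end{bmatrix}Q$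 is upper triangular. A Bruhat generator of an $n\times n$ left triangular matrix $B$ is a triple $$\mathcal L=\mathrm{Left}\left(P\begin{bmatrix}L&0\end{bmatrix}Q\right),\quad \mathcal R=\mathrm{Left}\left(P\begin{bmatrix}I_r&0\\0&0\end{bmatrix}Q\right),\quad \mathcal U=\mathrm{Left}\left(P\begin{bmatrix}U\\0\end{bmatrix}Q\right)$$ for some PLUQ decomposition $B=PLUQ$ revealing the rank profile matrix of $B$. Algorithm LT-Bruhat. Input: an $n\times n$ matrix $A$. If $n=0$ return empty matrices; if $n=1$ return $([0],[0],[0])$. Otherwise: 1. Write $A=\begin{bmatrix}A_1&A_2\\A_3&*\end{bmatrix}$ with $A_3$ of size $\lfloor n/2\rfloor\times\lfloor n/2\rfloor$ (so $A_2$ has size $\lceil n/2\rceil\times\lceil n/2\rceil$). 2. Compute a PLUQ decomposition $A_1=P_1\begin{bmatrix}L_1\\M_1\end{bmatrix}\begin{bmatrix}U_1&V_1\end{bmatrix}Q_1$ revealing the rank profile matrix of $A_1$, where $L_1,U_1$ are $r_1\times r_1$, and set $R_1=P_1\begin{bmatrix}I_{r_1}&0\\0&0\end{bmatrix}Q_1$.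 3. Set $\begin{bmatrix}B_1\\B_2\end{bmatrix}=P_1^TA_2$ and $\begin{bmatrix}C_1&C_2\end{bmatrix}=A_3Q_1^T$, where $B_1$ has $r_1$ rows and $C_1$ has $r_1$ columns; compute $D=L_1^{-1}B_1$, $E=C_1U_1^{-1}$, $F=B_2-M_1D$, $G=C_2-EV_1$. 4. Set $H=P_1\begin{bmatrix}0\\F\end{bmatrix}$ and $I=\begin{bmatrix}0&G\end{bmatrix}Q_1$, and recursively compute $(\mathcal L_2,\mathcal R_2,\mathcal U_2)$ from $H$ and $(\mathcal L_3,\mathcal R_3,\mathcal U_3)$ from $I$. 5. Return $$\mathcal L=\begin{bmatrix}P_1\begin{bmatrix}L_1&0\\M_1&0\end{bmatrix}Q_1&0\\ \mathrm{Left}(\begin{bmatrix}E&0\end{bmatrix}Q_1)&0\end{bmatrix}+\begin{bmatrix}0&\mathcal L_2\\\mathcal L_3&0\end{bmatrix},\qquad \mathcal R=\begin{bmatrix}R_1&\mathcal R_2\\\mathcal R_3&0\end{bmatrix},$$ $$\mathcal U=\begin{bmatrix}P_1\begin{bmatrix}U_1&V_1\\0&0\end{bmatrix}Q_1&\mathrm{Left}\left(P_1\begin{bmatrix}D\\0\end{bmatrix}\right)\\0&0\end{bmatrix}+\begin{bmatrix}0&\mathcal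 U_2\\\mathcal U_3&0\end{bmatrix}.$$ Matrix products, the two triangular solves and the PLUQ decomposition are performed by subroutines. Theorem. Let $2<\omega\le3$ and $c\in\mathbb R$. There is a constant $C$, depending only on $\omega$ and $c$, such that for every field $K$: (a) For every correct choice of the subroutines, every $n$ and every $n\times n$ matrix $A$ over $K$, Algorithm LT-Bruhat computes a Bruhat generator of $\mathrm{Left}(A)$. (b) If for every $n$ two $n\times n$ matrices over $K$ can be multiplied in at most $c\,n^\omega$ field operations, then there are correct subroutines with which Algorithm LT-Bruhat uses at most $C\,\max(s,1)^{\omega-2}\,n^2$ field operations on every $n\times n$ matrix $A$ over $K$, where $s$ is the quasiseparable order of $\mathrm{Left}(A)$; that is, $O(s^{\omega-2}n^2)$ field operations for $s\ge1$. -/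

import Mathlib

open Matrix

universe u v

/-! ## Programs over a field

Field elements live in registers. A program only ever sees the *addresses* (natural numbers) of the
registers and the outcomes of its zero tests, never a field element itself, so whatever it learns
about its input it has to pay for. Every instruction costs one unit. -/

/-- The instructions that produce a new field element from the registers. -/
inductive FieldOp (K : Type u) : Type u where
  | const (c : K)
  | add (x y : ℕ)
  | sub (x y : ℕ)
  | mul (x y : ℕ)
  | div (x y : ℕ)

/-- A program over `K` returning an `α`. An instruction `op o k` stores the result of `o` in a fresh
register and continues with `k` applied to its address; `test x k` continues with `k` applied to the
answer to the question whether register `x` contains zero. -/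
inductive FieldProg (K : Type u) (α : Type) : Type u where
  | ret (a : α)
  | op (o : FieldOp K) (k : ℕ → FieldProg K α)
  | test (x : ℕ) (k : Bool → FieldProg K α)

namespace FieldOp

/-- The value of an instruction, given the contents of the registers. -/
def eval {K : Type u} [Field K] (mem : List K) : FieldOp K → K
  | const c => c
  | add x y => mem.getD x 0 + mem.getD y 0
  | sub x y => mem.getD x 0 - mem.getD y 0
  | mul x y => mem.getD x 0 * mem.getD y 0
  | div x y => mem.getD x 0 / mem.getD y 0

end FieldOp

namespace FieldProg

/-- Sequential composition. -/
def bind {K : Type u} {α β : Type} : FieldProg K α → (α → FieldProg K β) → FieldProg K β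
  | ret a, f => f a
  | op o k, f => op o fun x => (k x).bind f
  | test x k, f => test x fun b => (k b).bind f

instance {K : Type u} : Monad (FieldProg K) where
  pure := ret
  bind := bind

/-- The program that executes one instruction and returns the address of the result. -/
def exec {K : Type u} (o : FieldOp K) : FieldProg K ℕ := op o ret

/-- What running a program yields: its result, the final registers, and the number of
instructions (field operations, constants and zero tests) that were executed. -/
structure Outcome (K : Type u) (α : Type) : Type u where
  val : α
  mem : List K
  cost : ℕ

open scoped Classical in
/-- Running a program from given registers. New registers are appended at the end. -/
noncomputable def run {K : Type u} [Field K] {α : Type} :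
    FieldProg K α → List K → Outcome K α
  | ret a, mem => ⟨a, mem, 0⟩
  | op o k, mem =>
      let res := (k mem.length).run (mem ++ [o.eval mem])
      ⟨res.val, res.mem, res.cost + 1⟩
  | test x k, mem =>
      let res := (k (decide (mem.getD x 0 = 0))).run mem
      ⟨res.val, res.mem, res.cost + 1⟩

end FieldProg

/-- A matrix of register addresses. -/
abbrev AddrMatrix (m n : ℕ) : Type := Matrix (Fin m) (Fin n) ℕ

/-- The addresses `X` are allocated and hold the entries of the matrix `A`. -/
def Holds {K : Type u} {m n : ℕ} (mem : List K) (X : AddrMatrix m n)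
    (A : Matrix (Fin m) (Fin n) K) : Prop :=
  ∀ i j, mem[X i j]? = some (A i j)

/-- Two `n × n` matrices over `K` can be multiplied in at most `c * n ^ ω` field operations,
for every `n`. -/
def MatMulCost (K : Type u) [Field K] (ω c : ℝ) : Prop :=
  ∀ n : ℕ, ∃ p : AddrMatrix n n → AddrMatrix n n → FieldProg K (AddrMatrix n n),
    ∀ (mem : List K) (X Y : AddrMatrix n n) (A B : Matrix (Fin n) (Fin n) K),
      Holds mem X A → Holds mem Y B →
        Holds ((p X Y).run mem).mem ((p X Y).run mem).val (A * B) ∧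
        (((p X Y).run mem).cost : ℝ) ≤ c * (n : ℝ) ^ ω

/-- Run finitely many programs one after the other and collect their results. -/
def FieldProg.collect {K : Type u} {α : Type} :
    (n : ℕ) → (Fin n → FieldProg K α) → FieldProg K (Fin n → α)
  | 0, _ => pure Fin.elim0
  | n + 1, f => do
      let x ← f 0
      let v ← collect n fun i => f i.succ
      pure (Fin.cons x v)

/-- Apply a two-argument instruction entrywise to two matrices. -/
def entrywise {K : Type u} {m n : ℕ} (o : ℕ → ℕ → FieldOp K)
    (X Y : AddrMatrix m n) : FieldProg K (AddrMatrix m n) := do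
  let Z ← FieldProg.collect m fun i => FieldProg.collect n fun j => FieldProg.exec (o (X i j) (Y i j))
  pure (Matrix.of Z)

/-! ## Left triangular parts, rank profile matrices, PLUQ decompositions -/

/-- `Left(A)`: keep the entries `(i, j)` with `i ≤ n - j` (indices from `1`) of an `m × n` matrix
and replace all others by `z`. -/
def leftPartWith {α : Type v} {m n : ℕ} (z : α) (A : Matrix (Fin m) (Fin n) α) :
    Matrix (Fin m) (Fin n) α :=
  Matrix.of fun i j => if (i : ℕ) + 1 + ((j : ℕ) + 1) ≤ n then A i j else z

/-- The left triangular part of a matrix over a field. -/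
abbrev leftPart {K : Type u} [Field K] {m n : ℕ} (A : Matrix (Fin m) (Fin n) K) :
    Matrix (Fin m) (Fin n) K := leftPartWith 0 A

/-- The leading `k × l` submatrix (the whole range of indices if `k` or `l` is too large). -/
def leading {K : Type u} {m n : ℕ} (A : Matrix (Fin m) (Fin n) K) (k l : ℕ) :
    Matrix {i : Fin m // (i : ℕ) < k} {j : Fin n // (j : ℕ) < l} K :=
  A.submatrix Subtype.val Subtype.val

/-- The (left) quasiseparable order of an `n × n` left triangular matrix: the maximal rank of a
leading `k × (n - k)` submatrix. The value `k = 0` contributes `0`. -/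
noncomputable def quasisepOrder {K : Type u} [Field K] {n : ℕ} (A : Matrix (Fin n) (Fin n) K) : ℕ :=
  (Finset.range n).sup fun k => (leading A k (n - k)).rank

/-- `R` is the rank profile matrix of `A`: a `0`-`1` matrix with at most one nonzero entry in each
row and column, all of whose leading submatrices have the same rank as those of `A`. (It then has
exactly `rank A` nonzero entries.) -/
structure IsRankProfileMatrix {K : Type u} [Field K] {m n : ℕ}
    (A R : Matrix (Fin m) (Fin n) K) : Prop where
  zero_or_one : ∀ i j, R i j = 0 ∨ R i j = 1
  row_unique : ∀ i j j', R i j ≠ 0 → R i j' ≠ 0 → j = j'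
  col_unique : ∀ i i' j, R i j ≠ 0 → R i' j ≠ 0 → i = i'
  rank_leading : ∀ k l, (leading R k l).rank = (leading A k l).rank

/-- The data of a PLUQ decomposition, with entries in `α`: two permutations, an `m × r` matrix `L`
and an `r × n` matrix `U`. -/
structure PLUQ (α : Type v) (m n : ℕ) : Type v where
  r : ℕ
  r_le_rows : r ≤ m
  r_le_cols : r ≤ n
  P : Equiv.Perm (Fin m)
  Q : Equiv.Perm (Fin n)
  L : Matrix (Fin m) (Fin r) α
  U : Matrix (Fin r) (Fin n) α

/-- `[X 0]`: fill up with columns of entries `z` on the right. -/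
def padCols {α : Type v} {m r : ℕ} (z : α) (n : ℕ) (X : Matrix (Fin m) (Fin r) α) :
    Matrix (Fin m) (Fin n) α :=
  Matrix.of fun i j => if h : (j : ℕ) < r then X i ⟨j, h⟩ else z

/-- `[X; 0]`: fill up with rows of entries `z` below. -/
def padRows {α : Type v} {r n : ℕ} (z : α) (m : ℕ) (X : Matrix (Fin r) (Fin n) α) :
    Matrix (Fin m) (Fin n) α :=
  Matrix.of fun i j => if h : (i : ℕ) < r then X ⟨i, h⟩ j else z

/-- The `m × n` matrix with blocks `I_r`, `0`, `0`, `0`, with `z` and `o` for zero and one. -/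
def pivotBlock {α : Type v} (z o : α) (m n r : ℕ) : Matrix (Fin m) (Fin n) α :=
  Matrix.of fun i j => if (i : ℕ) = j ∧ (i : ℕ) < r then o else z

/-- `P * X * Q` for permutation matrices `P` and `Q`, on entries of any type; see
`permute_eq_mul`. -/
def permute {α : Type v} {m n : ℕ} (P : Equiv.Perm (Fin m)) (Q : Equiv.Perm (Fin n))
    (X : Matrix (Fin m) (Fin n) α) : Matrix (Fin m) (Fin n) α :=
  X.submatrix P Q.symm

theorem permute_eq_mul {K : Type u} [Field K] {m n : ℕ} (P : Equiv.Perm (Fin m))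
    (Q : Equiv.Perm (Fin n)) (X : Matrix (Fin m) (Fin n) K) :
    permute P Q X = P.permMatrix K * X * Q.permMatrix K := by
  ext i j
  simp [permute, Equiv.Perm.permMatrix, PEquiv.toMatrix_toPEquiv_mul,
    PEquiv.mul_toMatrix_toPEquiv]

theorem permute_symm_eq_mul {K : Type u} [Field K] {m n : ℕ} (P : Equiv.Perm (Fin m))
    (Q : Equiv.Perm (Fin n)) (X : Matrix (Fin m) (Fin n) K) :
    permute P.symm Q.symm X = (P.permMatrix K)ᵀ * X * (Q.permMatrix K)ᵀ := by
  rw [permute_eq_mul, Matrix.transpose_permMatrix, Matrix.transpose_permMatrix]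
  rfl

/-- `A = P L U Q` with `L` unit lower triangular and `U` upper triangular with nonzero diagonal. -/
structure IsPLUQ {K : Type u} [Field K] {m n : ℕ} (A : Matrix (Fin m) (Fin n) K)
    (d : PLUQ K m n) : Prop where
  eq_mul : A = d.P.permMatrix K * d.L * d.U * d.Q.permMatrix K
  L_upper : ∀ (i : Fin m) (j : Fin d.r), (i : ℕ) < j → d.L i j = 0
  L_diag : ∀ (i : Fin m) (j : Fin d.r), (i : ℕ) = j → d.L i j = 1
  U_lower : ∀ (i : Fin d.r) (j : Fin n), (j : ℕ) < i → d.U i j = 0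
  U_diag : ∀ (i : Fin d.r) (j : Fin n), (i : ℕ) = j → d.U i j ≠ 0

/-- A PLUQ decomposition revealing the rank profile matrix: `P [I_r 0; 0 0] Q` is the rank profile
matrix, `P [L 0] Pᵀ` is lower triangular and `Qᵀ [U; 0] Q` is upper triangular. -/
structure IsRevealingPLUQ {K : Type u} [Field K] {m n : ℕ} (A : Matrix (Fin m) (Fin n) K)
    (d : PLUQ K m n) : Prop extends IsPLUQ A d where
  rankProfile : IsRankProfileMatrix A
    (d.P.permMatrix K * pivotBlock (0 : K) 1 m n d.r * d.Q.permMatrix K)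
  PLPt_lower : ∀ i j, i < j →
    (d.P.permMatrix K * padCols 0 m d.L * (d.P.permMatrix K)ᵀ) i j = 0
  QtUQ_upper : ∀ i j, j < i →
    ((d.Q.permMatrix K)ᵀ * padRows 0 n d.U * d.Q.permMatrix K) i j = 0

/-- A triple of matrices `(ℒ, ℛ, 𝒰)`. -/
structure Triple (α : Type v) (n : ℕ) : Type v where
  L : Matrix (Fin n) (Fin n) α
  R : Matrix (Fin n) (Fin n) α
  U : Matrix (Fin n) (Fin n) α

/-- `(ℒ, ℛ, 𝒰)` is a Bruhat generator of the left triangular matrix `A`: for some PLUQ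
decomposition of `A` revealing its rank profile matrix,
`ℒ = Left(P [L 0] Q)`, `ℛ = Left(P [I_r 0; 0 0] Q)` and `𝒰 = Left(P [U; 0] Q)`. -/
def IsBruhatGenerator {K : Type u} [Field K] {n : ℕ} (A : Matrix (Fin n) (Fin n) K)
    (t : Triple K n) : Prop :=
  ∃ d : PLUQ K n n, IsRevealingPLUQ A d ∧
    t.L = leftPart (d.P.permMatrix K * padCols 0 n d.L * d.Q.permMatrix K) ∧
    t.R = leftPart (d.P.permMatrix K * pivotBlock (0 : K) 1 n n d.r * d.Q.permMatrix K) ∧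
    t.U = leftPart (d.P.permMatrix K * padRows 0 n d.U * d.Q.permMatrix K)

/-! ## The algorithm -/

/-- Implementations of the dense linear algebra that the algorithm calls: matrix product, the two
triangular solvers `(L, B) ↦ L⁻¹ B` and `(C, U) ↦ C U⁻¹`, and PLUQ decomposition. -/
structure Subroutines (K : Type u) : Type u where
  mul : (a b c : ℕ) → AddrMatrix a b → AddrMatrix b c → FieldProg K (AddrMatrix a c)
  solveLower : (r c : ℕ) → AddrMatrix r r → AddrMatrix r c → FieldProg K (AddrMatrix r c)
  solveUpper : (a r : ℕ) → AddrMatrix a r → AddrMatrix r r → FieldProg K (AddrMatrix a r)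
  pluq : (m n : ℕ) → AddrMatrix m n → FieldProg K (PLUQ ℕ m n)

/-- The subroutines compute what they are meant to, on all inputs. -/
structure Subroutines.Correct {K : Type u} [Field K] (S : Subroutines K) : Prop where
  mul : ∀ (a b c : ℕ) (mem : List K) (X : AddrMatrix a b) (Y : AddrMatrix b c)
    (A : Matrix (Fin a) (Fin b) K) (B : Matrix (Fin b) (Fin c) K),
    Holds mem X A → Holds mem Y B →
      Holds ((S.mul a b c X Y).run mem).mem ((S.mul a b c X Y).run mem).val (A * B)
  solveLower : ∀ (r c : ℕ) (mem : List K) (X : AddrMatrix r r) (Y : AddrMatrix r c)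
    (L : Matrix (Fin r) (Fin r) K) (B : Matrix (Fin r) (Fin c) K),
    Holds mem X L → Holds mem Y B → (∀ i j, i < j → L i j = 0) → (∀ i, L i i = 1) →
      Holds ((S.solveLower r c X Y).run mem).mem ((S.solveLower r c X Y).run mem).val (L⁻¹ * B)
  solveUpper : ∀ (a r : ℕ) (mem : List K) (X : AddrMatrix a r) (Y : AddrMatrix r r)
    (C : Matrix (Fin a) (Fin r) K) (U : Matrix (Fin r) (Fin r) K),
    Holds mem X C → Holds mem Y U → (∀ i j, j < i → U i j = 0) → (∀ i, U i i ≠ 0) →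
      Holds ((S.solveUpper a r X Y).run mem).mem ((S.solveUpper a r X Y).run mem).val (C * U⁻¹)
  pluq : ∀ (m n : ℕ) (mem : List K) (X : AddrMatrix m n) (A : Matrix (Fin m) (Fin n) K),
    Holds mem X A →
      let res := (S.pluq m n X).run mem
      ∃ (L : Matrix (Fin m) (Fin res.val.r) K) (U : Matrix (Fin res.val.r) (Fin n) K),
        Holds res.mem res.val.L L ∧ Holds res.mem res.val.U U ∧
        IsRevealingPLUQ A
          ⟨res.val.r, res.val.r_le_rows, res.val.r_le_cols, res.val.P, res.val.Q, L, U⟩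

/-- Cut `n` indices into the first `a` and the last `b`. -/
def cut {a b n : ℕ} (h : a + b = n) : Fin a ⊕ Fin b ≃ Fin n :=
  finSumFinEquiv.trans (finCongr h)

/-- Algorithm LT-Bruhat, for a given implementation of the subroutines. A matrix `A` of size
`n ≥ 2` is cut as `[A₁ A₂; A₃ *]` with `A₃` of size `⌊n/2⌋ × ⌊n/2⌋`; hence `A₁` is
`⌈n/2⌉ × ⌊n/2⌋` and `A₂` is `⌈n/2⌉ × ⌈n/2⌉`. Permuting and moving entries is free. -/
noncomputable def ltBruhat {K : Type u} [Field K] (S : Subroutines K) :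
    (n : ℕ) → AddrMatrix n n → FieldProg K (Triple ℕ n)
  | 0, A => pure ⟨A, A, A⟩
  | 1, _ => do
      let z ← FieldProg.exec (.const 0)
      pure ⟨Matrix.of fun _ _ => z, Matrix.of fun _ _ => z, Matrix.of fun _ _ => z⟩
  | k + 2, A => do
      let h := (k + 2) / 2
      let g := (k + 2) - (k + 2) / 2
      let rows : Fin g ⊕ Fin h ≃ Fin (k + 2) := cut (by omega)
      let cols : Fin h ⊕ Fin g ≃ Fin (k + 2) := cut (by omega)
      let A' := A.submatrix rows cols
      let A₁ := A'.toBlocks₁₁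
      let A₂ := A'.toBlocks₁₂
      let A₃ := A'.toBlocks₂₁
      let z ← FieldProg.exec (.const 0)
      let o ← FieldProg.exec (.const 1)
      -- A₁ = P₁ [L₁; M₁] [U₁ V₁] Q₁
      let d ← S.pluq g h A₁
      let r := d.r
      let rowCut : Fin r ⊕ Fin (g - r) ≃ Fin g := cut (Nat.add_sub_cancel' d.r_le_rows)
      let colCut : Fin r ⊕ Fin (h - r) ≃ Fin h := cut (Nat.add_sub_cancel' d.r_le_cols)
      let L₁ := (d.L.submatrix rowCut id).toRows₁
      let M₁ := (d.L.submatrix rowCut id).toRows₂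
      let U₁ := (d.U.submatrix id colCut).toCols₁
      let V₁ := (d.U.submatrix id colCut).toCols₂
      let R₁ := permute d.P d.Q (pivotBlock z o g h r)
      -- [B₁; B₂] = P₁ᵀ A₂ and [C₁ C₂] = A₃ Q₁ᵀ
      let B := (permute d.P.symm 1 A₂).submatrix rowCut id
      let C := (permute 1 d.Q.symm A₃).submatrix id colCut
      let D ← S.solveLower r g L₁ B.toRows₁
      let E ← S.solveUpper h r C.toCols₁ U₁
      let M₁D ← S.mul (g - r) r g M₁ D
      let F ← entrywise .sub B.toRows₂ M₁D
      let EV₁ ← S.mul h r (h - r) E V₁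
      let G ← entrywise .sub C.toCols₂ EV₁
      -- H = P₁ [0; F] and I = [0 G] Q₁
      let H := permute d.P 1
        ((Matrix.fromRows (Matrix.of fun _ _ => z) F).submatrix rowCut.symm id)
      let I := permute 1 d.Q
        ((Matrix.fromCols (Matrix.of fun _ _ => z) G).submatrix id colCut.symm)
      let t₂ ← ltBruhat S g H
      let t₃ ← ltBruhat S h I
      let 𝒪 : AddrMatrix h g := Matrix.of fun _ _ => z
      let outL ← entrywise .add
        ((Matrix.fromBlocks
          (permute d.P d.Q (padCols z h d.L)) (Matrix.of fun _ _ => z)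
          (leftPartWith z (permute 1 d.Q (padCols z h E))) 𝒪).submatrix rows.symm cols.symm)
        ((Matrix.fromBlocks
          (Matrix.of fun _ _ => z) t₂.L
          t₃.L 𝒪).submatrix rows.symm cols.symm)
      let outU ← entrywise .add
        ((Matrix.fromBlocks
          (permute d.P d.Q (padRows z g d.U)) (leftPartWith z (permute d.P 1 (padRows z g D)))
          (Matrix.of fun _ _ => z) 𝒪).submatrix rows.symm cols.symm)
        ((Matrix.fromBlocks
          (Matrix.of fun _ _ => z) t₂.U
          t₃.U 𝒪).submatrix rows.symm cols.symm)
      let outR := (Matrix.fromBlocks R₁ t₂.R t₃.R 𝒪).submatrix rows.symm cols.symm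
      pure ⟨outL, outR, outU⟩
  termination_by n => n
  decreasing_by all_goals omega

/-! Correctness. Stripped of its permutations, a PLUQ decomposition revealing the rank profile
matrix is a list of pivots with two factors that are triangular both in the order of the pivots and
in the order of rows and columns (`IsPivoting`, `isRevealingPLUQ_iff`). Leading ranks then count
pivots (`IsPivoting.rank_leading`), so the rank profile matrix comes for free. In the recursion, $H$
vanishes on the pivot rows of $A_1$ and $I$ on its pivot columns. Hence the pivots of $A_1$,
$\mathrm{Left}(H)$ and $\mathrm{Left}(I)$ can be concatenated, with $D$ and $E$ extending the
factors of $A_1$ (`IsPivoting.exists_glue`).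

The product of the combined factors has blocks $LD+\mathrm{Left}(H)$, $EU+\mathrm{Left}(I)$ and
$ED$, so it agrees with $\mathrm{Left}(A)$ only on the left triangle. This is enough
(`IsPivoting.isBruhatGenerator_of_leftPart_eq`). Pivots outside the triangle contribute nothing
inside it. Those inside are also valid pivots for $\mathrm{Left}(A)$ itself, and eliminating with
them leaves a matrix that is zero on the triangle. The remaining pivots of that matrix lie outside
the triangle, where the Bruhat generator does not see them (`exists_completion`).

Cost. The rank of $A_1$ is at most $s$. A leading $k\times l$ block of $H$ arises by column
operations from the leading $k\times(\lfloor n/2\rfloor+l)$ block of $A$, so the quasiseparable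
order does not grow (`quasisepOrder_upper_le`, and `quasisepOrder_lower_le` for $I$). If every
subroutine costs $O(\max(r,1)^{\omega-2}N^2)$, with $r$ the rank or inner dimension and $N$ a bound
on the sizes, then the recursion has two half-size calls with the same $s$ and overhead
$O(\max(s,1)^{\omega-2}n^2)$. The squares decrease geometrically, so no logarithm appears
(`wp_ltBruhat`).

Such subroutines come from square multiplication. Rectangular products are cut into squares of the
inner dimension (`wp_rectMul`), and triangular matrices are inverted by halves (`wp_lowerInv`).
Rank-sensitive elimination halves the set of rows (`wp_elim`): with $\theta=\omega-2\in(0,1]$,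
concavity gives $r_1^\theta+r_2^\theta\le 2\cdot2^{-\theta}(r_1+r_2)^\theta$, and the gain
$2^{-\theta}<1$ pays for the updates. -/

/-! ### Program logic: correctness and cost as postconditions -/

namespace FieldProg

variable {K : Type u} {α β : Type}

/-- Weakest precondition: running `p` from `mem` ends with registers, result and cost
that satisfy `Φ`. -/
def wp [Field K] (p : FieldProg K α) (mem : List K) (Φ : List K → α → ℕ → Prop) : Prop :=
  Φ (p.run mem).mem (p.run mem).val (p.run mem).cost

theorem run_bind [Field K] (p : FieldProg K α) (f : α → FieldProg K β) (mem : List K) :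
    (p >>= f).run mem =
      ⟨((f (p.run mem).val).run (p.run mem).mem).val,
        ((f (p.run mem).val).run (p.run mem).mem).mem,
        (p.run mem).cost + ((f (p.run mem).val).run (p.run mem).mem).cost⟩ := by
  change (p.bind f).run mem = _
  induction p generalizing mem with
  | ret a => simp [FieldProg.bind, run]
  | op o k ih => simp [FieldProg.bind, run, ih, add_assoc, add_comm, add_left_comm]
  | test x k ih => simp [FieldProg.bind, run, ih, add_assoc, add_comm, add_left_comm]

/-- Registers are only ever appended, so addresses handed out earlier keep their contents. Every
later transport of register contents rests on this. -/
theorem prefix_run [Field K] (p : FieldProg K α) (mem : List K) : mem <+: (p.run mem).mem := by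
  induction p generalizing mem with
  | ret a => simp [run]
  | op o k ih => exact (List.prefix_append _ _).trans (ih _ _)
  | test x k ih => exact ih _ _

theorem wp_bind [Field K] {p : FieldProg K α} {f : α → FieldProg K β} {mem : List K}
    {Φ : List K → β → ℕ → Prop} :
    (p >>= f).wp mem Φ ↔
      p.wp mem fun mem₁ a c₁ => (f a).wp mem₁ fun mem₂ b c₂ => Φ mem₂ b (c₁ + c₂) := by
  simp [wp, run_bind]

theorem wp_pure [Field K] {a : α} {mem : List K} {Φ : List K → α → ℕ → Prop} :
    (pure a : FieldProg K α).wp mem Φ ↔ Φ mem a 0 := Iff.rfl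

theorem wp.mono [Field K] {p : FieldProg K α} {mem : List K} {Φ Ψ : List K → α → ℕ → Prop}
    (h : p.wp mem Φ) (hΦ : ∀ mem' a c, mem <+: mem' → Φ mem' a c → Ψ mem' a c) : p.wp mem Ψ :=
  hΦ _ _ _ (prefix_run _ _) h

/-- The rule for sequential composition, with the growth of the registers recorded. -/
theorem wp.bind [Field K] {p : FieldProg K α} {f : α → FieldProg K β} {mem : List K}
    {Φ : List K → α → ℕ → Prop} {Ψ : List K → β → ℕ → Prop} (h : p.wp mem Φ)
    (hf : ∀ mem₁ a c₁, mem <+: mem₁ → Φ mem₁ a c₁ →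
      (f a).wp mem₁ fun mem₂ b c₂ => Ψ mem₂ b (c₁ + c₂)) : (p >>= f).wp mem Ψ :=
  wp_bind.2 (h.mono hf)

theorem wp_exec [Field K] (o : FieldOp K) (mem : List K) :
    (exec o).wp mem fun mem' x c => mem'[x]? = some (o.eval mem) ∧ c = 1 := by
  simp [wp, exec, run]

theorem wp_test [Field K] {x : ℕ} {mem : List K} {a : K} (h : mem[x]? = some a) :
    (test x ret : FieldProg K Bool).wp mem fun _ b c => (b = true ↔ a = 0) ∧ c = 1 := by
  classical
  have h' : mem.getD x 0 = a := by simp [List.getD, h]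
  refine ⟨?_, rfl⟩
  rw [← h']
  simp only [run]
  exact decide_eq_true_iff

/-- Each postcondition must be stable under growth of the registers, because the results of earlier
programs have to survive the later ones. -/
theorem wp_collect [Field K] {n : ℕ} {f : Fin n → FieldProg K α} {mem : List K} {c : ℝ}
    {Φ : Fin n → List K → α → Prop}
    (hmono : ∀ i mem₁ mem₂ a, mem₁ <+: mem₂ → Φ i mem₁ a → Φ i mem₂ a)
    (h : ∀ i mem₁, mem <+: mem₁ →
      (f i).wp mem₁ fun mem₂ a c₂ => Φ i mem₂ a ∧ (c₂ : ℝ) ≤ c) :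
    (collect n f).wp mem fun mem₁ v c₁ => (∀ i, Φ i mem₁ (v i)) ∧ (c₁ : ℝ) ≤ n * c := by
  induction n generalizing mem with
  | zero => exact wp_pure.2 ⟨fun i => i.elim0, by simp⟩
  | succ n ih =>
    refine (h 0 mem List.prefix_rfl).bind fun mem₁ a c₁ h₁ ⟨ha, hc₁⟩ => ?_
    refine (ih (f := fun i => f i.succ) (Φ := fun i => Φ i.succ)
      (fun i => hmono i.succ) fun i mem₂ h₂ => h i.succ mem₂ (h₁.trans h₂)).bind
      fun mem₂ v c₂ h₂ ⟨hv, hc₂⟩ => ?_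
    refine wp_pure.2 ⟨fun i => ?_, ?_⟩
    · cases i using Fin.cases with
      | zero => exact hmono _ _ _ _ h₂ ha
      | succ i => exact hv i
    · push_cast
      linarith

end FieldProg

theorem List.IsPrefix.getElem?_of_eq_some {K : Type u} {mem mem' : List K} (h : mem <+: mem')
    {x : ℕ} {a : K} (hx : mem[x]? = some a) : mem'[x]? = some a := by
  obtain ⟨t, rfl⟩ := h
  rw [List.getElem?_append_left]
  · exact hx
  · exact (List.getElem?_eq_some_iff.1 hx).1

/-! ### Matrices stored in registers, entrywise operations -/

section Holds

variable {K : Type u} {m n : ℕ} {mem mem' : List K}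

theorem Holds.mono {X : AddrMatrix m n} {A : Matrix (Fin m) (Fin n) K} (h : Holds mem X A)
    (hm : mem <+: mem') : Holds mem' X A := fun i j => hm.getElem?_of_eq_some (h i j)

theorem Holds.submatrix {a b : ℕ} {X : AddrMatrix m n} {A : Matrix (Fin m) (Fin n) K}
    (h : Holds mem X A) (f : Fin a → Fin m) (g : Fin b → Fin n) :
    Holds mem (X.submatrix f g) (A.submatrix f g) := fun i j => h (f i) (g j)

theorem Holds.transpose {X : AddrMatrix m n} {A : Matrix (Fin m) (Fin n) K}
    (h : Holds mem X A) : Holds mem Xᵀ Aᵀ := fun i j => h j i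

theorem wp_entrywise [Field K] (o : ℕ → ℕ → FieldOp K) (φ : K → K → K)
    (ho : ∀ (mem : List K) x y a b, mem[x]? = some a → mem[y]? = some b →
      (o x y).eval mem = φ a b)
    {X Y : AddrMatrix m n} {A B : Matrix (Fin m) (Fin n) K} (hX : Holds mem X A)
    (hY : Holds mem Y B) :
    (entrywise o X Y).wp mem fun mem' Z c =>
      Holds mem' Z (Matrix.of fun i j => φ (A i j) (B i j)) ∧ (c : ℝ) ≤ m * n := by
  have hrow : ∀ i mem₁, mem <+: mem₁ →
      (FieldProg.collect n fun j => FieldProg.exec (o (X i j) (Y i j))).wp mem₁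
        fun mem₂ v c => (∀ j, mem₂[v j]? = some (φ (A i j) (B i j))) ∧ (c : ℝ) ≤ n * 1 := by
    intro i mem₁ h₁
    refine FieldProg.wp_collect (Φ := fun j mem x => mem[x]? = some (φ (A i j) (B i j)))
      (fun j mem₁ mem₂ a h ha => h.getElem?_of_eq_some ha) fun j mem₂ h₂ =>
        (FieldProg.wp_exec _ _).mono fun mem₃ x c h₃ h => ⟨?_, by simp [h.2]⟩
    rw [h.1, ho _ _ _ _ _ (((hX.mono h₁).mono h₂) i j) (((hY.mono h₁).mono h₂) i j)]
  refine (FieldProg.wp_collect (Φ := fun i mem v => ∀ j, mem[v j]? = some (φ (A i j) (B i j)))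
    (fun i mem₁ mem₂ v h hv j => h.getElem?_of_eq_some (hv j)) hrow).bind
    fun mem₁ v c₁ h₁ ⟨hv, hc⟩ => FieldProg.wp_pure.2 ⟨fun i j => hv i j, ?_⟩
  simpa using hc

theorem wp_entrywise_add [Field K] {X Y : AddrMatrix m n} {A B : Matrix (Fin m) (Fin n) K}
    (hX : Holds mem X A) (hY : Holds mem Y B) :
    (entrywise (K := K) .add X Y).wp mem fun mem' Z c =>
      Holds mem' Z (A + B) ∧ (c : ℝ) ≤ m * n :=
  wp_entrywise _ (· + ·) (fun mem x y a b hx hy => by simp [FieldOp.eval, List.getD, hx, hy]) hX hY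

theorem wp_entrywise_sub [Field K] {X Y : AddrMatrix m n} {A B : Matrix (Fin m) (Fin n) K}
    (hX : Holds mem X A) (hY : Holds mem Y B) :
    (entrywise (K := K) .sub X Y).wp mem fun mem' Z c =>
      Holds mem' Z (A - B) ∧ (c : ℝ) ≤ m * n :=
  wp_entrywise _ (· - ·) (fun mem x y a b hx hy => by simp [FieldOp.eval, List.getD, hx, hy]) hX hY

end Holds

theorem sum_subtype_of_forall_not {M ι : Type*} [AddCommMonoid M] [Fintype ι] {P : ι → Prop}
    [Fintype {t // P t}] {f : ι → M} (h : ∀ t, ¬ P t → f t = 0) :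
    ∑ t : {t // P t}, f t = ∑ t, f t := by
  classical
  rw [← Finset.sum_subset (Finset.subset_univ (Finset.univ.filter P))
    fun t _ ht => h t (by simpa using ht)]
  exact (Finset.sum_subtype _ (by simp) f).symm

/-! ### Pivot lists: ranks and rank profile matrices -/

section Pivoting

variable {K : Type u} [Field K] {ι : Type} {m n : ℕ}

/-- `L` and `U` are the factors of an elimination with pivots at `(p t, q t)`, processed in the
order of increasing `ord t`, such that `L` and `U` are also lower and upper triangular with
respect to the order of rows and columns. -/
structure IsPivoting (ord : ι → ℕ) (p : ι → Fin m) (q : ι → Fin n)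
    (L : Matrix (Fin m) ι K) (U : Matrix ι (Fin n) K) : Prop where
  ord_inj : Function.Injective ord
  row_inj : Function.Injective p
  col_inj : Function.Injective q
  L_lower : ∀ i t, i < p t → L i t = 0
  L_pivot : ∀ s t, ord s < ord t → L (p s) t = 0
  L_diag : ∀ t, L (p t) t = 1
  U_upper : ∀ t j, j < q t → U t j = 0
  U_pivot : ∀ s t, ord s < ord t → U t (q s) = 0
  U_diag : ∀ t, U t (q t) ≠ 0

theorem isUnit_of_lower [Fintype ι] [DecidableEq ι] {ord : ι → ℕ} (hord : Function.Injective ord)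
    (M : Matrix ι ι K) (h : ∀ s t, ord s < ord t → M s t = 0) (hd : ∀ t, M t t ≠ 0) :
    IsUnit M := by
  let _ : LinearOrder ι := LinearOrder.lift' ord hord
  rw [Matrix.isUnit_iff_isUnit_det,
    Matrix.det_of_isLowerTriangular M (fun s t hst => h s t hst)]
  exact (Finset.prod_ne_zero_iff.2 fun t _ => hd t).isUnit

theorem isUnit_of_upper [Fintype ι] [DecidableEq ι] {ord : ι → ℕ} (hord : Function.Injective ord)
    (M : Matrix ι ι K) (h : ∀ s t, ord s < ord t → M t s = 0) (hd : ∀ t, M t t ≠ 0) :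
    IsUnit M :=
  (Matrix.isUnit_transpose M).1 (isUnit_of_lower hord Mᵀ (fun s t => h s t) hd)

/-- A matrix of pivot rows. -/
def rowSelector (K : Type u) [Field K] (p : ι → Fin m) : Matrix (Fin m) ι K :=
  Matrix.of fun i t => if p t = i then 1 else 0

/-- A matrix of pivot columns. -/
def colSelector (K : Type u) [Field K] (q : ι → Fin n) : Matrix ι (Fin n) K :=
  Matrix.of fun t j => if q t = j then 1 else 0

namespace IsPivoting

variable {ord : ι → ℕ} {p : ι → Fin m} {q : ι → Fin n} {L : Matrix (Fin m) ι K}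
  {U : Matrix ι (Fin n) K}

theorem isUnit_L [Fintype ι] [DecidableEq ι] (h : IsPivoting ord p q L U) :
    IsUnit (L.submatrix p id) :=
  isUnit_of_lower h.ord_inj _ h.L_pivot fun t => by simp [h.L_diag]

theorem isUnit_U [Fintype ι] [DecidableEq ι] (h : IsPivoting ord p q L U) :
    IsUnit (U.submatrix id q) :=
  isUnit_of_upper h.ord_inj _ h.U_pivot h.U_diag

theorem L_ne_zero (h : IsPivoting ord p q L U) (t : ι) : L (p t) t ≠ 0 := by simp [h.L_diag]

/-- A zero row of `L U` is a zero row of `L`. -/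
theorem L_eq_zero_of_row [Fintype ι] (h : IsPivoting ord p q L U) {i : Fin m}
    (hi : ∀ j, (L * U) i j = 0) (t : ι) : L i t = 0 := by
  classical
  have h1 : (L * U).submatrix id q * (U.submatrix id q)⁻¹ = L := by
    change L * U.submatrix id q * _ = _
    rw [Matrix.mul_assoc, Matrix.mul_nonsing_inv _ ((Matrix.isUnit_iff_isUnit_det _).1 h.isUnit_U),
      Matrix.mul_one]
  rw [← h1, Matrix.mul_apply]
  exact Finset.sum_eq_zero fun s _ => by simp [hi]

/-- A zero column of `L U` is a zero column of `U`. -/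
theorem U_eq_zero_of_col [Fintype ι] (h : IsPivoting ord p q L U) {j : Fin n}
    (hj : ∀ i, (L * U) i j = 0) (t : ι) : U t j = 0 := by
  classical
  have h1 : (L.submatrix p id)⁻¹ * (L * U).submatrix p id = U := by
    change (L.submatrix p id)⁻¹ * (L.submatrix p id * U) = _
    rw [← Matrix.mul_assoc,
      Matrix.nonsing_inv_mul _ ((Matrix.isUnit_iff_isUnit_det _).1 h.isUnit_L), Matrix.one_mul]
  rw [← h1, Matrix.mul_apply]
  exact Finset.sum_eq_zero fun s _ => by simp [hj]

theorem comp {κ : Type} (h : IsPivoting ord p q L U) (f : κ → ι) (hf : Function.Injective f) :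
    IsPivoting (ord ∘ f) (p ∘ f) (q ∘ f) (L.submatrix id f) (U.submatrix f id) where
  ord_inj := h.ord_inj.comp hf
  row_inj := h.row_inj.comp hf
  col_inj := h.col_inj.comp hf
  L_lower i t := h.L_lower i (f t)
  L_pivot s t := h.L_pivot (f s) (f t)
  L_diag t := h.L_diag (f t)
  U_upper t j := h.U_upper (f t) j
  U_pivot s t := h.U_pivot (f s) (f t)
  U_diag t := h.U_diag (f t)

theorem congr_ord (h : IsPivoting ord p q L U) {ord' : ι → ℕ}
    (ho : ∀ s t, ord s < ord t ↔ ord' s < ord' t) : IsPivoting ord' p q L U where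
  ord_inj s t hst := h.ord_inj <| by
    have h1 := ho s t
    have h2 := ho t s
    omega
  row_inj := h.row_inj
  col_inj := h.col_inj
  L_lower := h.L_lower
  L_pivot s t hst := h.L_pivot s t ((ho s t).2 hst)
  L_diag := h.L_diag
  U_upper := h.U_upper
  U_pivot s t hst := h.U_pivot s t ((ho s t).2 hst)
  U_diag := h.U_diag

/-- The 0-1 matrices of the pivots form a pivoting with the same pivots. Applying `rank_leading` to
both pivotings shows that their products have the same leading ranks, which is the rank profile
condition. -/
theorem selectors (h : IsPivoting ord p q L U) :
    IsPivoting ord p q (rowSelector K p) (colSelector K q) where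
  ord_inj := h.ord_inj
  row_inj := h.row_inj
  col_inj := h.col_inj
  L_lower i t hi := by simp [rowSelector, hi.ne']
  L_pivot s t hst := by
    have : p t ≠ p s := fun e => hst.ne (by rw [h.row_inj e])
    simp [rowSelector, this]
  L_diag t := by simp [rowSelector]
  U_upper t j hj := by simp [colSelector, hj.ne']
  U_pivot s t hst := by
    have : q t ≠ q s := fun e => hst.ne (by rw [h.col_inj e])
    simp [colSelector, this]
  U_diag t := by simp [colSelector]

/-- The rank of a leading submatrix is the number of pivots in it. -/
theorem rank_leading [Fintype ι] (h : IsPivoting ord p q L U) (k l : ℕ) :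
    (leading (L * U) k l).rank = Fintype.card {t : ι // (p t : ℕ) < k ∧ (q t : ℕ) < l} := by
  classical
  set T := {t : ι // (p t : ℕ) < k ∧ (q t : ℕ) < l}
  have hT := h.comp (Subtype.val : T → ι) Subtype.val_injective
  set L' : Matrix {i : Fin m // (i : ℕ) < k} T K := L.submatrix Subtype.val Subtype.val
  set U' : Matrix T {j : Fin n // (j : ℕ) < l} K := U.submatrix Subtype.val Subtype.val
  -- Pivots outside the leading block do not contribute to it: below row `k` the column of `L`
  -- vanishes on the block, and beyond column `l` the row of `U` does. This bounds the rank from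
  -- above by the number of the other pivots.
  have hLU : leading (L * U) k l = L' * U' := by
    ext i j
    simp only [leading, Matrix.submatrix_apply, Matrix.mul_apply, L', U']
    refine (sum_subtype_of_forall_not (f := fun t => L i.1 t * U t j.1) fun t ht => ?_).symm
    rcases not_and_or.1 ht with ht | ht
    · rw [h.L_lower _ _ (by rw [Fin.lt_def]; have := i.2; omega), zero_mul]
    · rw [h.U_upper _ _ (by rw [Fin.lt_def]; have := j.2; omega), mul_zero]
  rw [hLU]
  refine le_antisymm ((Matrix.rank_mul_le_left _ _).trans (Matrix.rank_le_card_width _)) ?_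
  -- On the pivot rows and columns the product is a product of two invertible triangular matrices,
  -- which gives the lower bound.
  have h2 : ((L' * U').submatrix (fun t : T => ⟨p t.1, t.2.1⟩) (fun t : T => ⟨q t.1, t.2.2⟩)).rank
      = Fintype.card T := by
    refine Matrix.rank_of_isUnit _ ?_
    exact hT.isUnit_L.mul hT.isUnit_U
  rw [← h2]
  exact Matrix.rank_submatrix_le (L' * U') _ _

theorem rank_mul [Fintype ι] (h : IsPivoting ord p q L U) : (L * U).rank = Fintype.card ι := by
  classical
  refine le_antisymm ((Matrix.rank_mul_le_left _ _).trans (Matrix.rank_le_card_width _)) ?_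
  have h1 := h.isUnit_L.mul h.isUnit_U
  have h2 := Matrix.rank_of_isUnit _ h1
  have h3 : (L.submatrix p id * U.submatrix id q).rank ≤ (L * U).rank :=
    Matrix.rank_submatrix_le (L * U) p q
  exact h2.symm.trans_le h3

theorem isRankProfileMatrix [Fintype ι] (h : IsPivoting ord p q L U) :
    IsRankProfileMatrix (L * U) (rowSelector K p * colSelector K q) := by
  classical
  have key : ∀ i j, (rowSelector K p * colSelector K q) i j =
      if ∃ t, p t = i ∧ q t = j then 1 else 0 := by
    intro i j
    rw [Matrix.mul_apply]
    split_ifs with hij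
    · obtain ⟨t, rfl, rfl⟩ := hij
      rw [Finset.sum_eq_single t]
      · simp [rowSelector, colSelector]
      · intro s _ hs
        simp [rowSelector, h.row_inj.ne hs]
      · simp
    · refine Finset.sum_eq_zero fun t _ => ?_
      by_cases hp : p t = i
      · simp [colSelector, show q t ≠ j from fun e => hij ⟨t, hp, e⟩]
      · simp [rowSelector, hp]
  have key' : ∀ i j, (rowSelector K p * colSelector K q) i j ≠ 0 → ∃ t, p t = i ∧ q t = j := by
    intro i j hij
    by_contra hne
    exact hij (by rw [key, if_neg hne])
  refine ⟨fun i j => ?_, fun i j j' h1 h2 => ?_, fun i i' j h1 h2 => ?_, fun k l => ?_⟩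
  · rw [key]
    split_ifs <;> simp
  · obtain ⟨t, ht, rfl⟩ := key' _ _ h1
    obtain ⟨t', ht', rfl⟩ := key' _ _ h2
    rw [h.row_inj (ht.trans ht'.symm)]
  · obtain ⟨t, rfl, ht⟩ := key' _ _ h1
    obtain ⟨t', rfl, ht'⟩ := key' _ _ h2
    rw [h.col_inj (ht.trans ht'.symm)]
  · rw [h.rank_leading, h.selectors.rank_leading]

end IsPivoting

end Pivoting

/-! ### Revealing PLUQ decompositions are pivotings -/

section PLUQ

variable {K : Type u} [Field K] {m n : ℕ}

namespace PLUQ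

/-- The rows of the pivots. -/
def row {α : Type v} (d : PLUQ α m n) (t : Fin d.r) : Fin m := d.P.symm (Fin.castLE d.r_le_rows t)

/-- The columns of the pivots. -/
def col {α : Type v} (d : PLUQ α m n) (t : Fin d.r) : Fin n := d.Q (Fin.castLE d.r_le_cols t)

/-- The product `P L`. -/
def lower {α : Type v} (d : PLUQ α m n) : Matrix (Fin m) (Fin d.r) α := d.L.submatrix d.P id

/-- The product `U Q`. -/
def upper {α : Type v} (d : PLUQ α m n) : Matrix (Fin d.r) (Fin n) α := d.U.submatrix id d.Q.symm

end PLUQ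

theorem permute_padCols {m r : ℕ} (hr : r ≤ n) (P : Equiv.Perm (Fin m)) (Q : Equiv.Perm (Fin n))
    (X : Matrix (Fin m) (Fin r) K) :
    permute P Q (padCols 0 n X) =
      X.submatrix P id * colSelector K fun t => Q (Fin.castLE hr t) := by
  ext i j
  simp only [permute, padCols, Matrix.submatrix_apply, Matrix.of_apply, Matrix.mul_apply,
    colSelector, mul_ite, mul_one, mul_zero]
  split_ifs with h
  · rw [Finset.sum_eq_single ⟨_, h⟩]
    · simp
    · intro t _ ht
      refine if_neg fun e => ht ?_
      ext
      simp [← e]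
    · simp
  · refine (Finset.sum_eq_zero fun t _ => if_neg fun e => h ?_).symm
    simp [← e]

theorem permute_transpose {α : Type v} (P : Equiv.Perm (Fin m)) (Q : Equiv.Perm (Fin n))
    (X : Matrix (Fin m) (Fin n) α) : (permute P Q X)ᵀ = permute Q.symm P.symm Xᵀ := rfl

theorem permute_padRows {r : ℕ} (hr : r ≤ m) (P : Equiv.Perm (Fin m)) (Q : Equiv.Perm (Fin n))
    (X : Matrix (Fin r) (Fin n) K) :
    permute P Q (padRows 0 m X) =
      (rowSelector K fun t => P.symm (Fin.castLE hr t)) * X.submatrix id Q.symm := by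
  have h := permute_padCols hr Q.symm P.symm Xᵀ
  have h1 : padCols 0 m Xᵀ = (padRows 0 m X)ᵀ := rfl
  rw [h1, ← permute_transpose] at h
  rw [← Matrix.transpose_inj, h, Matrix.transpose_mul]
  rfl

theorem permute_pivotBlock {r : ℕ} (hrm : r ≤ m) (hrn : r ≤ n) (P : Equiv.Perm (Fin m))
    (Q : Equiv.Perm (Fin n)) :
    permute P Q (pivotBlock (0 : K) 1 m n r) =
      (rowSelector K fun t => P.symm (Fin.castLE hrm t)) *
        colSelector K fun t => Q (Fin.castLE hrn t) := by
  have h : pivotBlock (0 : K) 1 m n r =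
      padRows 0 m (Matrix.of fun (t : Fin r) (j : Fin n) =>
          if (t : ℕ) = j then (1 : K) else 0) := by
    ext i j
    simp only [pivotBlock, padRows, Matrix.of_apply]
    by_cases hi : (i : ℕ) < r <;> simp [hi]
  rw [h, permute_padRows hrm]
  congr 1
  ext t j
  simp [colSelector, ← Equiv.eq_symm_apply, Fin.ext_iff]

theorem IsPLUQ.eq_lower_mul_upper {A : Matrix (Fin m) (Fin n) K} {d : PLUQ K m n}
    (h : IsPLUQ A d) : A = d.lower * d.upper := by
  have h1 := permute_eq_mul d.P d.Q (d.L * d.U)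
  rw [h.eq_mul, Matrix.mul_assoc (d.P.permMatrix K), ← h1]
  rfl

/-- Triangularity of $L$ and $U$ is triangularity in the order of the pivots; triangularity of $P[L\
0]P^T$ and $Q^T[U;0]Q$ is triangularity in the order of rows and columns. From right to left, the
rank profile condition follows from `IsPivoting.isRankProfileMatrix`. -/
theorem isRevealingPLUQ_iff {A : Matrix (Fin m) (Fin n) K} {d : PLUQ K m n} :
    IsRevealingPLUQ A d ↔
      A = d.lower * d.upper ∧
        IsPivoting (fun t : Fin d.r => (t : ℕ)) d.row d.col d.lower d.upper := by
  have hmul : d.P.permMatrix K * d.L * d.U * d.Q.permMatrix K = d.lower * d.upper := by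
    rw [Matrix.mul_assoc (d.P.permMatrix K), ← permute_eq_mul]
    rfl
  have hR : d.P.permMatrix K * pivotBlock (0 : K) 1 m n d.r * d.Q.permMatrix K =
      rowSelector K d.row * colSelector K d.col := by
    rw [← permute_eq_mul, permute_pivotBlock d.r_le_rows d.r_le_cols]
    rfl
  have hP : d.P.permMatrix K * padCols 0 m d.L * (d.P.permMatrix K)ᵀ =
      permute d.P d.P.symm (padCols 0 m d.L) := by
    rw [permute_eq_mul, Matrix.transpose_permMatrix]
    rfl
  have hQ : (d.Q.permMatrix K)ᵀ * padRows 0 n d.U * d.Q.permMatrix K =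
      permute d.Q.symm d.Q (padRows 0 n d.U) := by
    rw [permute_eq_mul, Matrix.transpose_permMatrix]
    rfl
  constructor
  · intro h
    refine ⟨h.eq_lower_mul_upper, Fin.val_injective,
      d.P.symm.injective.comp (Fin.castLE_injective _), d.Q.injective.comp (Fin.castLE_injective _),
      fun i t hi => ?_, fun s t hst => ?_, fun t => ?_, fun t j hj => ?_, fun s t hst => ?_,
      fun t => ?_⟩
    · have := h.PLPt_lower i (d.row t) hi
      rw [hP] at this
      simpa [permute, padCols, PLUQ.row, PLUQ.lower] using this
    · exact h.L_upper _ _ (by simpa [PLUQ.row] using hst)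
    · exact h.L_diag _ _ (by simp [PLUQ.row])
    · have := h.QtUQ_upper (d.col t) j hj
      rw [hQ] at this
      simpa [permute, padRows, PLUQ.col, PLUQ.upper] using this
    · exact h.U_lower _ _ (by simpa [PLUQ.col] using hst)
    · exact h.U_diag _ _ (by simp [PLUQ.col])
  · rintro ⟨hA, h⟩
    have hrow : ∀ (i : Fin m) (hi : (i : ℕ) < d.r), d.P (d.row ⟨i, hi⟩) = i := fun i hi => by
      simp [PLUQ.row]
    have hcol : ∀ (j : Fin n) (hj : (j : ℕ) < d.r), d.Q.symm (d.col ⟨j, hj⟩) = j := fun j hj => by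
      simp [PLUQ.col]
    refine ⟨⟨hA.trans hmul.symm, fun i t hi => ?_, fun i t hi => ?_, fun t j hj => ?_,
      fun t j hj => ?_⟩, ?_, fun i j hij => ?_, fun i j hij => ?_⟩
    · have := h.L_pivot ⟨i, hi.trans t.2⟩ t hi
      simpa [PLUQ.lower, hrow] using this
    · have := h.L_diag t
      rw [show t = ⟨i, hi ▸ t.2⟩ from Fin.ext hi.symm] at this ⊢
      simpa [PLUQ.lower, hrow] using this
    · have := h.U_pivot ⟨j, hj.trans t.2⟩ t hj
      simpa [PLUQ.upper, hcol] using this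
    · have := h.U_diag t
      rw [show t = ⟨j, hj ▸ t.2⟩ from Fin.ext hj] at this ⊢
      simpa [PLUQ.upper, hcol] using this
    · rw [hR, hA]
      exact h.isRankProfileMatrix
    · rw [hP]
      simp only [permute, padCols, Matrix.submatrix_apply, Matrix.of_apply, Equiv.symm_symm]
      split_ifs with hj
      · refine h.L_lower i ⟨_, hj⟩ ?_
        simpa [PLUQ.row] using hij
      · rfl
    · rw [hQ]
      simp only [permute, padRows, Matrix.submatrix_apply, Matrix.of_apply]
      split_ifs with hi
      · refine h.U_upper ⟨_, hi⟩ j ?_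
        simpa [PLUQ.col] using hij
      · rfl

theorem exists_perm_extending {r m : ℕ} (hr : r ≤ m) {p : Fin r → Fin m}
    (hp : Function.Injective p) : ∃ σ : Equiv.Perm (Fin m), ∀ t, σ (Fin.castLE hr t) = p t :=
  Equiv.Perm.exists_extending_pair _ _ (Fin.castLE_injective hr) hp

theorem IsPivoting.isRevealingPLUQ {r : ℕ} {p : Fin r → Fin m} {q : Fin r → Fin n}
    {L : Matrix (Fin m) (Fin r) K} {U : Matrix (Fin r) (Fin n) K}
    (h : IsPivoting (fun t : Fin r => (t : ℕ)) p q L U) (hrm : r ≤ m) (hrn : r ≤ n)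
    {P : Equiv.Perm (Fin m)} {Q : Equiv.Perm (Fin n)} (hP : ∀ t, P (Fin.castLE hrm t) = p t)
    (hQ : ∀ t, Q (Fin.castLE hrn t) = q t) :
    IsRevealingPLUQ (L * U) ⟨r, hrm, hrn, P.symm, Q, L.submatrix P id, U.submatrix id Q⟩ := by
  rw [isRevealingPLUQ_iff]
  have h1 : PLUQ.lower ⟨r, hrm, hrn, P.symm, Q, L.submatrix P id, U.submatrix id Q⟩ = L := by
    ext; simp [PLUQ.lower]
  have h2 : PLUQ.upper ⟨r, hrm, hrn, P.symm, Q, L.submatrix P id, U.submatrix id Q⟩ = U := by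
    ext; simp [PLUQ.upper]
  rw [h1, h2, show PLUQ.row ⟨r, hrm, hrn, P.symm, Q, L.submatrix P id, U.submatrix id Q⟩ = p
    from funext hP, show PLUQ.col ⟨r, hrm, hrn, P.symm, Q, L.submatrix P id, U.submatrix id Q⟩ = q
    from funext hQ]
  exact ⟨rfl, h⟩

/-- A pivoting in which the pivots are listed in order comes from a PLUQ decomposition. -/
theorem IsPivoting.exists_PLUQ {r : ℕ} {p : Fin r → Fin m} {q : Fin r → Fin n}
    {L : Matrix (Fin m) (Fin r) K} {U : Matrix (Fin r) (Fin n) K}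
    (h : IsPivoting (fun t : Fin r => (t : ℕ)) p q L U) :
    ∃ d : PLUQ K m n, IsRevealingPLUQ (L * U) d ∧ ∃ e : Fin d.r ≃ Fin r, d.row = p ∘ e ∧
      d.col = q ∘ e ∧ d.lower = L.submatrix id e ∧ d.upper = U.submatrix e id := by
  have hrm : r ≤ m := by simpa using Fintype.card_le_of_injective p h.row_inj
  have hrn : r ≤ n := by simpa using Fintype.card_le_of_injective q h.col_inj
  obtain ⟨P, hP⟩ := exists_perm_extending hrm h.row_inj
  obtain ⟨Q, hQ⟩ := exists_perm_extending hrn h.col_inj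
  refine ⟨⟨r, hrm, hrn, P.symm, Q, L.submatrix P id, U.submatrix id Q⟩,
    h.isRevealingPLUQ hrm hrn hP hQ, Equiv.refl _, funext hP, funext hQ, ?_, ?_⟩
  · ext; simp [PLUQ.lower]
  · ext; simp [PLUQ.upper]

end PLUQ

/-! ### Pivotings over arbitrary finite index types -/

section Pivoting

variable {K : Type u} [Field K] {ι : Type} {m n : ℕ}

/-- Pivots are combined over sums and selected over subtypes, with `ord` recording when they are
processed. Sorting by `ord` leads back to the index type `Fin r` of a PLUQ decomposition. -/
theorem exists_equiv_fin_of_injective [Fintype ι] {ord : ι → ℕ} (h : Function.Injective ord) :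
    ∃ e : Fin (Fintype.card ι) ≃ ι, ∀ s t, ord (e s) < ord (e t) ↔ s < t := by
  let _ : LinearOrder ι := LinearOrder.lift' ord h
  let e := monoEquivOfFin ι rfl
  exact ⟨e.toEquiv, fun s t => e.lt_iff_lt⟩

/-- Every pivoting comes from a PLUQ decomposition. -/
theorem IsPivoting.exists_PLUQ_of_fintype [Fintype ι] {ord : ι → ℕ} {p : ι → Fin m}
    {q : ι → Fin n} {L : Matrix (Fin m) ι K} {U : Matrix ι (Fin n) K}
    (h : IsPivoting ord p q L U) :
    ∃ d : PLUQ K m n, IsRevealingPLUQ (L * U) d ∧ ∃ e : Fin d.r ≃ ι, d.row = p ∘ e ∧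
      d.col = q ∘ e ∧ d.lower = L.submatrix id e ∧ d.upper = U.submatrix e id := by
  obtain ⟨e, he⟩ := exists_equiv_fin_of_injective h.ord_inj
  have h1 := (h.comp e e.injective).congr_ord (ord' := fun t : Fin _ => (t : ℕ)) he
  obtain ⟨d, hd, e', hp, hq, hL, hU⟩ := h1.exists_PLUQ
  refine ⟨d, ?_, e'.trans e, hp, hq, hL, hU⟩
  rwa [Matrix.submatrix_mul_equiv, Matrix.submatrix_id_id] at hd

end Pivoting

/-! ### Left triangular parts -/

section LeftPart

variable {K : Type u} [Field K] {m n : ℕ}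

theorem leftPart_apply (A : Matrix (Fin m) (Fin n) K) (i : Fin m) (j : Fin n) :
    leftPart A i j = if (i : ℕ) + 1 + ((j : ℕ) + 1) ≤ n then A i j else 0 := rfl

theorem leftPart_eq_iff {A B : Matrix (Fin m) (Fin n) K} :
    leftPart A = leftPart B ↔
      ∀ (i : Fin m) (j : Fin n), (i : ℕ) + 1 + ((j : ℕ) + 1) ≤ n → A i j = B i j := by
  constructor
  · intro h i j hij
    simpa [leftPart_apply, hij] using congr_fun₂ h i j
  · intro h
    ext i j
    rw [leftPart_apply, leftPart_apply]
    split_ifs with hij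
    · exact h i j hij
    · rfl

theorem leftPart_add (A B : Matrix (Fin m) (Fin n) K) :
    leftPart (A + B) = leftPart A + leftPart B := by
  ext i j
  simp only [leftPart_apply, Matrix.add_apply]
  split_ifs <;> simp

theorem leftPart_leftPart (A : Matrix (Fin m) (Fin n) K) : leftPart (leftPart A) = leftPart A :=
  leftPart_eq_iff.2 fun i j hij => by rw [leftPart_apply, if_pos hij]

end LeftPart

/-! ### Concatenation and completion of pivotings, Bruhat generators -/

section Pivoting

variable {K : Type u} [Field K] {ι κ : Type} {m n : ℕ}

/-- The second list is processed after the first, so `L'` and `U'` have to vanish on the earlier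
pivot rows and columns. The same vanishing keeps the pivot positions distinct, since `L'` and `U'`
are nonzero at their own pivots. -/
theorem IsPivoting.sum [Finite ι] {ord : ι → ℕ} {p : ι → Fin m} {q : ι → Fin n}
    {L : Matrix (Fin m) ι K} {U : Matrix ι (Fin n) K} (h : IsPivoting ord p q L U)
    {ord' : κ → ℕ} {p' : κ → Fin m} {q' : κ → Fin n}
    {L' : Matrix (Fin m) κ K} {U' : Matrix κ (Fin n) K} (h' : IsPivoting ord' p' q' L' U')
    (hL : ∀ s t, L' (p s) t = 0) (hU : ∀ s t, U' t (q s) = 0) :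
    ∃ N, (∀ t, ord t < N) ∧ IsPivoting (Sum.elim ord fun t => N + ord' t) (Sum.elim p p')
      (Sum.elim q q') (Matrix.fromCols L L') (Matrix.fromRows U U') := by
  obtain ⟨N, hN⟩ := (Set.finite_range ord).bddAbove
  have hN : ∀ t, ord t < N + 1 := fun t => Nat.lt_succ_of_le (hN ⟨t, rfl⟩)
  refine ⟨N + 1, hN, ?_, ?_, ?_, ?_, ?_, ?_, ?_, ?_, ?_⟩
  · refine h.ord_inj.sumElim (fun s t hst => h'.ord_inj (by simpa using hst)) fun s t => ?_
    have := hN s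
    omega
  · refine h.row_inj.sumElim h'.row_inj fun s t hst => h'.L_ne_zero t ?_
    rw [← hst, hL]
  · refine h.col_inj.sumElim h'.col_inj fun s t hst => h'.U_diag t ?_
    rw [← hst, hU]
  · rintro i (t | t) hi
    · exact h.L_lower i t hi
    · exact h'.L_lower i t hi
  · rintro (s | s) (t | t) hst
    · exact h.L_pivot s t hst
    · exact hL s t
    · have := hN t
      simp only [Sum.elim_inl, Sum.elim_inr] at hst
      omega
    · exact h'.L_pivot s t (by simpa using hst)
  · rintro (t | t)
    · exact h.L_diag t
    · exact h'.L_diag t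
  · rintro (t | t) j hj
    · exact h.U_upper t j hj
    · exact h'.U_upper t j hj
  · rintro (s | s) (t | t) hst
    · exact h.U_pivot s t hst
    · exact hU s t
    · have := hN t
      simp only [Sum.elim_inl, Sum.elim_inr] at hst
      omega
    · exact h'.U_pivot s t (by simpa using hst)
  · rintro (t | t)
    · exact h.U_diag t
    · exact h'.U_diag t

theorem colSelector_sumElim (q : ι → Fin n) (q' : κ → Fin n) :
    colSelector K (Sum.elim q q') = Matrix.fromRows (colSelector K q) (colSelector K q') := by
  ext (t | t) j <;> rfl

theorem rowSelector_sumElim (p : ι → Fin m) (p' : κ → Fin m) :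
    rowSelector K (Sum.elim p p') = Matrix.fromCols (rowSelector K p) (rowSelector K p') := by
  ext i (t | t) <;> rfl

/-- The column of a pivot, divided by the pivot. -/
def pivotCol (B : Matrix (Fin m) (Fin n) K) (i₀ : Fin m) (j₀ : Fin n) : Matrix (Fin m) Unit K :=
  Matrix.of fun i _ => B i j₀ / B i₀ j₀

/-- The row of a pivot. -/
def pivotRow (B : Matrix (Fin m) (Fin n) K) (i₀ : Fin m) : Matrix Unit (Fin n) K :=
  Matrix.of fun _ j => B i₀ j

/-- A single elimination step. -/
theorem isPivoting_unit {B : Matrix (Fin m) (Fin n) K} {i₀ : Fin m} {j₀ : Fin n}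
    (h₀ : B i₀ j₀ ≠ 0) (hrow : ∀ j, j < j₀ → B i₀ j = 0) (hcol : ∀ i, i < i₀ → B i j₀ = 0) :
    IsPivoting (fun _ : Unit => 0) (fun _ => i₀) (fun _ => j₀)
      (pivotCol B i₀ j₀) (pivotRow B i₀) where
  ord_inj _ _ _ := rfl
  row_inj _ _ _ := rfl
  col_inj _ _ _ := rfl
  L_lower i _ hi := by simp [pivotCol, hcol i hi]
  L_pivot _ _ h := absurd h (lt_irrefl _)
  L_diag _ := by simp [pivotCol, h₀]
  U_upper _ j hj := hrow j hj
  U_pivot _ _ h := absurd h (lt_irrefl _)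
  U_diag _ := h₀

theorem pivotCol_mul_pivotRow_apply (B : Matrix (Fin m) (Fin n) K) (i₀ i : Fin m) (j₀ j : Fin n) :
    (pivotCol B i₀ j₀ * pivotRow B i₀) i j = B i j₀ / B i₀ j₀ * B i₀ j := by
  simp [Matrix.mul_apply, pivotCol, pivotRow]

/-- An elimination step followed by an elimination of the Schur complement. -/
theorem IsPivoting.cons [Fintype κ] {B : Matrix (Fin m) (Fin n) K} {i₀ : Fin m} {j₀ : Fin n}
    (h₀ : B i₀ j₀ ≠ 0) (hrow : ∀ j, j < j₀ → B i₀ j = 0) (hcol : ∀ i, i < i₀ → B i j₀ = 0)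
    {ord : κ → ℕ} {p : κ → Fin m} {q : κ → Fin n}
    {L : Matrix (Fin m) κ K} {U : Matrix κ (Fin n) K} (h : IsPivoting ord p q L U)
    (hB : B - pivotCol B i₀ j₀ * pivotRow B i₀ = L * U) :
    ∃ N, IsPivoting (Sum.elim (fun _ : Unit => 0) fun t => N + ord t)
      (Sum.elim (fun _ => i₀) p) (Sum.elim (fun _ => j₀) q)
      (Matrix.fromCols (pivotCol B i₀ j₀) L) (Matrix.fromRows (pivotRow B i₀) U) := by
  obtain ⟨N, -, hN⟩ := (isPivoting_unit h₀ hrow hcol).sum h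
    (fun _ t => h.L_eq_zero_of_row (i := i₀) (fun j => by
      rw [← hB, Matrix.sub_apply, pivotCol_mul_pivotRow_apply, div_self h₀, one_mul, sub_self]) t)
    (fun _ t => h.U_eq_zero_of_col (j := j₀) (fun i => by
      rw [← hB, Matrix.sub_apply, pivotCol_mul_pivotRow_apply, div_mul_cancel₀ _ h₀, sub_self]) t)
  exact ⟨N, hN⟩

theorem eq_fromCols_mul_fromRows [Fintype κ] {B : Matrix (Fin m) (Fin n) K} {i₀ : Fin m}
    {j₀ : Fin n} {L : Matrix (Fin m) κ K} {U : Matrix κ (Fin n) K}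
    (hB : B - pivotCol B i₀ j₀ * pivotRow B i₀ = L * U) :
    B = Matrix.fromCols (pivotCol B i₀ j₀) L * Matrix.fromRows (pivotRow B i₀) U := by
  rw [Matrix.fromCols_mul_fromRows, ← hB, add_sub_cancel]

/-- Plain Gaussian elimination: the pivot is the leftmost nonzero entry of the topmost nonzero row,
so nothing precedes it in its row or in its column. The induction is on the number of bottom rows
that may be nonzero. -/
theorem exists_isPivoting (B : Matrix (Fin m) (Fin n) K) :
    ∃ (κ : Type) (_ : Fintype κ) (ord : κ → ℕ) (p : κ → Fin m) (q : κ → Fin n)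
      (L : Matrix (Fin m) κ K) (U : Matrix κ (Fin n) K), IsPivoting ord p q L U ∧ B = L * U := by
  suffices h : ∀ (k : ℕ) (B : Matrix (Fin m) (Fin n) K),
      (∀ i : Fin m, (i : ℕ) + k < m → ∀ j, B i j = 0) →
      ∃ (κ : Type) (_ : Fintype κ) (ord : κ → ℕ) (p : κ → Fin m) (q : κ → Fin n)
        (L : Matrix (Fin m) κ K) (U : Matrix κ (Fin n) K), IsPivoting ord p q L U ∧ B = L * U from
    h m B fun i hi => by omega
  intro k
  induction k with
  | zero =>
    intro B hB
    refine ⟨Empty, inferInstance, Empty.elim, Empty.elim, Empty.elim, 0, 0, ?_, ?_⟩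
    · constructor <;> intro s <;> first | exact s.elim | (intro t; exact t.elim)
    · ext i j
      simp [hB i i.2 j]
  | succ k ih =>
    intro B hB
    by_cases hz : ∀ i : Fin m, (i : ℕ) + k < m → ∀ j, B i j = 0
    · exact ih B hz
    · push Not at hz
      obtain ⟨i₀, hi₀, hj⟩ := hz
      obtain ⟨j₀, h₀, hmin⟩ := WellFounded.has_min
          (wellFounded_lt : WellFounded ((· < ·) : Fin n → Fin n → Prop))
        {j | B i₀ j ≠ 0} hj
      -- By `hB` and `hi₀`, the row `i₀` has index exactly `m - k - 1`, so all rows above it are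
      -- zero.
      have hcol : ∀ i, i < i₀ → ∀ j, B i j = 0 := fun i hi => hB i (by
        have := i₀.2; rw [Fin.lt_def] at hi; omega)
      obtain ⟨κ, _, ord, p, q, L, U, h, hLU⟩ :=
        ih (B - pivotCol B i₀ j₀ * pivotRow B i₀) fun i hi j => by
          rw [Matrix.sub_apply, pivotCol_mul_pivotRow_apply]
          by_cases hii : i < i₀
          · simp [hcol i hii]
          · obtain rfl : i = i₀ := by
              by_contra hne
              have := Fin.lt_def.1 (lt_of_le_of_ne (not_lt.1 hii) (Ne.symm hne))
              exact (h₀ : B i₀ j₀ ≠ 0) (hB i₀ (by omega) j₀)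
            rw [div_self h₀, one_mul, sub_self]
      obtain ⟨N, hN⟩ := IsPivoting.cons h₀
        (fun j hj => by_contra fun hne => hmin j hne hj) (fun i hi => hcol i hi _) h hLU
      exact ⟨_, inferInstance, _, _, _, _, _, hN, eq_fromCols_mul_fromRows hLU⟩

/-- The triple that belongs to a pivoting. -/
def pivotTriple [Fintype ι] (p q : ι → Fin n) (L : Matrix (Fin n) ι K) (U : Matrix ι (Fin n) K) :
    Triple K n :=
  ⟨leftPart (L * colSelector K q), leftPart (rowSelector K p * colSelector K q),
    leftPart (rowSelector K p * U)⟩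

theorem pivotTriple_comp_equiv [Fintype ι] [Fintype κ] (e : κ ≃ ι) (p q : ι → Fin n)
    (L : Matrix (Fin n) ι K) (U : Matrix ι (Fin n) K) :
    pivotTriple (p ∘ e) (q ∘ e) (L.submatrix id e) (U.submatrix e id) = pivotTriple p q L U := by
  have hp : rowSelector K (p ∘ e) = (rowSelector K p).submatrix id e := rfl
  have hq : colSelector K (q ∘ e) = (colSelector K q).submatrix e id := rfl
  simp only [pivotTriple, hp, hq, Matrix.submatrix_mul_equiv, Matrix.submatrix_id_id]

theorem pivotTriple_sumElim [Fintype ι] [Fintype κ] (p q : ι → Fin n) (p' q' : κ → Fin n)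
    (L : Matrix (Fin n) ι K) (U : Matrix ι (Fin n) K) (L' : Matrix (Fin n) κ K)
    (U' : Matrix κ (Fin n) K) :
    pivotTriple (Sum.elim p p') (Sum.elim q q') (Matrix.fromCols L L') (Matrix.fromRows U U') =
      ⟨(pivotTriple p q L U).L + (pivotTriple p' q' L' U').L,
        (pivotTriple p q L U).R + (pivotTriple p' q' L' U').R,
        (pivotTriple p q L U).U + (pivotTriple p' q' L' U').U⟩ := by
  simp only [pivotTriple, colSelector_sumElim, rowSelector_sumElim, Matrix.fromCols_mul_fromRows,
    leftPart_add]

theorem IsRevealingPLUQ.isBruhatGenerator {B : Matrix (Fin n) (Fin n) K} {d : PLUQ K n n}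
    (h : IsRevealingPLUQ B d) :
    IsBruhatGenerator B (pivotTriple d.row d.col d.lower d.upper) := by
  refine ⟨d, h, ?_, ?_, ?_⟩
  · rw [← permute_eq_mul, permute_padCols d.r_le_cols]
    rfl
  · rw [← permute_eq_mul, permute_pivotBlock d.r_le_rows d.r_le_cols]
    rfl
  · rw [← permute_eq_mul, permute_padRows d.r_le_rows]
    rfl

theorem IsBruhatGenerator.exists_isPivoting {B : Matrix (Fin n) (Fin n) K} {t : Triple K n}
    (h : IsBruhatGenerator B t) :
    ∃ (r : ℕ) (p q : Fin r → Fin n) (L : Matrix (Fin n) (Fin r) K) (U : Matrix (Fin r) (Fin n) K),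
      IsPivoting (fun t : Fin r => (t : ℕ)) p q L U ∧ B = L * U ∧ t = pivotTriple p q L U := by
  obtain ⟨d, hd, hL, hR, hU⟩ := h
  obtain ⟨hB, hp⟩ := isRevealingPLUQ_iff.1 hd
  refine ⟨_, _, _, _, _, hp, hB, ?_⟩
  rw [← permute_eq_mul, permute_padCols d.r_le_cols] at hL
  rw [← permute_eq_mul, permute_pivotBlock d.r_le_rows d.r_le_cols] at hR
  rw [← permute_eq_mul, permute_padRows d.r_le_rows] at hU
  cases t
  simp only [pivotTriple, Triple.mk.injEq]
  exact ⟨hL, hR, hU⟩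

theorem IsPivoting.isBruhatGenerator [Fintype ι] {ord : ι → ℕ} {p q : ι → Fin n}
    {L : Matrix (Fin n) ι K} {U : Matrix ι (Fin n) K} (h : IsPivoting ord p q L U) :
    IsBruhatGenerator (L * U) (pivotTriple p q L U) := by
  obtain ⟨d, hd, e, hp, hq, hL, hU⟩ := h.exists_PLUQ_of_fintype
  have := hd.isBruhatGenerator
  rwa [hp, hq, hL, hU, pivotTriple_comp_equiv] at this

/-- Column `t` of `L` starts in row `p t` and is placed in column `q t`; row `t` of `U` starts in
column `q t` and is placed in row `p t`. If the pivot is outside the left triangle, both lie outside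
it entirely. -/
theorem pivotTriple_eq_zero [Fintype ι] {p q : ι → Fin n} {L : Matrix (Fin n) ι K}
    {U : Matrix ι (Fin n) K} {ord : ι → ℕ} (h : IsPivoting ord p q L U)
    (hleft : ∀ t, ¬ (p t : ℕ) + 1 + ((q t : ℕ) + 1) ≤ n) : pivotTriple p q L U = ⟨0, 0, 0⟩ := by
  have hL : leftPart (L * colSelector K q) = 0 := by
    ext i j
    rw [leftPart_apply]
    split_ifs with hij
    · refine (Matrix.mul_apply ..).trans (Finset.sum_eq_zero fun t _ => ?_)
      by_cases hq : q t = j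
      · rw [h.L_lower i t (Fin.lt_def.2 (by have := hleft t; rw [hq] at this; omega)), zero_mul]
      · simp [colSelector, hq]
    · rfl
  have hR : leftPart (rowSelector K p * colSelector K q) = 0 := by
    ext i j
    rw [leftPart_apply]
    split_ifs with hij
    · refine (Matrix.mul_apply ..).trans (Finset.sum_eq_zero fun t _ => ?_)
      by_cases hq : q t = j
      · rw [h.selectors.L_lower i t (Fin.lt_def.2 (by have := hleft t; rw [hq] at this; omega)),
          zero_mul]
      · simp [colSelector, hq]
    · rfl
  have hU : leftPart (rowSelector K p * U) = 0 := by
    ext i j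
    rw [leftPart_apply]
    split_ifs with hij
    · refine (Matrix.mul_apply ..).trans (Finset.sum_eq_zero fun t _ => ?_)
      by_cases hp : p t = i
      · rw [h.U_upper t j (Fin.lt_def.2 (by have := hleft t; rw [hp] at this; omega)), mul_zero]
      · simp [rowSelector, hp]
    · rfl
  rw [pivotTriple, hL, hR, hU]

/-- If pivots in the left triangular part explain the left triangular part of `B`, they can be
completed to a pivoting of `B` by pivots outside the left triangular part. -/
theorem exists_completion {r : ℕ} : ∀ {B : Matrix (Fin n) (Fin n) K} {p q : Fin r → Fin n}
    {L : Matrix (Fin n) (Fin r) K} {U : Matrix (Fin r) (Fin n) K}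
    (_ : IsPivoting (fun t : Fin r => (t : ℕ)) p q L U)
    (_ : ∀ t, (p t : ℕ) + 1 + ((q t : ℕ) + 1) ≤ n) (_ : leftPart B = leftPart (L * U)),
    ∃ (κ : Type) (_ : Fintype κ) (ord : κ → ℕ) (p' q' : κ → Fin n)
      (L' : Matrix (Fin n) κ K) (U' : Matrix κ (Fin n) K), IsPivoting ord p' q' L' U' ∧
      B = L' * U' ∧ pivotTriple p' q' L' U' = pivotTriple p q L U := by
  induction r with
  | zero =>
    intro B p q L U h hleft hB
    obtain ⟨κ, _, ord, p', q', L', U', h', rfl⟩ := exists_isPivoting B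
    refine ⟨κ, _, ord, p', q', L', U', h', rfl, ?_⟩
    rw [pivotTriple_eq_zero h', pivotTriple_eq_zero h fun t => t.elim0]
    intro t ht
    -- A pivot inside the triangle would give a leading block with this pivot in its corner. That
    -- block lies inside the triangle, where `B` vanishes, yet it has positive rank.
    have h0 : (leading (L' * U') (p' t + 1) (q' t + 1)) = 0 := by
      ext i j
      have hi := i.2
      have hj := j.2
      have := leftPart_eq_iff.1 hB i.1 j.1 (by omega)
      simpa [leading, Matrix.mul_apply] using this
    have h1 := h'.rank_leading (p' t + 1) (q' t + 1)
    rw [h0, Matrix.rank_zero, eq_comm, Fintype.card_eq_zero_iff] at h1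
    exact h1.elim ⟨t, by simp⟩
  | succ r ih =>
    intro B p q L U h hleft hB
    have hsum : ∀ i j, (L * U) i j =
        L i 0 * U 0 j + (L.submatrix id Fin.succ * U.submatrix Fin.succ id) i j := fun i j => by
      rw [Matrix.mul_apply, Fin.sum_univ_succ, Matrix.mul_apply]
      rfl
    have hLeft := leftPart_eq_iff.1 hB
    -- the first pivot row and column
    have hcol : ∀ i : Fin n, (i : ℕ) + 1 + ((q 0 : ℕ) + 1) ≤ n → B i (q 0) = L i 0 * U 0 (q 0) := by
      intro i hi
      rw [hLeft _ _ hi, Matrix.mul_apply, Fin.sum_univ_succ, Finset.sum_eq_zero, add_zero]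
      intro t _
      rw [h.U_pivot 0 t.succ (by simp), mul_zero]
    have hrow : ∀ j : Fin n, (p 0 : ℕ) + 1 + ((j : ℕ) + 1) ≤ n → B (p 0) j = U 0 j := by
      intro j hj
      rw [hLeft _ _ hj, Matrix.mul_apply, Fin.sum_univ_succ, Finset.sum_eq_zero, add_zero,
        h.L_diag, one_mul]
      intro t _
      rw [h.L_pivot 0 t.succ (by simp), zero_mul]
    have hpiv : B (p 0) (q 0) = U 0 (q 0) := hrow _ (hleft 0)
    have h₀ : B (p 0) (q 0) ≠ 0 := hpiv ▸ h.U_diag 0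
    have hquot : ∀ i : Fin n, (i : ℕ) + 1 + ((q 0 : ℕ) + 1) ≤ n →
        B i (q 0) / B (p 0) (q 0) = L i 0 := fun i hi => by
      rw [hcol i hi, hpiv, mul_div_cancel_right₀ _ (h.U_diag 0)]
    have hs : IsPivoting (fun t : Fin r => (t : ℕ)) (p ∘ Fin.succ) (q ∘ Fin.succ)
        (L.submatrix id Fin.succ) (U.submatrix Fin.succ id) :=
      (h.comp Fin.succ (Fin.succ_injective r)).congr_ord fun s t => by simp
    have hp0 := hleft 0
    obtain ⟨κ, _, ord, p', q', L', U', h', hB', ht⟩ :=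
      ih (B := B - pivotCol B (p 0) (q 0) * pivotRow B (p 0)) hs (fun t => hleft _)
        (leftPart_eq_iff.2 fun i j hij => by
          rw [Matrix.sub_apply, pivotCol_mul_pivotRow_apply, hLeft i j hij, hsum, add_comm,
            add_sub_assoc, add_eq_left, sub_eq_zero]
          -- The rank-one update may read pivot row and column entries outside the triangle, where
          -- `B` is not controlled. If $(i,j)$ is in the triangle but $(i,q_0)$ is not, then $j<q_0$
          -- and the row factor is zero. If $(p_0,j)$ is not, then $i<p_0$ and the column factor is
          -- zero.
          by_cases hi : (i : ℕ) + 1 + ((q 0 : ℕ) + 1) ≤ n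
          · rw [hquot i hi]
            by_cases hj : (p 0 : ℕ) + 1 + ((j : ℕ) + 1) ≤ n
            · rw [hrow j hj]
            · rw [h.L_lower i 0 (Fin.lt_def.2 (by omega)), zero_mul, zero_mul]
          · rw [hrow j (by omega), h.U_upper 0 j (Fin.lt_def.2 (by omega)), mul_zero, mul_zero])
    obtain ⟨N, hN⟩ := IsPivoting.cons h₀
      (fun j hj => by
        rw [Fin.lt_def] at hj
        rw [hrow j (by omega), h.U_upper 0 j (Fin.lt_def.2 hj)])
      (fun i hi => by
        rw [Fin.lt_def] at hi
        rw [hcol i (by omega), h.L_lower i 0 (Fin.lt_def.2 hi), zero_mul]) h' hB'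
    refine ⟨_, inferInstance, _, _, _, _, _, hN, eq_fromCols_mul_fromRows hB', ?_⟩
    rw [pivotTriple_sumElim, ht]
    simp only [pivotTriple, Triple.mk.injEq, ← leftPart_add]
    refine ⟨leftPart_eq_iff.2 fun i j hij => ?_, leftPart_eq_iff.2 fun i j hij => ?_,
      leftPart_eq_iff.2 fun i j hij => ?_⟩
    · rw [Matrix.add_apply, Matrix.mul_apply, Matrix.mul_apply, Matrix.mul_apply,
        Fin.sum_univ_succ, Fintype.sum_unique]
      congr 1
      by_cases hj : q 0 = j
      · subst hj
        simp [pivotCol, colSelector, hquot i hij]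
      · simp [colSelector, hj]
    · rw [Matrix.add_apply, Matrix.mul_apply, Matrix.mul_apply, Matrix.mul_apply,
        Fin.sum_univ_succ, Fintype.sum_unique]
      rfl
    · rw [Matrix.add_apply, Matrix.mul_apply, Matrix.mul_apply, Matrix.mul_apply,
        Fin.sum_univ_succ, Fintype.sum_unique]
      congr 1
      by_cases hi : p 0 = i
      · subst hi
        simp [pivotRow, rowSelector, hrow j hij]
      · simp [rowSelector, hi]

/-- A pivoting that explains the left triangular part of `B` yields a Bruhat generator. -/
theorem IsPivoting.isBruhatGenerator_of_leftPart_eq [Fintype ι] {ord : ι → ℕ} {p q : ι → Fin n}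
    {L : Matrix (Fin n) ι K} {U : Matrix ι (Fin n) K} (h : IsPivoting ord p q L U)
    {B : Matrix (Fin n) (Fin n) K} (hB : leftPart B = leftPart (L * U)) :
    IsBruhatGenerator B (pivotTriple p q L U) := by
  classical
  set P : ι → Prop := fun t => (p t : ℕ) + 1 + ((q t : ℕ) + 1) ≤ n with hP
  have hs := h.comp (Subtype.val : {t // P t} → ι) Subtype.val_injective
  obtain ⟨e, he⟩ := exists_equiv_fin_of_injective hs.ord_inj
  have hf := (hs.comp e e.injective).congr_ord (ord' := fun t : Fin _ => (t : ℕ)) he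
  -- Only pivots inside the triangle are kept. For a discarded pivot, every $(i,j)$ in the triangle
  -- has $i<p_t$ or $j<q_t$, so its term vanishes. The final comparison of the triples uses the same
  -- dichotomy.
  have hLU : leftPart (L * U) =
      leftPart (L.submatrix id (Subtype.val : {t // P t} → ι) * U.submatrix Subtype.val id) := by
    refine leftPart_eq_iff.2 fun i j hij => ?_
    refine (sum_subtype_of_forall_not (f := fun t => L i t * U t j) fun t ht => ?_).symm
    by_cases hi : i < p t
    · rw [h.L_lower _ _ hi, zero_mul]
    · rw [h.U_upper _ _ (Fin.lt_def.2 (by rw [Fin.lt_def] at hi; simp only [hP] at ht; omega)),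
        mul_zero]
  obtain ⟨κ, _, ord', p', q', L', U', h', hB', ht⟩ := exists_completion (B := B) hf
    (fun t => (e t).2) (by
      rw [hB, hLU, Matrix.submatrix_mul_equiv, Matrix.submatrix_id_id]
      rfl)
  rw [pivotTriple_comp_equiv] at ht
  have := h'.isBruhatGenerator
  rw [← hB', ht] at this
  convert this using 1
  simp only [pivotTriple, Triple.mk.injEq]
  refine ⟨leftPart_eq_iff.2 fun i j hij => ?_, leftPart_eq_iff.2 fun i j hij => ?_,
    leftPart_eq_iff.2 fun i j hij => ?_⟩
  · refine (sum_subtype_of_forall_not (f := fun t => L i t * colSelector K q t j)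
      fun t ht => ?_).symm
    by_cases hi : i < p t
    · rw [h.L_lower _ _ hi, zero_mul]
    · rw [h.selectors.U_upper _ _
        (Fin.lt_def.2 (by rw [Fin.lt_def] at hi; simp only [hP] at ht; omega)), mul_zero]
  · refine (sum_subtype_of_forall_not (f := fun t => rowSelector K p i t * colSelector K q t j)
      fun t ht => ?_).symm
    by_cases hi : i < p t
    · rw [h.selectors.L_lower _ _ hi, zero_mul]
    · rw [h.selectors.U_upper _ _
        (Fin.lt_def.2 (by rw [Fin.lt_def] at hi; simp only [hP] at ht; omega)), mul_zero]
  · refine (sum_subtype_of_forall_not (f := fun t => rowSelector K p i t * U t j)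
      fun t ht => ?_).symm
    by_cases hi : i < p t
    · rw [h.selectors.L_lower _ _ hi, zero_mul]
    · rw [h.U_upper _ _
        (Fin.lt_def.2 (by rw [Fin.lt_def] at hi; simp only [hP] at ht; omega)), mul_zero]

end Pivoting

/-! ### Block matrices cut along the anti-diagonal -/

section Blocks

variable {K : Type u} [Field K] {g h n : ℕ}

/-- An entry of a matrix that is assembled from four blocks. -/
theorem forall_cut {a b : ℕ} (e : a + b = n) {P : Fin n → Prop} :
    (∀ i, P i) ↔ (∀ i, P (cut e (Sum.inl i))) ∧ ∀ i, P (cut e (Sum.inr i)) := by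
  rw [← (cut e).forall_congr_right, Sum.forall]

@[simp] theorem val_cut_inl {a b : ℕ} (e : a + b = n) (i : Fin a) :
    (cut e (Sum.inl i) : ℕ) = i := by simp [cut]

@[simp] theorem val_cut_inr {a b : ℕ} (e : a + b = n) (i : Fin b) :
    (cut e (Sum.inr i) : ℕ) = a + i := by simp [cut]

theorem cut_inl_lt_inl {a b : ℕ} (e : a + b = n) {i j : Fin a} :
    cut e (Sum.inl i) < cut e (Sum.inl j) ↔ i < j := by
  rw [Fin.lt_def, val_cut_inl, val_cut_inl, Fin.lt_def]

theorem cut_inr_lt_inr {a b : ℕ} (e : a + b = n) {i j : Fin b} :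
    cut e (Sum.inr i) < cut e (Sum.inr j) ↔ i < j := by
  rw [Fin.lt_def, val_cut_inr, val_cut_inr, Fin.lt_def, Nat.add_lt_add_iff_left]

theorem not_cut_inr_lt_inl {a b : ℕ} (e : a + b = n) {i : Fin b} {j : Fin a} :
    ¬ cut e (Sum.inr i) < cut e (Sum.inl j) := by
  rw [Fin.lt_def, val_cut_inl, val_cut_inr]
  omega

/-- A matrix assembled from four blocks. -/
def glue {α : Type v} (eg : g + h = n) (eh : h + g = n) (A₁ : Matrix (Fin g) (Fin h) α)
    (A₂ : Matrix (Fin g) (Fin g) α) (A₃ : Matrix (Fin h) (Fin h) α)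
    (A₄ : Matrix (Fin h) (Fin g) α) : Matrix (Fin n) (Fin n) α :=
  (Matrix.fromBlocks A₁ A₂ A₃ A₄).submatrix (cut eg).symm (cut eh).symm

/-- Because $g+h=n$, the first block lies inside the triangle and the last one outside, while the
two square blocks are cut along their own anti-diagonals. The recursion depends on this
self-similarity. -/
theorem leftPart_glue {K : Type u} [Field K] (eg : g + h = n) (eh : h + g = n)
    (A₁ : Matrix (Fin g) (Fin h) K) (A₂ : Matrix (Fin g) (Fin g) K) (A₃ : Matrix (Fin h) (Fin h) K)
    (A₄ : Matrix (Fin h) (Fin g) K) :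
    leftPart (glue eg eh A₁ A₂ A₃ A₄) = glue eg eh A₁ (leftPart A₂) (leftPart A₃) 0 := by
  refine Matrix.ext ?_
  rw [forall_cut eg]
  constructor <;> intro i <;> rw [forall_cut eh] <;> constructor <;> intro j <;>
    simp only [leftPart_apply, glue, Matrix.submatrix_apply, Equiv.symm_apply_apply,
      Matrix.fromBlocks_apply₁₁, Matrix.fromBlocks_apply₁₂, Matrix.fromBlocks_apply₂₁,
      Matrix.fromBlocks_apply₂₂, val_cut_inl, val_cut_inr, Matrix.zero_apply]
  · rw [if_pos (by omega)]
  · exact if_congr (by omega) rfl rfl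
  · exact if_congr (by omega) rfl rfl
  · rw [if_neg (by omega)]

theorem glue_add {K : Type u} [Field K] (eg : g + h = n) (eh : h + g = n)
    (A₁ B₁ : Matrix (Fin g) (Fin h) K) (A₂ B₂ : Matrix (Fin g) (Fin g) K)
    (A₃ B₃ : Matrix (Fin h) (Fin h) K) (A₄ B₄ : Matrix (Fin h) (Fin g) K) :
    glue eg eh A₁ A₂ A₃ A₄ + glue eg eh B₁ B₂ B₃ B₄ =
      glue eg eh (A₁ + B₁) (A₂ + B₂) (A₃ + B₃) (A₄ + B₄) := by
  rw [glue, glue, glue, ← Matrix.fromBlocks_add]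
  rfl

end Blocks

/-! ### Combination of the three eliminations -/

section Step

variable {K : Type u} [Field K] {g h n : ℕ} {ι ι₂ ι₃ : Type}

/-- The pivots of $A_1$ come first, and `hL`, `hU` keep the other two lists off their rows and
columns. Those two lists do not interact: they use different row blocks in the lower factor and
different column blocks in the upper factor. `D` and `E` are unrestricted because they fill columns
and rows that contain no pivot of $A_1$. -/
theorem IsPivoting.exists_glue [Finite ι] [Finite ι₂] (eg : g + h = n) (eh : h + g = n)
    {ord : ι → ℕ} {p : ι → Fin g} {q : ι → Fin h} {L : Matrix (Fin g) ι K}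
    {U : Matrix ι (Fin h) K} (h₁ : IsPivoting ord p q L U)
    {ord₂ : ι₂ → ℕ} {p₂ q₂ : ι₂ → Fin g} {L₂ : Matrix (Fin g) ι₂ K} {U₂ : Matrix ι₂ (Fin g) K}
    (h₂ : IsPivoting ord₂ p₂ q₂ L₂ U₂)
    {ord₃ : ι₃ → ℕ} {p₃ q₃ : ι₃ → Fin h} {L₃ : Matrix (Fin h) ι₃ K} {U₃ : Matrix ι₃ (Fin h) K}
    (h₃ : IsPivoting ord₃ p₃ q₃ L₃ U₃) (hL : ∀ s t, L₂ (p s) t = 0) (hU : ∀ s t, U₃ t (q s) = 0)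
    (D : Matrix ι (Fin g) K) (E : Matrix (Fin h) ι K) :
    ∃ ord', IsPivoting ord'
      (cut eg ∘ Sum.elim (Sum.inl ∘ p) (Sum.elim (Sum.inl ∘ p₂) (Sum.inr ∘ p₃)))
      (cut eh ∘ Sum.elim (Sum.inl ∘ q) (Sum.elim (Sum.inr ∘ q₂) (Sum.inl ∘ q₃)))
      ((Matrix.fromCols (Matrix.fromRows L E) (Matrix.fromCols (Matrix.fromRows L₂ 0)
        (Matrix.fromRows 0 L₃))).submatrix (cut eg).symm id)
      ((Matrix.fromRows (Matrix.fromCols U D) (Matrix.fromRows (Matrix.fromCols 0 U₂)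
        (Matrix.fromCols U₃ 0))).submatrix id (cut eh).symm) := by
  obtain ⟨N, hN⟩ := (Set.finite_range ord).bddAbove
  obtain ⟨N₂, hN₂⟩ := (Set.finite_range ord₂).bddAbove
  have hN : ∀ t, ord t ≤ N := fun t => hN ⟨t, rfl⟩
  have hN₂ : ∀ t, ord₂ t ≤ N₂ := fun t => hN₂ ⟨t, rfl⟩
  have hpp : ∀ s t, p s ≠ p₂ t := fun s t e => h₂.L_ne_zero t (by rw [← e, hL])
  have hqq : ∀ s t, q s ≠ q₃ t := fun s t e => h₃.U_diag t (by rw [← e, hU])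
  refine ⟨Sum.elim ord (Sum.elim (fun t => N + 1 + ord₂ t) fun t => N + 1 + (N₂ + 1 + ord₃ t)),
    ?_, ?_, ?_, ?_, ?_, ?_, ?_, ?_, ?_⟩
  · rintro (s | s | s) (t | t | t) hst <;> simp only [Sum.elim_inl, Sum.elim_inr] at hst
    · rw [h₁.ord_inj hst]
    · have := hN s; omega
    · have := hN s; omega
    · have := hN t; omega
    · rw [h₂.ord_inj (Nat.add_left_cancel hst)]
    · have := hN₂ s; omega
    · have := hN t; omega
    · have := hN₂ t; omega
    · rw [h₃.ord_inj (Nat.add_left_cancel (Nat.add_left_cancel hst))]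
  · refine (cut eg).injective.comp ?_
    rintro (s | s | s) (t | t | t) hst <;>
      simp only [Sum.elim_inl, Sum.elim_inr, Function.comp_apply, Sum.inl.injEq, Sum.inr.injEq,
        reduceCtorEq] at hst
    · rw [h₁.row_inj hst]
    · exact absurd hst (hpp _ _)
    · exact absurd hst.symm (hpp _ _)
    · rw [h₂.row_inj hst]
    · rw [h₃.row_inj hst]
  · refine (cut eh).injective.comp ?_
    rintro (s | s | s) (t | t | t) hst <;>
      simp only [Sum.elim_inl, Sum.elim_inr, Function.comp_apply, Sum.inl.injEq, Sum.inr.injEq,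
        reduceCtorEq] at hst
    · rw [h₁.col_inj hst]
    · exact absurd hst (hqq _ _)
    · rw [h₂.col_inj hst]
    · exact absurd hst.symm (hqq _ _)
    · rw [h₃.col_inj hst]
  · rw [forall_cut eg]
    constructor <;> rintro i (t | t | t) hi <;>
      simp only [Sum.elim_inl, Sum.elim_inr, Function.comp_apply, cut_inl_lt_inl, cut_inr_lt_inr,
        not_cut_inr_lt_inl] at hi <;> simp
    · exact h₁.L_lower _ _ hi
    · exact h₂.L_lower _ _ hi
    · exact h₃.L_lower _ _ hi
  · rintro (s | s | s) (t | t | t) hst <;> simp only [Sum.elim_inl, Sum.elim_inr] at hst <;> simp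
    · exact h₁.L_pivot _ _ hst
    · exact hL _ _
    · have := hN t; omega
    · exact h₂.L_pivot _ _ (by omega)
    · have := hN t; omega
    · exact h₃.L_pivot _ _ (by omega)
  · rintro (t | t | t) <;> simp [h₁.L_diag, h₂.L_diag, h₃.L_diag]
  · intro t j
    revert t
    revert j
    rw [forall_cut eh]
    constructor <;> rintro i (t | t | t) hi <;>
      simp only [Sum.elim_inl, Sum.elim_inr, Function.comp_apply, cut_inl_lt_inl, cut_inr_lt_inr,
        not_cut_inr_lt_inl] at hi <;> simp
    · exact h₁.U_upper _ _ hi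
    · exact h₃.U_upper _ _ hi
    · exact h₂.U_upper _ _ hi
  · rintro (s | s | s) (t | t | t) hst <;> simp only [Sum.elim_inl, Sum.elim_inr] at hst <;> simp
    · exact h₁.U_pivot _ _ hst
    · exact hU _ _
    · have := hN t; omega
    · exact h₂.U_pivot _ _ (by omega)
    · have := hN t; omega
    · exact h₃.U_pivot _ _ (by omega)
  · rintro (t | t | t) <;> simp [h₁.U_diag, h₂.U_diag, h₃.U_diag]

theorem mul_eq_glue [Fintype ι] [Fintype ι₂] [Fintype ι₃] (eg : g + h = n) (eh : h + g = n)
    (L : Matrix (Fin g) ι K) (E : Matrix (Fin h) ι K) (L₂ : Matrix (Fin g) ι₂ K)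
    (L₃ : Matrix (Fin h) ι₃ K) (U : Matrix ι (Fin h) K) (D : Matrix ι (Fin g) K)
    (U₂ : Matrix ι₂ (Fin g) K) (U₃ : Matrix ι₃ (Fin h) K) :
    (Matrix.fromCols (Matrix.fromRows L E) (Matrix.fromCols (Matrix.fromRows L₂ 0)
        (Matrix.fromRows 0 L₃))).submatrix (cut eg).symm id *
      (Matrix.fromRows (Matrix.fromCols U D) (Matrix.fromRows (Matrix.fromCols 0 U₂)
        (Matrix.fromCols U₃ 0))).submatrix id (cut eh).symm =
      glue eg eh (L * U) (L * D + L₂ * U₂) (E * U + L₃ * U₃) (E * D) := by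
  rw [glue, ← Matrix.submatrix_mul _ _ _ id _ Function.bijective_id, Matrix.fromCols_mul_fromRows,
    Matrix.fromCols_mul_fromRows, Matrix.fromRows_mul_fromCols, Matrix.fromRows_mul_fromCols,
    Matrix.fromRows_mul_fromCols, Matrix.fromBlocks_add, Matrix.fromBlocks_add]
  simp

theorem colSelector_glue (eh : h + g = n) (q : ι → Fin h) (q₂ : ι₂ → Fin g) (q₃ : ι₃ → Fin h) :
    colSelector K (cut eh ∘ Sum.elim (Sum.inl ∘ q) (Sum.elim (Sum.inr ∘ q₂) (Sum.inl ∘ q₃))) =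
      (Matrix.fromRows (Matrix.fromCols (colSelector K q) 0)
        (Matrix.fromRows (Matrix.fromCols 0 (colSelector K q₂))
          (Matrix.fromCols (colSelector K q₃) 0))).submatrix id (cut eh).symm := by
  refine Matrix.ext fun t j => ?_
  revert t j
  rw [forall_comm, forall_cut eh]
  constructor <;> rintro i (t | t | t) <;> simp [colSelector]

theorem rowSelector_glue (eg : g + h = n) (p : ι → Fin g) (p₂ : ι₂ → Fin g) (p₃ : ι₃ → Fin h) :
    rowSelector K (cut eg ∘ Sum.elim (Sum.inl ∘ p) (Sum.elim (Sum.inl ∘ p₂) (Sum.inr ∘ p₃))) =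
      (Matrix.fromCols (Matrix.fromRows (rowSelector K p) 0)
        (Matrix.fromCols (Matrix.fromRows (rowSelector K p₂) 0)
          (Matrix.fromRows 0 (rowSelector K p₃)))).submatrix (cut eg).symm id := by
  refine Matrix.ext ?_
  rw [forall_cut eg]
  constructor <;> rintro i (t | t | t) <;> simp [rowSelector]

/-- The combination of the Bruhat generators of the two Schur complements in the algorithm. -/
theorem isBruhatGenerator_glue (eg : g + h = n) (eh : h + g = n)
    {A₁ : Matrix (Fin g) (Fin h) K} {A₂ : Matrix (Fin g) (Fin g) K} {A₃ : Matrix (Fin h) (Fin h) K}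
    {A₄ : Matrix (Fin h) (Fin g) K} {d : PLUQ K g h} (hd : IsRevealingPLUQ A₁ d)
    {D : Matrix (Fin d.r) (Fin g) K} {E : Matrix (Fin h) (Fin d.r) K}
    (hH : ∀ t j, (A₂ - d.lower * D) (d.row t) j = 0)
    (hI : ∀ i t, (A₃ - E * d.upper) i (d.col t) = 0) {t₂ : Triple K g} {t₃ : Triple K h}
    (ht₂ : IsBruhatGenerator (leftPart (A₂ - d.lower * D)) t₂)
    (ht₃ : IsBruhatGenerator (leftPart (A₃ - E * d.upper)) t₃) :
    IsBruhatGenerator (leftPart (glue eg eh A₁ A₂ A₃ A₄))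
      ⟨glue eg eh (permute d.P d.Q (padCols 0 h d.L)) 0
          (leftPart (permute 1 d.Q (padCols 0 h E))) 0 + glue eg eh 0 t₂.L t₃.L 0,
        glue eg eh (permute d.P d.Q (pivotBlock 0 1 g h d.r)) t₂.R t₃.R 0,
        glue eg eh (permute d.P d.Q (padRows 0 g d.U))
          (leftPart (permute d.P 1 (padRows 0 g D))) 0 0 + glue eg eh 0 t₂.U t₃.U 0⟩ := by
  obtain ⟨hA₁, h₁⟩ := isRevealingPLUQ_iff.1 hd
  obtain ⟨r₂, p₂, q₂, L₂, U₂, h₂, hLU₂, rfl⟩ := ht₂.exists_isPivoting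
  obtain ⟨r₃, p₃, q₃, L₃, U₃, h₃, hLU₃, rfl⟩ := ht₃.exists_isPivoting
  -- A zero row of $H$ is still zero in $\mathrm{Left}(H)$, which is what the recursive call
  -- factors.
  have hL : ∀ s t, L₂ (d.row s) t = 0 := fun s t => h₂.L_eq_zero_of_row (fun j => by
    rw [← hLU₂, leftPart_apply, hH, ite_self]) t
  have hU : ∀ s t, U₃ t (d.col s) = 0 := fun s t => h₃.U_eq_zero_of_col (fun j => by
    rw [← hLU₃, leftPart_apply, hI, ite_self]) t
  obtain ⟨ord, hp⟩ := h₁.exists_glue eg eh h₂ h₃ hL hU D E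
  rw [permute_padCols d.r_le_cols, permute_pivotBlock d.r_le_rows d.r_le_cols,
    permute_padRows d.r_le_rows, permute_padCols d.r_le_cols, permute_padRows d.r_le_rows]
  -- The two products agree only after taking left parts: the corner `E * D` is dropped, and
  -- $LD+\mathrm{Left}(A_2-LD)$ has the left part of $A_2$.
  have key := hp.isBruhatGenerator_of_leftPart_eq (B := leftPart (glue eg eh A₁ A₂ A₃ A₄)) (by
    rw [mul_eq_glue, leftPart_leftPart, leftPart_glue, leftPart_glue, leftPart_add, leftPart_add,
      ← hLU₂, ← hLU₃, leftPart_leftPart, leftPart_leftPart, ← leftPart_add, ← leftPart_add,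
      add_sub_cancel, add_sub_cancel, hA₁])
  rw [pivotTriple, colSelector_glue, rowSelector_glue, mul_eq_glue, mul_eq_glue,
    mul_eq_glue] at key
  simp only [leftPart_glue, Matrix.mul_zero, Matrix.zero_mul, zero_add, leftPart_add] at key
  rw [leftPart_glue]
  simp only [glue_add, pivotTriple, zero_add, add_zero]
  exact key

end Step

/-! ### The Schur complements computed by the algorithm -/

section Schur

variable {K : Type u} [Field K] {m n : ℕ}

/-- The upper Schur complement that the algorithm computes in permuted form. -/
theorem permute_fromRows_schur {A : Matrix (Fin m) (Fin n) K} {d : PLUQ K m n}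
    (hd : IsRevealingPLUQ A d) {c : ℕ} (A₂ : Matrix (Fin m) (Fin c) K)
    {rowCut : Fin d.r ⊕ Fin (m - d.r) ≃ Fin m}
    (hcut : rowCut = cut (Nat.add_sub_cancel' d.r_le_rows))
    {B : Matrix (Fin d.r ⊕ Fin (m - d.r)) (Fin c) K}
    (hB : B = (permute d.P.symm 1 A₂).submatrix rowCut id) {D : Matrix (Fin d.r) (Fin c) K}
    (hD : D = (d.L.submatrix rowCut id).toRows₁⁻¹ * B.toRows₁) :
    permute d.P 1 ((Matrix.fromRows 0 (B.toRows₂ - (d.L.submatrix rowCut id).toRows₂ * D)).submatrix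
      rowCut.symm id) = A₂ - d.lower * D ∧ ∀ t j, (A₂ - d.lower * D) (d.row t) j = 0 := by
  have hunit : IsUnit (d.L.submatrix rowCut id).toRows₁ := by
    refine isUnit_of_lower Fin.val_injective _ (fun s t hst => ?_) fun t => ?_
    · exact hd.L_upper _ _ (by simpa [hcut] using hst)
    · have := hd.L_diag (rowCut (Sum.inl t)) t (by simp [hcut])
      simp [Matrix.toRows₁, this]
  -- The zero block that the algorithm writes is $B_1-L_1D$. With it, the stacked matrix is the
  -- uniform expression $B-[L_1;M_1]D$, and undoing the permutation gives $A_2-PLD$.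
  have h1 :
      (0 : Matrix (Fin d.r) (Fin c) K) = B.toRows₁ - (d.L.submatrix rowCut id).toRows₁ * D := by
    rw [hD, ← Matrix.mul_assoc, Matrix.mul_nonsing_inv _ ((Matrix.isUnit_iff_isUnit_det _).1 hunit),
      Matrix.one_mul, sub_self]
  have h2 : Matrix.fromRows 0 (B.toRows₂ - (d.L.submatrix rowCut id).toRows₂ * D) =
      B - d.L.submatrix rowCut id * D := by
    conv_lhs => rw [h1]
    ext (i | i) j <;> rfl
  have h3 : permute d.P 1 ((Matrix.fromRows 0
      (B.toRows₂ - (d.L.submatrix rowCut id).toRows₂ * D)).submatrix rowCut.symm id) =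
        A₂ - d.lower * D := by
    rw [h2, hB]
    ext i j
    simp [permute, Matrix.mul_apply, PLUQ.lower,
      show Equiv.symm (1 : Equiv.Perm (Fin c)) = 1 from rfl]
  refine ⟨h3, fun t j => ?_⟩
  rw [← h3]
  have : rowCut.symm (d.P (d.row t)) = Sum.inl t := by
    rw [Equiv.symm_apply_eq, hcut]
    ext
    simp [PLUQ.row]
  simp [permute, this]

/-- The left Schur complement that the algorithm computes in permuted form. -/
theorem permute_fromCols_schur {A : Matrix (Fin m) (Fin n) K} {d : PLUQ K m n}
    (hd : IsRevealingPLUQ A d) {a : ℕ} (A₃ : Matrix (Fin a) (Fin n) K)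
    {colCut : Fin d.r ⊕ Fin (n - d.r) ≃ Fin n}
    (hcut : colCut = cut (Nat.add_sub_cancel' d.r_le_cols))
    {B : Matrix (Fin a) (Fin d.r ⊕ Fin (n - d.r)) K}
    (hB : B = (permute 1 d.Q.symm A₃).submatrix id colCut) {E : Matrix (Fin a) (Fin d.r) K}
    (hE : E = B.toCols₁ * (d.U.submatrix id colCut).toCols₁⁻¹) :
    permute 1 d.Q ((Matrix.fromCols 0 (B.toCols₂ - E * (d.U.submatrix id colCut).toCols₂)).submatrix
      id colCut.symm) = A₃ - E * d.upper ∧ ∀ i t, (A₃ - E * d.upper) i (d.col t) = 0 := by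
  have hunit : IsUnit (d.U.submatrix id colCut).toCols₁ := by
    refine isUnit_of_upper Fin.val_injective _ (fun s t hst => ?_) fun t => ?_
    · exact hd.U_lower _ _ (by simpa [hcut] using hst)
    · exact hd.U_diag t (colCut (Sum.inl t)) (by simp [hcut])
  have h1 :
      (0 : Matrix (Fin a) (Fin d.r) K) = B.toCols₁ - E * (d.U.submatrix id colCut).toCols₁ := by
    rw [hE, Matrix.mul_assoc, Matrix.nonsing_inv_mul _ ((Matrix.isUnit_iff_isUnit_det _).1 hunit),
      Matrix.mul_one, sub_self]
  have h2 : Matrix.fromCols 0 (B.toCols₂ - E * (d.U.submatrix id colCut).toCols₂) =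
      B - E * d.U.submatrix id colCut := by
    conv_lhs => rw [h1]
    ext i (j | j) <;> rfl
  have h3 : permute 1 d.Q ((Matrix.fromCols 0
      (B.toCols₂ - E * (d.U.submatrix id colCut).toCols₂)).submatrix id colCut.symm) =
        A₃ - E * d.upper := by
    rw [h2, hB]
    ext i j
    simp [permute, Matrix.mul_apply, PLUQ.upper]
  refine ⟨h3, fun i t => ?_⟩
  rw [← h3]
  have : colCut.symm (d.Q.symm (d.col t)) = Sum.inl t := by
    rw [Equiv.symm_apply_eq, hcut]
    ext
    simp [PLUQ.col]
  simp [permute, this]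

end Schur

/-! ### The quasiseparable order does not grow in the recursion -/

section Quasisep

variable {K : Type u} [Field K] {m n : ℕ}

/-- A leading $k\times l$ block with $k+l\le n$ lies inside the triangle and inside the leading
$k\times(n-k)$ block. Allowing all such $l$ suits the induction. -/
theorem quasisepOrder_leftPart_le_iff {A : Matrix (Fin n) (Fin n) K} {s : ℕ} :
    quasisepOrder (leftPart A) ≤ s ↔ ∀ k l, k + l ≤ n → (leading A k l).rank ≤ s := by
  have hleft : ∀ k l, k + l ≤ n → leading (leftPart A) k l = leading A k l := by
    intro k l hkl
    ext i j
    have hi := i.2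
    have hj := j.2
    simp only [leading, Matrix.submatrix_apply, leftPart_apply]
    rw [if_pos (by omega)]
  rw [quasisepOrder, Finset.sup_le_iff]
  constructor
  · intro h k l hkl
    by_cases hk : k < n
    · have h1 := h k (Finset.mem_range.2 hk)
      rw [hleft _ _ (by omega)] at h1
      refine le_trans ?_ h1
      exact Matrix.rank_submatrix_le (leading A k (n - k)) id
        (fun j : {j : Fin n // (j : ℕ) < l} => ⟨j.1, by have := j.2; omega⟩)
    · refine (Matrix.rank_le_card_width _).trans ?_
      rw [Fintype.card_eq_zero_iff.2 ⟨fun j => by have := j.2; omega⟩]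
      exact Nat.zero_le _
  · intro h k hk
    rw [Finset.mem_range] at hk
    rw [hleft _ _ (by omega)]
    exact h _ _ (by omega)

theorem rank_leading_transpose (A : Matrix (Fin m) (Fin n) K) (k l : ℕ) :
    (leading Aᵀ k l).rank = (leading A l k).rank := by
  rw [← Matrix.rank_transpose (leading A l k)]
  rfl

/-- Eliminating columns does not increase the rank of leading submatrices. -/
theorem rank_leading_sub_mul_le {a a' b b' : ℕ} (ea : a + a' = m) (eb : b + b' = n)
    (A : Matrix (Fin m) (Fin n) K) (X : Matrix (Fin b) (Fin b') K) (k l : ℕ) :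
    (leading ((A.submatrix (cut ea) (cut eb)).toBlocks₁₂ -
      (A.submatrix (cut ea) (cut eb)).toBlocks₁₁ * X) k l).rank ≤ (leading A k (b + l)).rank := by
  -- The difference is the upper part of $A$ times $[-X;1]$. The first `l` columns of that factor
  -- are supported in the first `b + l` rows, so only the leading columns of $A$ enter.
  let W : Matrix (Fin n) (Fin b') K := (Matrix.fromRows (-X) 1).submatrix (cut eb).symm id
  let V : Matrix {t : Fin n // (t : ℕ) < b + l} {j : Fin b' // (j : ℕ) < l} K :=
    W.submatrix Subtype.val Subtype.val
  let f : {i : Fin a // (i : ℕ) < k} → {i : Fin m // (i : ℕ) < k} :=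
    fun i => ⟨cut ea (Sum.inl i.1), by simpa using i.2⟩
  have h1 : leading ((A.submatrix (cut ea) (cut eb)).toBlocks₁₂ -
      (A.submatrix (cut ea) (cut eb)).toBlocks₁₁ * X) k l =
        (leading A k (b + l)).submatrix f id * V := by
    refine Matrix.ext fun i j => ?_
    change _ = ∑ t : {t : Fin n // (t : ℕ) < b + l}, A (cut ea (Sum.inl i.1)) t.1 * W t.1 j.1
    rw [sum_subtype_of_forall_not (f := fun t => A (cut ea (Sum.inl i.1)) t * W t j.1),
      ← (cut eb).sum_comp, Fintype.sum_sum_type]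
    · simp [leading, W, Matrix.mul_apply, Matrix.one_apply, sub_eq_neg_add]
      rfl
    · rw [forall_cut eb]
      refine ⟨fun t ht => ?_, fun t ht => ?_⟩
      · rw [val_cut_inl] at ht
        omega
      · rw [val_cut_inr] at ht
        have hj := j.2
        have : t ≠ j.1 := fun e => by rw [e] at ht; omega
        simp [W, this]
  rw [h1]
  exact (Matrix.rank_mul_le_left _ _).trans (Matrix.rank_submatrix_le _ _ _)

/-- The pivot columns of $A$ are $PL$ times an invertible triangular matrix, hence $PL=AY$. This
turns $A_2-PLD$ into $A_2-A_1(YD)$, a column operation to which `rank_leading_sub_mul_le` applies.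
-/
theorem IsRevealingPLUQ.exists_lower_eq {A : Matrix (Fin m) (Fin n) K} {d : PLUQ K m n}
    (hd : IsRevealingPLUQ A d) : ∃ Y : Matrix (Fin n) (Fin d.r) K, d.lower = A * Y := by
  obtain ⟨hA, h⟩ := isRevealingPLUQ_iff.1 hd
  refine ⟨(1 : Matrix (Fin n) (Fin n) K).submatrix id d.col * (d.upper.submatrix id d.col)⁻¹, ?_⟩
  have h2 : d.upper * (1 : Matrix (Fin n) (Fin n) K).submatrix id d.col =
      d.upper.submatrix id d.col := by
    ext i j
    simp [Matrix.mul_apply, Matrix.one_apply]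
  rw [hA, Matrix.mul_assoc, ← Matrix.mul_assoc d.upper, h2,
    Matrix.mul_nonsing_inv _ ((Matrix.isUnit_iff_isUnit_det _).1 h.isUnit_U), Matrix.mul_one]

theorem IsRevealingPLUQ.exists_upper_eq {A : Matrix (Fin m) (Fin n) K} {d : PLUQ K m n}
    (hd : IsRevealingPLUQ A d) : ∃ Y : Matrix (Fin d.r) (Fin m) K, d.upper = Y * A := by
  obtain ⟨hA, h⟩ := isRevealingPLUQ_iff.1 hd
  refine ⟨(d.lower.submatrix d.row id)⁻¹ * (1 : Matrix (Fin m) (Fin m) K).submatrix d.row id, ?_⟩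
  have h2 : (1 : Matrix (Fin m) (Fin m) K).submatrix d.row id * d.lower =
      d.lower.submatrix d.row id := by
    ext i j
    simp [Matrix.mul_apply, Matrix.one_apply]
  rw [hA, Matrix.mul_assoc, ← Matrix.mul_assoc _ d.lower, h2, ← Matrix.mul_assoc,
    Matrix.nonsing_inv_mul _ ((Matrix.isUnit_iff_isUnit_det _).1 h.isUnit_L), Matrix.one_mul]

theorem IsRevealingPLUQ.r_eq_rank {A : Matrix (Fin m) (Fin n) K} {d : PLUQ K m n}
    (hd : IsRevealingPLUQ A d) : d.r = A.rank := by
  obtain ⟨hA, h⟩ := isRevealingPLUQ_iff.1 hd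
  rw [hA, h.rank_mul, Fintype.card_fin]

theorem r_le_of_quasisepOrder_le {g h : ℕ} (eg : g + h = n) (eh : h + g = n)
    {A : Matrix (Fin n) (Fin n) K} {s : ℕ} (hA : quasisepOrder (leftPart A) ≤ s) {d : PLUQ K g h}
    (hd : IsRevealingPLUQ (A.submatrix (cut eg) (cut eh)).toBlocks₁₁ d) : d.r ≤ s := by
  rw [hd.r_eq_rank]
  refine le_trans ?_ (quasisepOrder_leftPart_le_iff.1 hA g h eg.le)
  exact Matrix.rank_submatrix_le (leading A g h)
    (fun i : Fin g => ⟨cut eg (Sum.inl i), by simp⟩)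
    (fun j : Fin h => ⟨cut eh (Sum.inl j), by simp⟩)

/-- A block $k\times l$ with $k+l\le g$ in the complement comes from a block $k\times(h+l)$ of $A$,
and $k+h+l\le n$. -/
theorem quasisepOrder_upper_le {g h : ℕ} (eg : g + h = n) (eh : h + g = n)
    {A : Matrix (Fin n) (Fin n) K} {s : ℕ} (hA : quasisepOrder (leftPart A) ≤ s) {d : PLUQ K g h}
    (hd : IsRevealingPLUQ (A.submatrix (cut eg) (cut eh)).toBlocks₁₁ d)
    (D : Matrix (Fin d.r) (Fin g) K) :
    quasisepOrder (leftPart ((A.submatrix (cut eg) (cut eh)).toBlocks₁₂ - d.lower * D)) ≤ s := by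
  obtain ⟨Y, hY⟩ := hd.exists_lower_eq
  rw [quasisepOrder_leftPart_le_iff] at hA ⊢
  intro k l hkl
  rw [hY, Matrix.mul_assoc]
  exact (rank_leading_sub_mul_le eg eh A _ k l).trans (hA _ _ (by omega))

theorem quasisepOrder_lower_le {g h : ℕ} (eg : g + h = n) (eh : h + g = n)
    {A : Matrix (Fin n) (Fin n) K} {s : ℕ} (hA : quasisepOrder (leftPart A) ≤ s) {d : PLUQ K g h}
    (hd : IsRevealingPLUQ (A.submatrix (cut eg) (cut eh)).toBlocks₁₁ d)
    (E : Matrix (Fin h) (Fin d.r) K) :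
    quasisepOrder (leftPart ((A.submatrix (cut eg) (cut eh)).toBlocks₂₁ - E * d.upper)) ≤ s := by
  obtain ⟨Y, hY⟩ := hd.exists_upper_eq
  rw [quasisepOrder_leftPart_le_iff] at hA ⊢
  intro k l hkl
  have h1 := rank_leading_sub_mul_le eh eg Aᵀ (E * Y)ᵀ l k
  rw [rank_leading_transpose] at h1
  rw [← rank_leading_transpose, hY, ← Matrix.mul_assoc, Matrix.transpose_sub, Matrix.transpose_mul]
  exact h1.trans (hA _ _ (by omega))

end Quasisep

/-! ### Running the algorithm with given subroutines -/

section Run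

variable {K : Type u}

/-- The subroutines use at most `κ max(r, 1) ^ θ N ^ 2` operations on matrices of size at most `N`,
where `r` is the rank, or the inner dimension of the product, or the size of the triangular
matrix. -/
structure Subroutines.CostBound [Field K] (S : Subroutines K) (κ θ : ℝ) : Prop where
  mul : ∀ (a b c N : ℕ) (mem : List K) (X : AddrMatrix a b) (Y : AddrMatrix b c)
    (A : Matrix (Fin a) (Fin b) K) (B : Matrix (Fin b) (Fin c) K),
    1 ≤ N → a ≤ N → b ≤ N → c ≤ N → Holds mem X A → Holds mem Y B →
      (((S.mul a b c X Y).run mem).cost : ℝ) ≤ κ * (max (b : ℝ) 1 ^ θ * (N : ℝ) ^ 2)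
  solveLower : ∀ (r c N : ℕ) (mem : List K) (X : AddrMatrix r r) (Y : AddrMatrix r c)
    (L : Matrix (Fin r) (Fin r) K) (B : Matrix (Fin r) (Fin c) K),
    1 ≤ N → r ≤ N → c ≤ N →
    Holds mem X L → Holds mem Y B → (∀ i j, i < j → L i j = 0) → (∀ i, L i i = 1) →
      (((S.solveLower r c X Y).run mem).cost : ℝ) ≤ κ * (max (r : ℝ) 1 ^ θ * (N : ℝ) ^ 2)
  solveUpper : ∀ (a r N : ℕ) (mem : List K) (X : AddrMatrix a r) (Y : AddrMatrix r r)
    (C : Matrix (Fin a) (Fin r) K) (U : Matrix (Fin r) (Fin r) K),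
    1 ≤ N → a ≤ N → r ≤ N →
    Holds mem X C → Holds mem Y U → (∀ i j, j < i → U i j = 0) → (∀ i, U i i ≠ 0) →
      (((S.solveUpper a r X Y).run mem).cost : ℝ) ≤ κ * (max (r : ℝ) 1 ^ θ * (N : ℝ) ^ 2)
  pluq : ∀ (m n N : ℕ) (mem : List K) (X : AddrMatrix m n) (A : Matrix (Fin m) (Fin n) K),
    1 ≤ N → m ≤ N → n ≤ N → Holds mem X A →
      (((S.pluq m n X).run mem).cost : ℝ) ≤
        κ * (max (((S.pluq m n X).run mem).val.r : ℝ) 1 ^ θ * (N : ℝ) ^ 2)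

variable {mem : List K}

theorem Holds.of_eq {m n : ℕ} {X : AddrMatrix m n} {A B : Matrix (Fin m) (Fin n) K}
    (h : Holds mem X A) (e : A = B) : Holds mem X B := e ▸ h

theorem holds_zero [Field K] {m n : ℕ} {z : ℕ} (hz : mem[z]? = some (0 : K)) :
    Holds mem (Matrix.of fun (_ : Fin m) (_ : Fin n) => z) 0 :=
  fun _ _ => hz

theorem Holds.permute {m n : ℕ} {X : AddrMatrix m n} {A : Matrix (Fin m) (Fin n) K}
    (h : Holds mem X A) (P : Equiv.Perm (Fin m)) (Q : Equiv.Perm (Fin n)) :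
    Holds mem (permute P Q X) (permute P Q A) := fun _ _ => h _ _

theorem Holds.padCols [Field K] {m r : ℕ} {X : AddrMatrix m r} {A : Matrix (Fin m) (Fin r) K}
    (h : Holds mem X A) {z : ℕ} (hz : mem[z]? = some 0) (n : ℕ) :
    Holds mem (padCols z n X) (padCols 0 n A) := fun i j => by
  simp only [_root_.padCols, Matrix.of_apply]
  split_ifs
  · exact h _ _
  · exact hz

theorem Holds.padRows [Field K] {r n : ℕ} {X : AddrMatrix r n} {A : Matrix (Fin r) (Fin n) K}
    (h : Holds mem X A) {z : ℕ} (hz : mem[z]? = some 0) (m : ℕ) :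
    Holds mem (padRows z m X) (padRows 0 m A) := fun i j => by
  simp only [_root_.padRows, Matrix.of_apply]
  split_ifs
  · exact h _ _
  · exact hz

theorem holds_pivotBlock [Field K] {z o : ℕ} (hz : mem[z]? = some (0 : K))
    (ho : mem[o]? = some (1 : K))
    (m n r : ℕ) : Holds mem (pivotBlock z o m n r) (pivotBlock (0 : K) 1 m n r) := fun i j => by
  simp only [pivotBlock, Matrix.of_apply]
  split_ifs
  · exact ho
  · exact hz

theorem Holds.leftPart [Field K] {m n : ℕ} {X : AddrMatrix m n} {A : Matrix (Fin m) (Fin n) K}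
    (h : Holds mem X A) {z : ℕ} (hz : mem[z]? = some 0) :
    Holds mem (leftPartWith z X) (leftPart A) := fun i j => by
  simp only [leftPartWith, Matrix.of_apply]
  split_ifs
  · exact h _ _
  · exact hz

theorem Holds.glue {g h n : ℕ} (eg : g + h = n) (eh : h + g = n) {X₁ : AddrMatrix g h}
    {X₂ : AddrMatrix g g} {X₃ : AddrMatrix h h} {X₄ : AddrMatrix h g}
    {A₁ : Matrix (Fin g) (Fin h) K}
    {A₂ : Matrix (Fin g) (Fin g) K} {A₃ : Matrix (Fin h) (Fin h) K} {A₄ : Matrix (Fin h) (Fin g) K}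
    (h₁ : Holds mem X₁ A₁) (h₂ : Holds mem X₂ A₂) (h₃ : Holds mem X₃ A₃) (h₄ : Holds mem X₄ A₄) :
    Holds mem (glue eg eh X₁ X₂ X₃ X₄) (glue eg eh A₁ A₂ A₃ A₄) := by
  intro i
  revert i
  rw [forall_cut eg]
  constructor <;> intro i j <;> revert j <;> rw [forall_cut eh] <;> constructor <;> intro j <;>
    simp only [_root_.glue, Matrix.submatrix_apply, Equiv.symm_apply_apply,
      Matrix.fromBlocks_apply₁₁, Matrix.fromBlocks_apply₁₂, Matrix.fromBlocks_apply₂₁,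
      Matrix.fromBlocks_apply₂₂]
  · exact h₁ _ _
  · exact h₂ _ _
  · exact h₃ _ _
  · exact h₄ _ _

theorem Holds.fromRows_submatrix {a b n m : ℕ} {X : AddrMatrix a n} {Y : AddrMatrix b n}
    {A : Matrix (Fin a) (Fin n) K} {B : Matrix (Fin b) (Fin n) K} (hX : Holds mem X A)
    (hY : Holds mem Y B) (e : Fin m → Fin a ⊕ Fin b) :
    Holds mem ((Matrix.fromRows X Y).submatrix e id) ((Matrix.fromRows A B).submatrix e id) := by
  intro i j
  simp only [Matrix.submatrix_apply]
  rcases e i with i | i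
  · exact hX _ _
  · exact hY _ _

theorem Holds.fromCols_submatrix {a b n m : ℕ} {X : AddrMatrix n a} {Y : AddrMatrix n b}
    {A : Matrix (Fin n) (Fin a) K} {B : Matrix (Fin n) (Fin b) K} (hX : Holds mem X A)
    (hY : Holds mem Y B) (e : Fin m → Fin a ⊕ Fin b) :
    Holds mem ((Matrix.fromCols X Y).submatrix id e) ((Matrix.fromCols A B).submatrix id e) := by
  intro i j
  simp only [Matrix.submatrix_apply]
  rcases e j with j | j
  · exact hX _ _
  · exact hY _ _

theorem glue_submatrix_cut {g h n : ℕ} (eg : g + h = n) (eh : h + g = n)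
    (A : Matrix (Fin n) (Fin n) K) :
    glue eg eh (A.submatrix (cut eg) (cut eh)).toBlocks₁₁ (A.submatrix (cut eg) (cut eh)).toBlocks₁₂
      (A.submatrix (cut eg) (cut eh)).toBlocks₂₁
        (A.submatrix (cut eg) (cut eh)).toBlocks₂₂ = A := by
  rw [glue, Matrix.fromBlocks_toBlocks]
  ext
  simp

theorem isBruhatGenerator_zero [Field K] {n : ℕ} :
    IsBruhatGenerator (0 : Matrix (Fin n) (Fin n) K) ⟨0, 0, 0⟩ := by
  have h : IsPivoting (K := K) (m := n) (n := n) (ι := Fin 0) (fun t => (t : ℕ)) Fin.elim0 Fin.elim0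
      0 0 := by
    constructor <;> intro s <;> first | exact s.elim0 | (intro t; exact t.elim0)
  have h1 := h.isBruhatGenerator
  rw [pivotTriple_eq_zero h fun t => t.elim0, Matrix.mul_zero] at h1
  exact h1

/-- The recursive step of the algorithm, with the recursive calls as parameters. -/
def ltBruhatStep (S : Subroutines K) {g h n : ℕ} (eg : g + h = n) (eh : h + g = n)
    (rec₂ : AddrMatrix g g → FieldProg K (Triple ℕ g))
    (rec₃ : AddrMatrix h h → FieldProg K (Triple ℕ h)) [Field K]
    (A : AddrMatrix n n) : FieldProg K (Triple ℕ n) := do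
  let rows : Fin g ⊕ Fin h ≃ Fin n := cut eg
  let cols : Fin h ⊕ Fin g ≃ Fin n := cut eh
  let A' := A.submatrix rows cols
  let A₁ := A'.toBlocks₁₁
  let A₂ := A'.toBlocks₁₂
  let A₃ := A'.toBlocks₂₁
  let z ← FieldProg.exec (.const 0)
  let o ← FieldProg.exec (.const 1)
  let d ← S.pluq g h A₁
  let r := d.r
  let rowCut : Fin r ⊕ Fin (g - r) ≃ Fin g := cut (Nat.add_sub_cancel' d.r_le_rows)
  let colCut : Fin r ⊕ Fin (h - r) ≃ Fin h := cut (Nat.add_sub_cancel' d.r_le_cols)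
  let L₁ := (d.L.submatrix rowCut id).toRows₁
  let M₁ := (d.L.submatrix rowCut id).toRows₂
  let U₁ := (d.U.submatrix id colCut).toCols₁
  let V₁ := (d.U.submatrix id colCut).toCols₂
  let R₁ := permute d.P d.Q (pivotBlock z o g h r)
  let B := (permute d.P.symm 1 A₂).submatrix rowCut id
  let C := (permute 1 d.Q.symm A₃).submatrix id colCut
  let D ← S.solveLower r g L₁ B.toRows₁
  let E ← S.solveUpper h r C.toCols₁ U₁
  let M₁D ← S.mul (g - r) r g M₁ D
  let F ← entrywise .sub B.toRows₂ M₁D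
  let EV₁ ← S.mul h r (h - r) E V₁
  let G ← entrywise .sub C.toCols₂ EV₁
  let H := permute d.P 1
    ((Matrix.fromRows (Matrix.of fun _ _ => z) F).submatrix rowCut.symm id)
  let I := permute 1 d.Q
    ((Matrix.fromCols (Matrix.of fun _ _ => z) G).submatrix id colCut.symm)
  let t₂ ← rec₂ H
  let t₃ ← rec₃ I
  let 𝒪 : AddrMatrix h g := Matrix.of fun _ _ => z
  let outL ← entrywise .add
    ((Matrix.fromBlocks
      (permute d.P d.Q (padCols z h d.L)) (Matrix.of fun _ _ => z)
      (leftPartWith z (permute 1 d.Q (padCols z h E))) 𝒪).submatrix rows.symm cols.symm)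
    ((Matrix.fromBlocks
      (Matrix.of fun _ _ => z) t₂.L
      t₃.L 𝒪).submatrix rows.symm cols.symm)
  let outU ← entrywise .add
    ((Matrix.fromBlocks
      (permute d.P d.Q (padRows z g d.U)) (leftPartWith z (permute d.P 1 (padRows z g D)))
      (Matrix.of fun _ _ => z) 𝒪).submatrix rows.symm cols.symm)
    ((Matrix.fromBlocks
      (Matrix.of fun _ _ => z) t₂.U
      t₃.U 𝒪).submatrix rows.symm cols.symm)
  let outR := (Matrix.fromBlocks R₁ t₂.R t₃.R 𝒪).submatrix rows.symm cols.symm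
  pure ⟨outL, outR, outU⟩

theorem ltBruhat_add_two [Field K] (S : Subroutines K) (k : ℕ) (A : AddrMatrix (k + 2) (k + 2)) :
    ltBruhat S (k + 2) A = ltBruhatStep S (g := (k + 2) - (k + 2) / 2) (h := (k + 2) / 2)
      (by omega) (by omega) (ltBruhat S _) (ltBruhat S _) A := by
  rw [ltBruhat]
  rfl

section Subroutines

variable [Field K] {S : Subroutines K} (hS : S.Correct) (κ θ : ℝ)

/-- The cost bound is a premise inside the postcondition, here and in the companions below. A single
pass through the algorithm then serves arbitrary correct subroutines as well as efficient ones. -/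
theorem wp_subroutine_mul (hS : S.Correct) {a b c : ℕ} {X : AddrMatrix a b} {Y : AddrMatrix b c}
    {A : Matrix (Fin a) (Fin b) K} {B : Matrix (Fin b) (Fin c) K} (hX : Holds mem X A)
    (hY : Holds mem Y B) :
    (S.mul a b c X Y).wp mem fun mem' Z cost => Holds mem' Z (A * B) ∧
      (S.CostBound κ θ → ∀ N, 1 ≤ N → a ≤ N → b ≤ N → c ≤ N →
        (cost : ℝ) ≤ κ * (max (b : ℝ) 1 ^ θ * (N : ℝ) ^ 2)) :=
  ⟨hS.mul _ _ _ _ _ _ _ _ hX hY,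
    fun h _ h1 h2 h3 h4 => h.mul _ _ _ _ _ _ _ _ _ h1 h2 h3 h4 hX hY⟩

theorem wp_subroutine_solveLower (hS : S.Correct) {r c : ℕ} {X : AddrMatrix r r}
    {Y : AddrMatrix r c} {L : Matrix (Fin r) (Fin r) K} {B : Matrix (Fin r) (Fin c) K}
    (hX : Holds mem X L) (hY : Holds mem Y B) (hL : ∀ i j, i < j → L i j = 0)
    (hL' : ∀ i, L i i = 1) :
    (S.solveLower r c X Y).wp mem fun mem' Z cost => Holds mem' Z (L⁻¹ * B) ∧
      (S.CostBound κ θ → ∀ N, 1 ≤ N → r ≤ N → c ≤ N →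
        (cost : ℝ) ≤ κ * (max (r : ℝ) 1 ^ θ * (N : ℝ) ^ 2)) :=
  ⟨hS.solveLower _ _ _ _ _ _ _ hX hY hL hL',
    fun h _ h1 h2 h3 => h.solveLower _ _ _ _ _ _ _ _ h1 h2 h3 hX hY hL hL'⟩

theorem wp_subroutine_solveUpper (hS : S.Correct) {a r : ℕ} {X : AddrMatrix a r}
    {Y : AddrMatrix r r} {C : Matrix (Fin a) (Fin r) K} {U : Matrix (Fin r) (Fin r) K}
    (hX : Holds mem X C) (hY : Holds mem Y U) (hU : ∀ i j, j < i → U i j = 0)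
    (hU' : ∀ i, U i i ≠ 0) :
    (S.solveUpper a r X Y).wp mem fun mem' Z cost => Holds mem' Z (C * U⁻¹) ∧
      (S.CostBound κ θ → ∀ N, 1 ≤ N → a ≤ N → r ≤ N →
        (cost : ℝ) ≤ κ * (max (r : ℝ) 1 ^ θ * (N : ℝ) ^ 2)) :=
  ⟨hS.solveUpper _ _ _ _ _ _ _ hX hY hU hU',
    fun h _ h1 h2 h3 => h.solveUpper _ _ _ _ _ _ _ _ h1 h2 h3 hX hY hU hU'⟩

theorem wp_subroutine_pluq (hS : S.Correct) {m n : ℕ} {X : AddrMatrix m n}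
    {A : Matrix (Fin m) (Fin n) K} (hX : Holds mem X A) :
    (S.pluq m n X).wp mem fun mem' d cost =>
      (∃ (L : Matrix (Fin m) (Fin d.r) K) (U : Matrix (Fin d.r) (Fin n) K),
        Holds mem' d.L L ∧ Holds mem' d.U U ∧
        IsRevealingPLUQ A ⟨d.r, d.r_le_rows, d.r_le_cols, d.P, d.Q, L, U⟩) ∧
      (S.CostBound κ θ → ∀ N, 1 ≤ N → m ≤ N → n ≤ N →
        (cost : ℝ) ≤ κ * (max (d.r : ℝ) 1 ^ θ * (N : ℝ) ^ 2)) :=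
  ⟨hS.pluq _ _ _ _ _ hX, fun h _ h1 h2 h3 => h.pluq _ _ _ _ _ _ h1 h2 h3 hX⟩

end Subroutines

/-- The arithmetic of a recursion into two halves. -/
theorem sq_add_sq_half_le (k : ℕ) :
    ((((k + 2) / 2 : ℕ) : ℝ) ^ 2 + ((k + 2 - (k + 2) / 2 : ℕ) : ℝ) ^ 2) * 2 ≤
      ((k + 2 : ℕ) : ℝ) ^ 2 + 1 := by
  have h1 : (k + 2) - (k + 2) / 2 = (k + 2) / 2 ∨ (k + 2) - (k + 2) / 2 = (k + 2) / 2 + 1 := by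
    omega
  have h2 : k + 2 = (k + 2) / 2 + ((k + 2) - (k + 2) / 2) := by omega
  generalize (k + 2) - (k + 2) / 2 = g at *
  generalize (k + 2) / 2 = h at *
  rw [h2]
  rcases h1 with rfl | rfl <;> push_cast <;> nlinarith

open FieldProg in
theorem wp_ltBruhatStep [Field K] {S : Subroutines K} (hS : S.Correct) {κ θ : ℝ} (hκ : 0 ≤ κ)
    (hθ : 0 ≤ θ) {g h n : ℕ} (eg : g + h = n) (eh : h + g = n)
    {rec₂ : AddrMatrix g g → FieldProg K (Triple ℕ g)}
    {rec₃ : AddrMatrix h h → FieldProg K (Triple ℕ h)} (hn : 2 ≤ n) {C : ℝ}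
    (ih₂ : ∀ (A : Matrix (Fin g) (Fin g) K) (mem : List K) (X : AddrMatrix g g), Holds mem X A →
      (rec₂ X).wp mem fun mem' T c =>
        ∃ t : Triple K g, Holds mem' T.L t.L ∧ Holds mem' T.R t.R ∧ Holds mem' T.U t.U ∧
          IsBruhatGenerator (leftPart A) t ∧
          (S.CostBound κ θ → ∀ s : ℕ, quasisepOrder (leftPart A) ≤ s →
            (c : ℝ) ≤ C * (max (s : ℝ) 1 ^ θ * (g : ℝ) ^ 2)))
    (ih₃ : ∀ (A : Matrix (Fin h) (Fin h) K) (mem : List K) (X : AddrMatrix h h), Holds mem X A →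
      (rec₃ X).wp mem fun mem' T c =>
        ∃ t : Triple K h, Holds mem' T.L t.L ∧ Holds mem' T.R t.R ∧ Holds mem' T.U t.U ∧
          IsBruhatGenerator (leftPart A) t ∧
          (S.CostBound κ θ → ∀ s : ℕ, quasisepOrder (leftPart A) ≤ s →
            (c : ℝ) ≤ C * (max (s : ℝ) 1 ^ θ * (h : ℝ) ^ 2)))
    {A : Matrix (Fin n) (Fin n) K} {mem : List K} {X : AddrMatrix n n} (hX : Holds mem X A) :
    (ltBruhatStep S eg eh rec₂ rec₃ X).wp mem fun mem' T c =>
      ∃ t : Triple K n, Holds mem' T.L t.L ∧ Holds mem' T.R t.R ∧ Holds mem' T.U t.U ∧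
        IsBruhatGenerator (leftPart A) t ∧
        (S.CostBound κ θ → ∀ s : ℕ, quasisepOrder (leftPart A) ≤ s →
          (c : ℝ) ≤ (5 * κ + 5) * (max (s : ℝ) 1 ^ θ * (n : ℝ) ^ 2) +
            C * (max (s : ℝ) 1 ^ θ * (g : ℝ) ^ 2) + C * (max (s : ℝ) 1 ^ θ * (h : ℝ) ^ 2)) := by
  have hA₁ := hX.submatrix (fun i : Fin g => cut eg (Sum.inl i))
    (fun j : Fin h => cut eh (Sum.inl j))
  have hA₂ := hX.submatrix (fun i : Fin g => cut eg (Sum.inl i))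
    (fun j : Fin g => cut eh (Sum.inr j))
  have hA₃ := hX.submatrix (fun i : Fin h => cut eg (Sum.inr i))
    (fun j : Fin h => cut eh (Sum.inl j))
  unfold ltBruhatStep
  refine (wp_exec _ _).bind fun mem₁ z c₁ hm₁ ⟨hz, hc₁⟩ => ?_
  refine (wp_exec _ _).bind fun mem₂ o c₂ hm₂ ⟨ho, hc₂⟩ => ?_
  have hm := hm₁.trans hm₂
  refine (wp_subroutine_pluq κ θ hS (hA₁.mono hm)).bind fun mem₃ d c₃ hm₃ ⟨hd, hc₃⟩ => ?_
  have hz₃ := (hm₂.trans hm₃).getElem?_of_eq_some hz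
  have ho₃ := hm₃.getElem?_of_eq_some ho
  replace hm := hm.trans hm₃
  obtain ⟨r, hrg, hrh, P, Q, dL, dU⟩ := d
  obtain ⟨L, U, hL, hU, hd⟩ := hd
  dsimp only at L U hL hU hd hc₃ ⊢
  generalize hrc : cut (Nat.add_sub_cancel' hrg) = rowCut
  generalize hcc : cut (Nat.add_sub_cancel' hrh) = colCut
  set As := A.submatrix (cut eg) (cut eh) with hAs
  have hB : Holds mem₃ (_root_.permute P.symm 1 (X.submatrix (cut eg) (cut eh)).toBlocks₁₂)
    (_root_.permute P.symm 1 As.toBlocks₁₂) := (Holds.mono hA₂ hm).permute P.symm 1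
  have hC : Holds mem₃ (_root_.permute 1 Q.symm (X.submatrix (cut eg) (cut eh)).toBlocks₂₁)
    (_root_.permute 1 Q.symm As.toBlocks₂₁) := (Holds.mono hA₃ hm).permute 1 Q.symm
  set B : Matrix (Fin r ⊕ Fin (g - r)) (Fin g) K :=
    (_root_.permute P.symm 1 As.toBlocks₁₂).submatrix rowCut id with hBdef
  set C' : Matrix (Fin h) (Fin r ⊕ Fin (h - r)) K :=
    (_root_.permute 1 Q.symm As.toBlocks₂₁).submatrix id colCut with hCdef
  refine (wp_subroutine_solveLower κ θ hS (L := (L.submatrix rowCut id).toRows₁) (B := B.toRows₁)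
    (hL.submatrix (rowCut ∘ Sum.inl) id) (hB.submatrix (rowCut ∘ Sum.inl) id)
    (fun i j hij => hd.L_upper _ _ (by simpa [← hrc] using hij))
    (fun i => hd.L_diag _ _ (by simp [← hrc]))).bind fun mem₄ D c₄ hm₄ ⟨hD, hc₄⟩ => ?_
  refine (wp_subroutine_solveUpper κ θ hS (C := C'.toCols₁) (U := (U.submatrix id colCut).toCols₁)
    ((hC.mono hm₄).submatrix id (colCut ∘ Sum.inl)) ((hU.mono hm₄).submatrix id (colCut ∘ Sum.inl))
    (fun i j hij => hd.U_lower _ _ (by simpa [← hcc] using hij))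
    (fun i => hd.U_diag _ _ (by simp [← hcc]))).bind fun mem₅ E c₅ hm₅ ⟨hE, hc₅⟩ => ?_
  obtain ⟨DK, hDK⟩ : ∃ DK, DK = (L.submatrix rowCut id).toRows₁⁻¹ * B.toRows₁ := ⟨_, rfl⟩
  obtain ⟨EK, hEK⟩ : ∃ EK, EK = C'.toCols₁ * (U.submatrix id colCut).toCols₁⁻¹ := ⟨_, rfl⟩
  rw [← hDK] at hD
  rw [← hEK] at hE
  have hm₃₅ := hm₄.trans hm₅
  refine (wp_subroutine_mul κ θ hS ((hL.mono hm₃₅).submatrix (rowCut ∘ Sum.inr) id)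
    (hD.mono hm₅)).bind fun mem₆ MD c₆ hm₆ ⟨hMD, hc₆⟩ => ?_
  have hm₃₆ := hm₃₅.trans hm₆
  refine (wp_entrywise_sub (A := B.toRows₂) ((hB.mono hm₃₆).submatrix (rowCut ∘ Sum.inr) id)
    hMD).bind fun mem₇ F c₇ hm₇ ⟨hF, hc₇⟩ => ?_
  have hm₃₇ := hm₃₆.trans hm₇
  have hm₅₇ := hm₆.trans hm₇
  refine (wp_subroutine_mul κ θ hS (hE.mono hm₅₇)
    ((hU.mono hm₃₇).submatrix id (colCut ∘ Sum.inr))).bind fun mem₈ EV c₈ hm₈ ⟨hEV, hc₈⟩ => ?_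
  have hm₃₈ := hm₃₇.trans hm₈
  refine (wp_entrywise_sub (A := C'.toCols₂) ((hC.mono hm₃₈).submatrix id (colCut ∘ Sum.inr))
    hEV).bind fun mem₉ G c₉ hm₉ ⟨hG, hc₉⟩ => ?_
  have hm₃₉ := hm₃₈.trans hm₉
  have hm₇₉ := hm₈.trans hm₉
  have hz₉ := hm₃₉.getElem?_of_eq_some hz₃
  have hH := ((holds_zero hz₉).fromRows_submatrix (hF.mono hm₇₉) rowCut.symm).permute P 1
  have hI := ((holds_zero hz₉).fromCols_submatrix hG colCut.symm).permute 1 Q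
  obtain ⟨hHeq, hHrow⟩ := permute_fromRows_schur hd As.toBlocks₁₂ hrc.symm hBdef hDK
  obtain ⟨hIeq, hIcol⟩ := permute_fromCols_schur hd As.toBlocks₂₁ hcc.symm hCdef hEK
  replace hH := hH.of_eq hHeq
  replace hI := hI.of_eq hIeq
  refine (ih₂ _ _ _ hH).bind fun mem₁₀ T₂ c₁₀ hm₁₀ ⟨t₂, hL₂, hR₂, hU₂, ht₂, hc₁₀⟩ => ?_
  refine (ih₃ _ _ _ (hI.mono hm₁₀)).bind fun mem₁₁ T₃ c₁₁ hm₁₁ ⟨t₃, hL₃, hR₃, hU₃, ht₃, hc₁₁⟩ => ?_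
  have hm₉₁₁ := hm₁₀.trans hm₁₁
  have hm₃₁₁ := hm₃₉.trans hm₉₁₁
  have hz₁₁ := hm₃₁₁.getElem?_of_eq_some hz₃
  refine (wp_entrywise_add (Holds.glue eg eh (((hL.mono hm₃₁₁).padCols hz₁₁ h).permute P Q)
    (holds_zero hz₁₁) ((((hE.mono (hm₅₇.trans hm₇₉)).mono hm₉₁₁).padCols hz₁₁ h).permute 1 Q
      |>.leftPart hz₁₁) (holds_zero hz₁₁))
    (Holds.glue eg eh (holds_zero hz₁₁) (hL₂.mono hm₁₁) hL₃ (holds_zero hz₁₁))).bind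
    fun mem₁₂ oL c₁₂ hm₁₂ ⟨hoL, hc₁₂⟩ => ?_
  have hz₁₂ := hm₁₂.getElem?_of_eq_some hz₁₁
  have hm₃₁₂ := hm₃₁₁.trans hm₁₂
  refine (wp_entrywise_add (Holds.glue eg eh (((hU.mono hm₃₁₂).padRows hz₁₂ g).permute P Q)
    ((((hD.mono (((hm₅.trans hm₅₇).trans hm₇₉).trans hm₉₁₁)).mono hm₁₂).padRows hz₁₂ g).permute P 1
      |>.leftPart hz₁₂) (holds_zero hz₁₂) (holds_zero hz₁₂))
    (Holds.glue eg eh (holds_zero hz₁₂) ((hU₂.mono hm₁₁).mono hm₁₂) (hU₃.mono hm₁₂)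
      (holds_zero hz₁₂))).bind
    fun mem₁₃ oU c₁₃ hm₁₃ ⟨hoU, hc₁₃⟩ => ?_
  have hm₃₁₃ := hm₃₁₂.trans hm₁₃
  have hm₁₁₃ := hm₁₂.trans hm₁₃
  have hz₁₃ := hm₃₁₃.getElem?_of_eq_some hz₃
  have ho₁₃ := hm₃₁₃.getElem?_of_eq_some ho₃
  have key := isBruhatGenerator_glue eg eh (A₁ := As.toBlocks₁₁) (A₄ := As.toBlocks₂₂)
    hd hHrow hIcol ht₂ ht₃
  rw [hAs, glue_submatrix_cut eg eh A] at key
  refine wp_pure.2 ⟨_, hoL.mono hm₁₃, ?_, hoU, key, fun hcost s hs => ?_⟩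
  · exact Holds.glue eg eh ((holds_pivotBlock hz₁₃ ho₁₃ g h r).permute P Q)
      (hR₂.mono (hm₁₁.trans hm₁₁₃)) (hR₃.mono hm₁₁₃) (holds_zero hz₁₃)
  have hrs : r ≤ s := r_le_of_quasisepOrder_le eg eh hs hd
  have hM : max (r : ℝ) 1 ^ θ ≤ max (s : ℝ) 1 ^ θ :=
    Real.rpow_le_rpow (by positivity) (max_le_max (by exact_mod_cast hrs) le_rfl) hθ
  have hM1 : (1 : ℝ) ≤ max (s : ℝ) 1 ^ θ := Real.one_le_rpow (le_max_right _ _) hθ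
  replace hc₁₀ := hc₁₀ hcost s (quasisepOrder_upper_le eg eh hs hd DK)
  replace hc₁₁ := hc₁₁ hcost s (quasisepOrder_lower_le eg eh hs hd EK)
  have hκn : κ * (max (r : ℝ) 1 ^ θ * (n : ℝ) ^ 2) ≤ κ * (max (s : ℝ) 1 ^ θ * (n : ℝ) ^ 2) := by
    gcongr
  replace hc₃ := (hc₃ hcost n (by omega) (by omega) (by omega)).trans hκn
  replace hc₄ := (hc₄ hcost n (by omega) (by omega) (by omega)).trans hκn
  replace hc₅ := (hc₅ hcost n (by omega) (by omega) (by omega)).trans hκn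
  replace hc₆ := (hc₆ hcost n (by omega) (by omega) (by omega) (by omega)).trans hκn
  replace hc₈ := (hc₈ hcost n (by omega) (by omega) (by omega) (by omega)).trans hκn
  have hn2 : (2 : ℝ) ≤ (n : ℝ) ^ 2 := by
    have : (2 : ℝ) ≤ n := by exact_mod_cast hn
    nlinarith
  replace hc₇ : (c₇ : ℝ) ≤ (n : ℝ) ^ 2 := hc₇.trans (by
    rw [sq]
    exact mul_le_mul (by exact_mod_cast (by omega)) (by exact_mod_cast (by omega))
      (by positivity) (by positivity))
  replace hc₉ : (c₉ : ℝ) ≤ (n : ℝ) ^ 2 := hc₉.trans (by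
    rw [sq]
    exact mul_le_mul (by exact_mod_cast (by omega)) (by exact_mod_cast (by omega))
      (by positivity) (by positivity))
  have hMn : (n : ℝ) ^ 2 ≤ max (s : ℝ) 1 ^ θ * (n : ℝ) ^ 2 :=
    le_mul_of_one_le_left (by positivity) hM1
  rw [hc₁, hc₂]
  push_cast
  -- Five subroutine calls cost at most `5 * κ * Y`. Two constants and four entrywise operations
  -- cost at most $4n^2+2\le5n^2\le5Y$.
  generalize max (s : ℝ) 1 ^ θ * (n : ℝ) ^ 2 = Y at *
  nlinarith

open FieldProg in
theorem wp_ltBruhat [Field K] {S : Subroutines K} (hS : S.Correct)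
    {κ θ : ℝ} (hκ : 0 ≤ κ) (hθ : 0 ≤ θ) (n : ℕ) :
    ∀ (A : Matrix (Fin n) (Fin n) K) (mem : List K) (X : AddrMatrix n n), Holds mem X A →
      (ltBruhat S n X).wp mem fun mem' T c =>
        ∃ t : Triple K n, Holds mem' T.L t.L ∧ Holds mem' T.R t.R ∧ Holds mem' T.U t.U ∧
          IsBruhatGenerator (leftPart A) t ∧
          (S.CostBound κ θ → ∀ s : ℕ, quasisepOrder (leftPart A) ≤ s →
            (c : ℝ) ≤ 3 * (5 * κ + 6) * (max (s : ℝ) 1 ^ θ * (n : ℝ) ^ 2)) := by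
  induction n using Nat.strong_induction_on with
  | _ n ih =>
  intro A mem X hX
  match n with
  | 0 =>
    rw [ltBruhat]
    refine wp_pure.2 ⟨⟨A, A, A⟩, hX, hX, hX, ?_, fun _ s _ => by simp⟩
    have : ∀ B : Matrix (Fin 0) (Fin 0) K, B = 0 := fun B => Subsingleton.elim _ _
    rw [this (leftPart A), this A]
    exact isBruhatGenerator_zero
  | 1 =>
    rw [ltBruhat]
    refine (wp_exec _ _).bind fun mem₁ z c₁ hm ⟨hz, hc⟩ => wp_pure.2 ?_
    refine ⟨⟨0, 0, 0⟩, holds_zero hz, holds_zero hz, holds_zero hz, ?_, fun _ s _ => ?_⟩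
    · have : leftPart A = 0 := by
        ext i j
        rw [leftPart_apply, if_neg (by omega)]
        rfl
      rw [this]
      exact isBruhatGenerator_zero
    · have : (1 : ℝ) ≤ max (s : ℝ) 1 ^ θ := Real.one_le_rpow (le_max_right _ _) hθ
      simp only [hc]
      norm_num
      nlinarith
  | k + 2 =>
    rw [ltBruhat_add_two]
    refine (wp_ltBruhatStep hS hκ hθ _ _ (by omega) (ih _ (by omega)) (ih _ (by omega)) hX).mono
      fun mem' T c _ ⟨t, hL, hR, hU, ht, hc⟩ => ⟨t, hL, hR, hU, ht, fun hS s hs => ?_⟩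
    refine (hc hS s hs).trans ?_
    have hgh := sq_add_sq_half_le k
    have h4 : (4 : ℝ) ≤ ((k + 2 : ℕ) : ℝ) ^ 2 := by
      push_cast
      nlinarith [(Nat.cast_nonneg k : (0 : ℝ) ≤ k)]
    have hM : (0 : ℝ) ≤ max (s : ℝ) 1 ^ θ := by positivity
    generalize max (s : ℝ) 1 ^ θ = M at *
    generalize ((k + 2 : ℕ) : ℝ) ^ 2 = N at *
    generalize ((k + 2 - (k + 2) / 2 : ℕ) : ℝ) ^ 2 = G at *
    generalize (((k + 2) / 2 : ℕ) : ℝ) ^ 2 = H at *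
    -- For $n\ge2$ the two halves satisfy $G+H\le(N+1)/2\le\tfrac58N$. The factor 3 leaves
    -- $\tfrac98(5\kappa+6)$ for the overhead $5\kappa+5$.
    have h5 : 0 ≤ (5 * κ + 6) * M := by positivity
    have h6 : 0 ≤ M * N := by positivity
    nlinarith

end Run

/-! ### Rectangular products and triangular inverses from square products -/

section Product

variable {K : Type u} {a b c m n : ℕ}

/-- The `I`-th block of `b` consecutive rows of a matrix, filled up with `z`. -/
def rowBlock {α : Type v} (z : α) (b : ℕ) (X : Matrix (Fin a) (Fin m) α) (I : ℕ) :
    Matrix (Fin b) (Fin m) α :=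
  Matrix.of fun u v => if h : I * b + u < a then X ⟨I * b + u, h⟩ v else z

theorem rowBlock_apply_mod {α : Type v} (z : α) (hb : 0 < b) (X : Matrix (Fin a) (Fin m) α)
    (i : Fin a) (v : Fin m) : rowBlock z b X (i / b) ⟨i % b, Nat.mod_lt _ hb⟩ v = X i v := by
  have h : (i : ℕ) / b * b + i % b = i := Nat.div_add_mod' _ _
  simp only [rowBlock, Matrix.of_apply, h, i.2, dite_true]

theorem Holds.rowBlock [Field K] {mem : List K} {X : AddrMatrix a m} {A : Matrix (Fin a) (Fin m) K}
    (h : Holds mem X A) {z : ℕ} (hz : mem[z]? = some 0) (b I : ℕ) :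
    Holds mem (rowBlock z b X I) (rowBlock 0 b A I) := fun i j => by
  simp only [_root_.rowBlock, Matrix.of_apply]
  split_ifs
  · exact h _ _
  · exact hz

open FieldProg in
/-- Multiplication of rectangular matrices by cutting them into squares whose size is the inner
dimension. -/
def rectMul (mm : (n : ℕ) → AddrMatrix n n → AddrMatrix n n → FieldProg K (AddrMatrix n n))
    [Field K] (a b c : ℕ) (X : AddrMatrix a b) (Y : AddrMatrix b c) :
    FieldProg K (AddrMatrix a c) := do
  let z ← exec (.const 0)
  if hb : b = 0 then pure (Matrix.of fun _ _ => z) else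
    let Z ← collect (a / b + 1) fun I => collect (c / b + 1) fun J =>
      mm b (rowBlock z b X I) (rowBlock z b Yᵀ J)ᵀ
    pure (Matrix.of fun i j =>
      Z ⟨i / b, Nat.lt_succ_of_le (Nat.div_le_div_right i.2.le)⟩
        ⟨j / b, Nat.lt_succ_of_le (Nat.div_le_div_right j.2.le)⟩
        ⟨i % b, Nat.mod_lt _ (Nat.pos_of_ne_zero hb)⟩ ⟨j % b, Nat.mod_lt _ (Nat.pos_of_ne_zero hb)⟩)

/-- Square matrices of size `n` are multiplied in at most `κ n ^ (θ + 2)` operations. -/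
def MulWithin [Field K]
    (mm : (n : ℕ) → AddrMatrix n n → AddrMatrix n n → FieldProg K (AddrMatrix n n))
    (κ θ : ℝ) : Prop :=
  ∀ (n : ℕ) (mem : List K) (X Y : AddrMatrix n n) (A B : Matrix (Fin n) (Fin n) K),
    Holds mem X A → Holds mem Y B → (mm n X Y).wp mem fun mem' Z cost =>
      Holds mem' Z (A * B) ∧ (cost : ℝ) ≤ κ * ((n : ℝ) ^ θ * (n : ℝ) ^ 2)

variable [Field K] {mm : (n : ℕ) → AddrMatrix n n → AddrMatrix n n → FieldProg K (AddrMatrix n n)}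
  {κ θ : ℝ} {mem : List K}

open FieldProg in
theorem wp_rectMul (hmm : MulWithin mm κ θ) (hκ : 0 ≤ κ) {X : AddrMatrix a b}
    {Y : AddrMatrix b c} {A : Matrix (Fin a) (Fin b) K} {B : Matrix (Fin b) (Fin c) K}
    (hX : Holds mem X A) (hY : Holds mem Y B) :
    (rectMul mm a b c X Y).wp mem fun mem' Z cost => Holds mem' Z (A * B) ∧
      (cost : ℝ) ≤ 1 + κ * (((a : ℝ) + b) * (c + b) * (b : ℝ) ^ θ) := by
  unfold rectMul
  refine (wp_exec _ _).bind fun mem₁ z c₁ hm₁ ⟨hz, hc₁⟩ => ?_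
  split_ifs with hb
  · subst hb
    refine wp_pure.2 ⟨fun i j => ?_, ?_⟩
    · simpa [Matrix.mul_apply, FieldOp.eval] using hz
    · simp only [hc₁, add_zero, Nat.cast_one, le_add_iff_nonneg_right]
      positivity
  · have hb : 0 < b := Nat.pos_of_ne_zero hb
    have hX₁ := hX.mono hm₁
    have hY₁ := hY.mono hm₁
    have hrow : ∀ (I : Fin (a / b + 1)) (mem₂ : List K), mem₁ <+: mem₂ →
        (collect (c / b + 1) fun J =>
          mm b (rowBlock z b X I) (rowBlock z b Yᵀ J)ᵀ).wp mem₂ fun mem₃ v cost =>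
          (∀ J, Holds mem₃ (v J) (rowBlock 0 b A I * (rowBlock 0 b Bᵀ (J : ℕ))ᵀ)) ∧
          (cost : ℝ) ≤ (c / b + 1 : ℕ) * (κ * ((b : ℝ) ^ θ * (b : ℝ) ^ 2)) := by
      intro I mem₂ hm₂
      refine wp_collect (Φ := fun J mem v => Holds mem v
        (rowBlock 0 b A I * (rowBlock 0 b Bᵀ (J : ℕ))ᵀ)) (fun J _ _ _ h hv => hv.mono h)
        fun J mem₃ hm₃ => hmm b mem₃ _ _ _ _ ?_ ?_
      · exact (hX₁.mono (hm₂.trans hm₃)).rowBlock ((hm₂.trans hm₃).getElem?_of_eq_some hz) b I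
      · exact ((hY₁.mono (hm₂.trans hm₃)).transpose.rowBlock
          ((hm₂.trans hm₃).getElem?_of_eq_some hz) b J).transpose
    refine (wp_collect (Φ := fun (I : Fin (a / b + 1)) mem (v : Fin (c / b + 1) → AddrMatrix b b) =>
      ∀ J : Fin (c / b + 1), Holds mem (v J)
      (rowBlock 0 b A (I : ℕ) * (rowBlock 0 b Bᵀ (J : ℕ))ᵀ))
      (fun I _ _ _ h hv J => (hv J).mono h) hrow).bind fun mem₂ Z c₂ hm₂ ⟨hZ, hc₂⟩ =>
      wp_pure.2 ⟨fun i j => ?_, ?_⟩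
    · refine (hZ _ _ _ _).trans (congrArg some ?_)
      simp only [Matrix.mul_apply]
      refine Finset.sum_congr rfl fun v _ => ?_
      rw [rowBlock_apply_mod 0 hb A i v, Matrix.transpose_apply, rowBlock_apply_mod 0 hb Bᵀ j v,
        Matrix.transpose_apply]
    -- Each block product costs $\kappa b^\theta b^2$. The two factors $b$ are absorbed by the
    -- numbers of row blocks and column blocks.
    · have hdiv : ∀ x : ℕ, ((x / b + 1 : ℕ) : ℝ) * b ≤ x + b := fun x => by
        have := Nat.div_mul_le_self x b
        have h1 : (x / b + 1) * b ≤ x + b := by linarith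
        exact_mod_cast h1
      have h1 := mul_le_mul (hdiv a) (hdiv c) (by positivity) (by positivity)
      have h2 : 0 ≤ κ * (b : ℝ) ^ θ := by positivity
      have h3 := mul_le_mul_of_nonneg_left h1 h2
      simp only [hc₁, add_zero]
      push_cast at hc₂ h3 ⊢
      linarith

/-- The recursive step of the inversion of lower triangular matrices. -/
def lowerInvStep (mm : (n : ℕ) → AddrMatrix n n → AddrMatrix n n → FieldProg K (AddrMatrix n n))
    {h g n : ℕ} (e : h + g = n) (rec₁ : AddrMatrix h h → FieldProg K (AddrMatrix h h))
    (rec₂ : AddrMatrix g g → FieldProg K (AddrMatrix g g)) (X : AddrMatrix n n) :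
    FieldProg K (AddrMatrix n n) := do
  let X' := X.submatrix (cut e) (cut e)
  let Y₁ ← rec₁ X'.toBlocks₁₁
  let Y₂ ← rec₂ X'.toBlocks₂₂
  let T ← rectMul mm g h h X'.toBlocks₂₁ Y₁
  let W ← rectMul mm g g h Y₂ T
  let z ← FieldProg.exec (.const 0)
  let N ← entrywise .sub (Matrix.of fun _ _ => z) W
  pure ((Matrix.fromBlocks Y₁ (Matrix.of fun _ _ => z) N Y₂).submatrix (cut e).symm (cut e).symm)

/-- Inversion of lower triangular matrices. -/
def lowerInv (mm : (n : ℕ) → AddrMatrix n n → AddrMatrix n n → FieldProg K (AddrMatrix n n)) :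
    (n : ℕ) → AddrMatrix n n → FieldProg K (AddrMatrix n n)
  | 0, X => pure X
  | 1, X => do
    let o ← FieldProg.exec (.const 1)
    let i ← FieldProg.exec (.div o (X 0 0))
    pure (Matrix.of fun _ _ => i)
  | k + 2, X => lowerInvStep mm (h := (k + 2) / 2) (g := (k + 2) - (k + 2) / 2) (by omega)
    (lowerInv mm _) (lowerInv mm _) X
termination_by n => n
decreasing_by all_goals omega

/-- The corner is written as `0 - _` because the program negates by subtracting from a zero block.
-/
theorem inv_fromBlocks_lower {h g : ℕ} (A : Matrix (Fin h) (Fin h) K) (C : Matrix (Fin g) (Fin h) K)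
    (D : Matrix (Fin g) (Fin g) K) (hA : IsUnit A) (hD : IsUnit D) :
    (Matrix.fromBlocks A 0 C D)⁻¹ = Matrix.fromBlocks A⁻¹ 0 (0 - D⁻¹ * (C * A⁻¹)) D⁻¹ := by
  have hA' := Matrix.mul_nonsing_inv _ ((Matrix.isUnit_iff_isUnit_det _).1 hA)
  have hD' := Matrix.mul_nonsing_inv _ ((Matrix.isUnit_iff_isUnit_det _).1 hD)
  refine Matrix.inv_eq_right_inv ?_
  rw [Matrix.fromBlocks_multiply, zero_sub, Matrix.mul_neg D, ← Matrix.mul_assoc D, hD', hA']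
  simp

open FieldProg in
theorem wp_lowerInvStep (hmm : MulWithin mm κ θ) (hκ : 0 ≤ κ) (hθ : 0 ≤ θ) {h g n : ℕ}
    (e : h + g = n) (hn : 2 ≤ n) {C : ℝ} (hC : 0 ≤ C)
    {rec₁ : AddrMatrix h h → FieldProg K (AddrMatrix h h)}
    {rec₂ : AddrMatrix g g → FieldProg K (AddrMatrix g g)}
    (ih₁ : ∀ (mem : List K) (X : AddrMatrix h h) (A : Matrix (Fin h) (Fin h) K), Holds mem X A →
      (∀ i j, i < j → A i j = 0) → (∀ i, A i i ≠ 0) → (rec₁ X).wp mem fun mem' Y cost =>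
        Holds mem' Y A⁻¹ ∧ (cost : ℝ) ≤ C * ((h : ℝ) ^ θ * (h : ℝ) ^ 2))
    (ih₂ : ∀ (mem : List K) (X : AddrMatrix g g) (A : Matrix (Fin g) (Fin g) K), Holds mem X A →
      (∀ i j, i < j → A i j = 0) → (∀ i, A i i ≠ 0) → (rec₂ X).wp mem fun mem' Y cost =>
        Holds mem' Y A⁻¹ ∧ (cost : ℝ) ≤ C * ((g : ℝ) ^ θ * (g : ℝ) ^ 2))
    {X : AddrMatrix n n} {A : Matrix (Fin n) (Fin n) K} (hX : Holds mem X A)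
    (hA : ∀ i j, i < j → A i j = 0) (hA' : ∀ i, A i i ≠ 0) :
    (lowerInvStep mm e rec₁ rec₂ X).wp mem fun mem' Y cost => Holds mem' Y A⁻¹ ∧
      (cost : ℝ) ≤ (n : ℝ) ^ θ * ((4 * κ + 2) * (n : ℝ) ^ 2 + C * ((h : ℝ) ^ 2 + (g : ℝ) ^ 2)) := by
  set As := A.submatrix (cut e) (cut e) with hAs
  have h₁₁ : Holds mem (X.submatrix (cut e) (cut e)).toBlocks₁₁ As.toBlocks₁₁ := fun i j => hX _ _
  have h₂₁ : Holds mem (X.submatrix (cut e) (cut e)).toBlocks₂₁ As.toBlocks₂₁ := fun i j => hX _ _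
  have h₂₂ : Holds mem (X.submatrix (cut e) (cut e)).toBlocks₂₂ As.toBlocks₂₂ := fun i j => hX _ _
  have hl₁ : ∀ i j, i < j → As.toBlocks₁₁ i j = 0 := fun i j hij =>
    hA _ _ ((cut_inl_lt_inl e).2 hij)
  have hl₂ : ∀ i j, i < j → As.toBlocks₂₂ i j = 0 := fun i j hij =>
    hA _ _ ((cut_inr_lt_inr e).2 hij)
  have hd₁ : ∀ i, As.toBlocks₁₁ i i ≠ 0 := fun i => hA' _
  have hd₂ : ∀ i, As.toBlocks₂₂ i i ≠ 0 := fun i => hA' _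
  unfold lowerInvStep
  refine (ih₁ _ _ _ h₁₁ hl₁ hd₁).bind fun mem₁ Y₁ c₁ hm₁ ⟨hY₁, hc₁⟩ => ?_
  refine (ih₂ _ _ _ (h₂₂.mono hm₁) hl₂ hd₂).bind fun mem₂ Y₂ c₂ hm₂ ⟨hY₂, hc₂⟩ => ?_
  refine (wp_rectMul hmm hκ (h₂₁.mono (hm₁.trans hm₂)) (hY₁.mono hm₂)).bind
    fun mem₃ T c₃ hm₃ ⟨hT, hc₃⟩ => ?_
  refine (wp_rectMul hmm hκ (hY₂.mono hm₃) hT).bind fun mem₄ W c₄ hm₄ ⟨hW, hc₄⟩ => ?_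
  refine (wp_exec _ _).bind fun mem₅ z c₅ hm₅ ⟨hz, hc₅⟩ => ?_
  refine (wp_entrywise_sub (holds_zero hz) (hW.mono hm₅)).bind fun mem₆ N c₆ hm₆ ⟨hN, hc₆⟩ => ?_
  have hm₂₆ := ((hm₃.trans hm₄).trans hm₅).trans hm₆
  refine wp_pure.2 ⟨?_, ?_⟩
  · have hinv : A⁻¹ = (Matrix.fromBlocks As.toBlocks₁₁⁻¹ 0
        (0 - As.toBlocks₂₂⁻¹ * (As.toBlocks₂₁ * As.toBlocks₁₁⁻¹)) As.toBlocks₂₂⁻¹).submatrix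
          (cut e).symm (cut e).symm := by
      rw [← inv_fromBlocks_lower _ _ _ (isUnit_of_lower Fin.val_injective _ hl₁ hd₁)
        (isUnit_of_lower Fin.val_injective _ hl₂ hd₂)]
      have h0 : As.toBlocks₁₂ = 0 := by
        ext i j
        refine hA _ _ (Fin.lt_def.2 ?_)
        rw [val_cut_inl, val_cut_inr]
        omega
      rw [← h0, Matrix.fromBlocks_toBlocks, ← Matrix.inv_submatrix_equiv, hAs,
        Matrix.submatrix_submatrix]
      simp
    rw [hinv]
    intro i j
    simp only [Matrix.submatrix_apply]
    rcases (cut e).symm i with i | i <;> rcases (cut e).symm j with j | j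
    · exact hY₁.mono (hm₂.trans hm₂₆) i j
    · exact hm₆.getElem?_of_eq_some hz
    · exact hN i j
    · exact hY₂.mono hm₂₆ i j
  · have hhn : (h : ℝ) ≤ n := by exact_mod_cast (by omega)
    have hgn : (g : ℝ) ≤ n := by exact_mod_cast (by omega)
    have hn' : (2 : ℝ) ≤ n := by exact_mod_cast hn
    have hhθ : (h : ℝ) ^ θ ≤ (n : ℝ) ^ θ := Real.rpow_le_rpow (by positivity) hhn hθ
    have hgθ : (g : ℝ) ^ θ ≤ (n : ℝ) ^ θ := Real.rpow_le_rpow (by positivity) hgn hθ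
    have hnθ : 1 ≤ (n : ℝ) ^ θ := Real.one_le_rpow (by linarith) hθ
    have e₁ : (c₁ : ℝ) ≤ C * ((n : ℝ) ^ θ * (h : ℝ) ^ 2) := hc₁.trans (by gcongr)
    have e₂ : (c₂ : ℝ) ≤ C * ((n : ℝ) ^ θ * (g : ℝ) ^ 2) := hc₂.trans (by gcongr)
    have hgh : (g : ℝ) + h = n := by rw [add_comm]; exact_mod_cast e
    have e₃ : (c₃ : ℝ) ≤ 1 + κ * ((n : ℝ) * (2 * n) * (n : ℝ) ^ θ) := hc₃.trans (by
      gcongr ?_ + κ * (?_ * ?_ * ?_) <;> linarith)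
    have e₄ : (c₄ : ℝ) ≤ 1 + κ * ((2 * n) * (n : ℝ) * (n : ℝ) ^ θ) := hc₄.trans (by
      gcongr ?_ + κ * (?_ * ?_ * ?_) <;> linarith)
    -- The 3 collects the additive units of the two rectangular products and the zero register.
    have e₆ : (c₆ : ℝ) + 3 ≤ 2 * (n : ℝ) ^ 2 := by nlinarith
    have e₇ : 2 * (n : ℝ) ^ 2 ≤ (n : ℝ) ^ θ * (2 * (n : ℝ) ^ 2) :=
      le_mul_of_one_le_left (by positivity) hnθ
    rw [hc₅]
    push_cast
    linarith

/-- The sum of the squares of the halves is at most $\tfrac58n^2$. It remains that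
$\tfrac38(12\kappa+9)$ exceeds the overhead $4\kappa+2$ of a step. -/
theorem wp_lowerInv (hmm : MulWithin mm κ θ) (hκ : 0 ≤ κ) (hθ : 0 ≤ θ) (n : ℕ) :
    ∀ (mem : List K) (X : AddrMatrix n n) (A : Matrix (Fin n) (Fin n) K), Holds mem X A →
      (∀ i j, i < j → A i j = 0) → (∀ i, A i i ≠ 0) → (lowerInv mm n X).wp mem fun mem' Y cost =>
        Holds mem' Y A⁻¹ ∧ (cost : ℝ) ≤ (12 * κ + 9) * ((n : ℝ) ^ θ * (n : ℝ) ^ 2) := by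
  induction n using Nat.strong_induction_on with
  | _ n ih =>
  intro mem X A hX hA hA'
  match n with
  | 0 =>
    rw [lowerInv]
    exact FieldProg.wp_pure.2 ⟨fun i => i.elim0, by simp⟩
  | 1 =>
    rw [lowerInv]
    refine (FieldProg.wp_exec _ _).bind fun mem₁ o c₁ hm₁ ⟨ho, hc₁⟩ => ?_
    refine (FieldProg.wp_exec _ _).bind fun mem₂ i c₂ hm₂ ⟨hi, hc₂⟩ => FieldProg.wp_pure.2 ⟨?_, ?_⟩
    · intro s t
      have h1 := hX.mono hm₁ 0 0
      have h2 : A⁻¹ s t = (A 0 0)⁻¹ := by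
        rw [Subsingleton.elim s 0, Subsingleton.elim t 0, Matrix.inv_def, Matrix.adjugate_fin_one]
        simp
      rw [h2]
      refine hi.trans ?_
      simp [FieldOp.eval, List.getD, ho, h1]
    · rw [hc₁, hc₂]
      norm_num
      linarith
  | k + 2 =>
    rw [lowerInv]
    refine (wp_lowerInvStep hmm hκ hθ _ (by omega) (C := 12 * κ + 9) (by positivity)
      (ih _ (by omega)) (ih _ (by omega)) hX hA hA').mono fun mem' Y cost _ ⟨hY, hc⟩ => ⟨hY, ?_⟩
    refine hc.trans ?_
    rw [mul_left_comm]
    refine mul_le_mul_of_nonneg_left ?_ (by positivity)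
    have h1 := sq_add_sq_half_le k
    have h4 : (4 : ℝ) ≤ ((k + 2 : ℕ) : ℝ) ^ 2 := by
      push_cast
      nlinarith [(Nat.cast_nonneg k : (0 : ℝ) ≤ k)]
    nlinarith

end Product

/-! ### Rank-sensitive elimination -/

/-- The output of the elimination of an `m × n` matrix: `r` pivots, in the rows `p t` and columns
`q t`, and the two factors. -/
structure Elimination (α : Type v) (m n : ℕ) : Type v where
  r : ℕ
  p : Fin r → Fin m
  q : Fin r → Fin n
  L : Matrix (Fin m) (Fin r) α
  U : Matrix (Fin r) (Fin n) α

section Elimination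

variable {K : Type u} {m n : ℕ}

/-- The registers hold an elimination of `A`. -/
def HoldsElimination [Field K] (mem : List K) (d : Elimination ℕ m n)
    (A : Matrix (Fin m) (Fin n) K) : Prop :=
  ∃ (L : Matrix (Fin m) (Fin d.r) K) (U : Matrix (Fin d.r) (Fin n) K), Holds mem d.L L ∧
    Holds mem d.U U ∧ IsPivoting (fun t : Fin d.r => (t : ℕ)) d.p d.q L U ∧ A = L * U

/-- The elimination without pivots. -/
def Elimination.empty (α : Type v) (m n : ℕ) : Elimination α m n :=
  ⟨0, Fin.elim0, Fin.elim0, Matrix.of fun _ t => t.elim0, Matrix.of fun t _ => t.elim0⟩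

theorem holdsElimination_empty [Field K] {mem : List K} {A : Matrix (Fin m) (Fin n) K}
    (hA : A = 0) : HoldsElimination mem (Elimination.empty ℕ m n) A := by
  refine ⟨0, 0, fun _ t => t.elim0, fun t => t.elim0, ?_, by simp [hA]⟩
  constructor <;> intro s <;> first | exact s.elim0 | (intro t; exact t.elim0)

open FieldProg in
/-- Elimination of a single row: find the first nonzero entry. -/
def elimRow [Field K] (n : ℕ) (X : AddrMatrix 1 n) : FieldProg K (Elimination ℕ 1 n) := do
  let v ← collect n fun j => test (X 0 j) ret
  if h : (Finset.univ.filter fun j => v j = false).Nonempty then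
    let o ← exec (.const 1)
    pure ⟨1, fun _ => 0, fun _ => (Finset.univ.filter fun j => v j = false).min' h,
      Matrix.of fun _ _ => o, X⟩
  else pure (Elimination.empty ℕ 1 n)

open FieldProg in
/-- The multipliers of the remaining rows `X` with respect to the pivot rows of `d`, and the
remaining rows after the elimination. -/
def elimUpdate (mm : (n : ℕ) → AddrMatrix n n → AddrMatrix n n → FieldProg K (AddrMatrix n n))
    [Field K] {m₁ m₂ n : ℕ} (d : Elimination ℕ m₁ n) (X : AddrMatrix m₂ n) :
    FieldProg K (AddrMatrix m₂ d.r × AddrMatrix m₂ n) :=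
  -- Without pivots the update has to be free: the bound is proportional to $r^\theta$, which is $0$
  -- for $\theta>0$, whereas even the entrywise subtraction would cost $m_2n$. The address 0 is
  -- never read, as the matrix has no columns.
  if d.r = 0 then pure (Matrix.of fun _ _ => 0, X) else do
    let Y ← lowerInv mm d.r (d.U.submatrix id d.q)ᵀ
    let E ← rectMul mm m₂ d.r d.r (X.submatrix id d.q) Yᵀ
    let W ← rectMul mm m₂ d.r n E d.U
    let G ← entrywise .sub X W
    pure (E, G)

/-- Stack an elimination `d₁` of the upper rows with multipliers `E`, and an elimination `d₂` of
what remains of the lower rows. -/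
def Elimination.stack {α : Type v} (z : α) {m₁ m₂ m n : ℕ} (e : m₁ + m₂ = m)
    (d₁ : Elimination α m₁ n) (E : Matrix (Fin m₂) (Fin d₁.r) α) (d₂ : Elimination α m₂ n) :
    Elimination α m n where
  r := d₁.r + d₂.r
  p := cut e ∘ Sum.elim (Sum.inl ∘ d₁.p) (Sum.inr ∘ d₂.p) ∘ finSumFinEquiv.symm
  q := Sum.elim d₁.q d₂.q ∘ finSumFinEquiv.symm
  L := (Matrix.fromBlocks d₁.L (Matrix.of fun _ _ => z) E d₂.L).submatrix (cut e).symm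
    finSumFinEquiv.symm
  U := (Matrix.fromRows d₁.U d₂.U).submatrix finSumFinEquiv.symm id

open FieldProg in
/-- Elimination of matrices with at most `2 ^ k` rows, by halving the set of rows. -/
def elim (mm : (n : ℕ) → AddrMatrix n n → AddrMatrix n n → FieldProg K (AddrMatrix n n))
    [Field K] : (k m n : ℕ) → AddrMatrix m n → FieldProg K (Elimination ℕ m n)
  | 0, 0, n, _ => pure (Elimination.empty ℕ 0 n)
  | 0, 1, n, X => elimRow n X
  -- A default value, excluded by $m\le2^k$.
  | 0, m + 2, n, _ => pure (Elimination.empty ℕ (m + 2) n)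
  | k + 1, m, n, X => do
    let e : min m (2 ^ k) + (m - min m (2 ^ k)) = m := by omega
    let d₁ ← elim mm k _ n (X.submatrix (cut e ∘ Sum.inl) id)
    let EG ← elimUpdate mm d₁ (X.submatrix (cut e ∘ Sum.inr) id)
    let d₂ ← elim mm k _ n EG.2
    let z ← exec (.const 0)
    pure (d₁.stack z e EG.1 d₂)

variable [Field K] {mm : (n : ℕ) → AddrMatrix n n → AddrMatrix n n → FieldProg K (AddrMatrix n n)}
  {κ θ : ℝ} {mem : List K}

open FieldProg in
theorem wp_elimRow {X : AddrMatrix 1 n} {A : Matrix (Fin 1) (Fin n) K} (hX : Holds mem X A) :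
    (elimRow n X).wp mem fun mem' d cost => HoldsElimination mem' d A ∧
      (cost : ℝ) ≤ n + 1 := by
  unfold elimRow
  refine (wp_collect (c := 1) (Φ := fun j _ (b : Bool) => b = true ↔ A 0 j = 0)
    (fun _ _ _ _ _ h => h) fun j mem₁ hm₁ => (wp_test ((hX.mono hm₁) 0 j)).mono
      fun _ _ c _ h => ⟨h.1, by simp [h.2]⟩).bind fun mem₁ v c₁ hm₁ ⟨hv, hc₁⟩ => ?_
  have hv' : ∀ j, v j = false ↔ A 0 j ≠ 0 := fun j => by rw [Ne, ← hv, Bool.not_eq_true]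
  split_ifs with h
  · refine (wp_exec _ _).bind fun mem₂ o c₂ hm₂ ⟨ho, hc₂⟩ => wp_pure.2 ⟨?_, ?_⟩
    · have hmem := Finset.min'_mem _ h
      have hmin := fun j => Finset.min'_le (Finset.univ.filter fun j => v j = false) j
      simp only [Finset.mem_filter, Finset.mem_univ, true_and, hv'] at hmem hmin
      refine ⟨Matrix.of fun _ _ => 1, A, fun _ _ => ho, (hX.mono hm₁).mono hm₂, ?_, ?_⟩
      · refine ⟨Fin.val_injective, fun s t _ => ?_, fun s t _ => ?_, fun i t hi => ?_,
          fun s t hst => ?_, fun t => rfl, fun t j hj => ?_, fun s t hst => ?_, fun t => ?_⟩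
        · exact Subsingleton.elim (α := Fin 1) s t
        · exact Subsingleton.elim (α := Fin 1) s t
        · exact absurd hi (by simp)
        · rw [Subsingleton.elim (α := Fin 1) s t] at hst
          exact absurd hst (lt_irrefl _)
        · rw [Subsingleton.elim (α := Fin 1) t 0]
          by_contra hne
          exact absurd hj (not_lt.2 (hmin j hne))
        · rw [Subsingleton.elim (α := Fin 1) s t] at hst
          exact absurd hst (lt_irrefl _)
        · rw [Subsingleton.elim (α := Fin 1) t 0]
          exact hmem
      · ext i j
        rw [Subsingleton.elim i 0]
        have h1 : ((Matrix.of fun (_ _ : Fin 1) => (1 : K)) * A) 0 j = 1 * A 0 j :=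
          (Matrix.mul_apply).trans (Fin.sum_univ_one _)
        exact (h1.trans (one_mul _)).symm
    · rw [hc₂]
      push_cast
      linarith
  · refine wp_pure.2 ⟨holdsElimination_empty ?_, by push_cast; linarith⟩
    ext i j
    rw [Subsingleton.elim i 0]
    by_contra hne
    exact h ⟨j, by simpa [hv'] using hne⟩

open FieldProg in
-- On the pivot columns `U` is an invertible triangular matrix $U_q$, and $E=A_qU_q^{-1}$ clears
-- these columns in the lower rows. Since $r\le M$ and $r\le n$, the inversion and the two products
-- all fit into $Mn\,r^\theta$.
theorem wp_elimUpdate (hmm : MulWithin mm κ θ) (hκ : 0 ≤ κ) (hθ : 0 ≤ θ) {m₁ m₂ : ℕ}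
    {d : Elimination ℕ m₁ n} {X : AddrMatrix m₂ n} {A : Matrix (Fin m₂) (Fin n) K}
    {L : Matrix (Fin m₁) (Fin d.r) K} {U : Matrix (Fin d.r) (Fin n) K} (hX : Holds mem X A)
    (hU : Holds mem d.U U) (hd : IsPivoting (fun t : Fin d.r => (t : ℕ)) d.p d.q L U)
    {M : ℕ} (hm₁ : m₁ ≤ M) (hm₂ : m₂ ≤ M) :
    (elimUpdate mm d X).wp mem fun mem' EG cost =>
      (∃ E : Matrix (Fin m₂) (Fin d.r) K, Holds mem' EG.1 E ∧ Holds mem' EG.2 (A - E * U) ∧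
        ∀ i t, (A - E * U) i (d.q t) = 0) ∧
      (cost : ℝ) ≤ (20 * κ + 12) * ((M : ℝ) * n * (d.r : ℝ) ^ θ) := by
  unfold elimUpdate
  split_ifs with hr
  · refine wp_pure.2 ⟨⟨0, fun i t => ?_, ?_, fun i t => ?_⟩,
      by simp only [Nat.cast_zero]; positivity⟩
    · exact absurd t.2 (by omega)
    · simpa using hX
    · exact absurd t.2 (by omega)
  · have hunit := hd.isUnit_U
    have hrm : d.r ≤ m₁ := by simpa using Fintype.card_le_of_injective d.p hd.row_inj
    have hrn : d.r ≤ n := by simpa using Fintype.card_le_of_injective d.q hd.col_inj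
    refine (wp_lowerInv hmm hκ hθ _ _ _ ((U.submatrix id d.q)ᵀ) ((hU.submatrix id d.q).transpose)
      (fun i j hij => hd.U_pivot i j hij) (fun i => hd.U_diag i)).bind
      fun mem₁ Y c₁ hm₁ ⟨hY, hc₁⟩ => ?_
    rw [← Matrix.transpose_nonsing_inv] at hY
    refine (wp_rectMul hmm hκ ((hX.mono hm₁).submatrix id d.q) hY.transpose).bind
      fun mem₂ E c₂ hm₂ ⟨hE, hc₂⟩ => ?_
    rw [Matrix.transpose_transpose] at hE
    refine (wp_rectMul hmm hκ hE (hU.mono (hm₁.trans hm₂))).bind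
      fun mem₃ W c₃ hm₃ ⟨hW, hc₃⟩ => ?_
    refine (wp_entrywise_sub (hX.mono ((hm₁.trans hm₂).trans hm₃)) hW).bind
      fun mem₄ G c₄ hm₄ ⟨hG, hc₄⟩ => wp_pure.2 ⟨⟨_, hE.mono (hm₃.trans hm₄), hG, ?_⟩, ?_⟩
    · intro i t
      have h1 : A.submatrix id d.q * (U.submatrix id d.q)⁻¹ * U.submatrix id d.q =
          A.submatrix id d.q := by
        rw [Matrix.mul_assoc, Matrix.nonsing_inv_mul _ ((Matrix.isUnit_iff_isUnit_det _).1 hunit),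
          Matrix.mul_one]
      have h2 := congr_fun₂ h1 i t
      rw [Matrix.sub_apply, sub_eq_zero]
      exact h2.symm
    · have hr1 : (1 : ℝ) ≤ d.r := by exact_mod_cast Nat.one_le_iff_ne_zero.2 hr
      have hrM : (d.r : ℝ) ≤ M := by exact_mod_cast hrm.trans ‹m₁ ≤ M›
      have hmM : (m₂ : ℝ) ≤ M := by exact_mod_cast ‹m₂ ≤ M›
      have hrn' : (d.r : ℝ) ≤ n := by exact_mod_cast hrn
      have hrθ : 1 ≤ (d.r : ℝ) ^ θ := Real.one_le_rpow hr1 hθ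
      have e₀ : (M : ℝ) * n ≤ M * n * (d.r : ℝ) ^ θ := le_mul_of_one_le_right (by positivity) hrθ
      have e₀' : (1 : ℝ) ≤ M * n := by nlinarith
      have e₁ : (c₁ : ℝ) ≤ (12 * κ + 9) * ((M : ℝ) * n * (d.r : ℝ) ^ θ) := hc₁.trans (by
        rw [mul_comm ((d.r : ℝ) ^ θ), sq]
        gcongr)
      have e₂ : (c₂ : ℝ) ≤ 1 + κ * (4 * ((M : ℝ) * n * (d.r : ℝ) ^ θ)) := hc₂.trans (by
        have : ((m₂ : ℝ) + d.r) * ((d.r : ℝ) + d.r) ≤ 4 * (M * n) :=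
          calc _ ≤ (2 * (M : ℝ)) * (2 * n) := by gcongr <;> linarith
            _ = _ := by ring
        rw [← mul_assoc 4]
        gcongr)
      have e₃ : (c₃ : ℝ) ≤ 1 + κ * (4 * ((M : ℝ) * n * (d.r : ℝ) ^ θ)) := hc₃.trans (by
        have : ((m₂ : ℝ) + d.r) * ((n : ℝ) + d.r) ≤ 4 * (M * n) :=
          calc _ ≤ (2 * (M : ℝ)) * (2 * n) := by gcongr <;> linarith
            _ = _ := by ring
        rw [← mul_assoc 4]
        gcongr)
      have e₄ : (c₄ : ℝ) ≤ M * n := hc₄.trans (by gcongr)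
      push_cast
      linarith

/-- The columns cleared by the update force `U₂` to vanish on the earlier pivot columns, and the
rows of the two parts are disjoint. So `IsPivoting.sum` applies; listing the upper pivots first
gives the order of `Fin (d₁.r + d₂.r)`. -/
theorem holdsElimination_stack {m₁ m₂ : ℕ} (e : m₁ + m₂ = m) {d₁ : Elimination ℕ m₁ n}
    {d₂ : Elimination ℕ m₂ n} {X : AddrMatrix m₂ d₁.r} {A : Matrix (Fin m) (Fin n) K}
    {E : Matrix (Fin m₂) (Fin d₁.r) K} {L : Matrix (Fin m₁) (Fin d₁.r) K}
    {U : Matrix (Fin d₁.r) (Fin n) K} (hL : Holds mem d₁.L L) (hU : Holds mem d₁.U U)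
    (hd₁ : IsPivoting (fun t : Fin d₁.r => (t : ℕ)) d₁.p d₁.q L U)
    (hLU : A.submatrix (cut e ∘ Sum.inl) id = L * U) (hX : Holds mem X E)
    (hd₂ : HoldsElimination mem d₂ (A.submatrix (cut e ∘ Sum.inr) id - E * U))
    (h0 : ∀ i t, (A.submatrix (cut e ∘ Sum.inr) id - E * U) i (d₁.q t) = 0) {z : ℕ}
    (hz : mem[z]? = some 0) : HoldsElimination mem (d₁.stack z e X d₂) A := by
  obtain ⟨L₂, U₂, hL₂, hU₂, hd₂, hLU₂⟩ := hd₂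
  have hU0 : ∀ s t, U₂ t (d₁.q s) = 0 := fun s t =>
    hd₂.U_eq_zero_of_col (fun i => by rw [← hLU₂]; exact h0 i s) t
  have hp : IsPivoting (fun t : Fin (d₁.r + d₂.r) => (t : ℕ))
      (cut e ∘ Sum.elim (Sum.inl ∘ d₁.p) (Sum.inr ∘ d₂.p) ∘ finSumFinEquiv.symm)
      (Sum.elim d₁.q d₂.q ∘ finSumFinEquiv.symm)
      ((Matrix.fromBlocks L 0 E L₂).submatrix (cut e).symm finSumFinEquiv.symm)
      ((Matrix.fromRows U U₂).submatrix finSumFinEquiv.symm id) := by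
    have h1 : IsPivoting (fun t : Fin d₁.r => (t : ℕ)) (cut e ∘ Sum.inl ∘ d₁.p) d₁.q
        ((Matrix.fromRows L E).submatrix (cut e).symm id) U := by
      refine ⟨hd₁.ord_inj, ((cut e).injective.comp Sum.inl_injective).comp hd₁.row_inj, hd₁.col_inj,
        ?_, fun s t hst => ?_, fun t => ?_, hd₁.U_upper, hd₁.U_pivot, hd₁.U_diag⟩
      · rw [forall_cut e]
        refine ⟨fun i t hi => ?_, fun i t hi => absurd hi (not_cut_inr_lt_inl e)⟩
        simpa using hd₁.L_lower i t ((cut_inl_lt_inl e).1 hi)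
      · simpa using hd₁.L_pivot s t hst
      · simpa using hd₁.L_diag t
    have h2 : IsPivoting (fun t : Fin d₂.r => (t : ℕ)) (cut e ∘ Sum.inr ∘ d₂.p) d₂.q
        ((Matrix.fromRows 0 L₂).submatrix (cut e).symm id) U₂ := by
      refine ⟨hd₂.ord_inj, ((cut e).injective.comp Sum.inr_injective).comp hd₂.row_inj, hd₂.col_inj,
        ?_, fun s t hst => ?_, fun t => ?_, hd₂.U_upper, hd₂.U_pivot, hd₂.U_diag⟩
      · rw [forall_cut e]
        refine ⟨fun i t hi => by simp, fun i t hi => ?_⟩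
        simpa using hd₂.L_lower i t ((cut_inr_lt_inr e).1 hi)
      · simpa using hd₂.L_pivot s t hst
      · simpa using hd₂.L_diag t
    obtain ⟨N, hN, h3⟩ := h1.sum h2 (fun s t => by simp) hU0
    have h4 := (h3.comp finSumFinEquiv.symm finSumFinEquiv.symm.injective).congr_ord
      (ord' := fun t : Fin (d₁.r + d₂.r) => (t : ℕ)) fun s t => by
        obtain ⟨s, rfl⟩ := finSumFinEquiv.surjective s
        obtain ⟨t, rfl⟩ := finSumFinEquiv.surjective t
        simp only [Function.comp_apply, Equiv.symm_apply_apply]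
        rcases s with s | s <;> rcases t with t | t <;>
          simp only [Sum.elim_inl, Sum.elim_inr, finSumFinEquiv_apply_left,
            finSumFinEquiv_apply_right, Fin.val_castAdd, Fin.val_natAdd]
        · have := hN s; omega
        · have := hN t; omega
        · omega
    convert h4 using 1
    · funext t
      obtain ⟨t, rfl⟩ := finSumFinEquiv.surjective t
      rcases t with t | t <;> simp
    · ext i t
      obtain ⟨i, rfl⟩ := (cut e).surjective i
      obtain ⟨t, rfl⟩ := finSumFinEquiv.surjective t
      rcases i with i | i <;> rcases t with t | t <;> simp
  refine ⟨_, _, fun i t => ?_, fun t j => ?_, hp, ?_⟩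
  · have h1 : ∀ i t, mem[Matrix.fromBlocks d₁.L (Matrix.of fun _ _ => z) X d₂.L i t]? =
        some (Matrix.fromBlocks L 0 E L₂ i t) := by
      rintro (i | i) (t | t)
      exacts [hL i t, hz, hX i t, hL₂ i t]
    exact h1 _ _
  · have h1 : ∀ t, mem[Matrix.fromRows d₁.U d₂.U t j]? = some (Matrix.fromRows U U₂ t j) := by
      rintro (t | t)
      exacts [hU t j, hU₂ t j]
    exact h1 _
  · have h1 : (Matrix.fromBlocks L 0 E L₂).submatrix (cut e).symm finSumFinEquiv.symm *
        (Matrix.fromRows U U₂).submatrix finSumFinEquiv.symm id =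
        (Matrix.fromBlocks L 0 E L₂ * Matrix.fromRows U U₂).submatrix (cut e).symm id :=
      Matrix.submatrix_mul_equiv _ _ _ _ _
    refine Eq.trans (Matrix.ext ?_) h1.symm
    rw [forall_cut e]
    refine ⟨fun i j => ?_, fun i j => ?_⟩
    · have := congr_fun₂ hLU i j
      simp only [Matrix.submatrix_apply, Function.comp_apply, id] at this
      simp [this, Matrix.mul_apply, Fintype.sum_sum_type]
    · have := congr_fun₂ hLU₂ i j
      simp only [Matrix.sub_apply, Matrix.submatrix_apply, Function.comp_apply, id,
        sub_eq_iff_eq_add] at this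
      simp [this, Matrix.mul_apply, Fintype.sum_sum_type, add_comm]

/-- Concavity of `x ↦ x ^ θ`. -/
theorem rpow_add_rpow_le {θ : ℝ} (hθ : 0 < θ) (hθ₁ : θ ≤ 1) {x y : ℝ} (hx : 0 ≤ x) (hy : 0 ≤ y) :
    x ^ θ + y ^ θ ≤ 2 * ((1 / 2) ^ θ * (x + y) ^ θ) := by
  have h := (Real.concaveOn_rpow hθ.le hθ₁).2 (Set.mem_Ici.2 hx) (Set.mem_Ici.2 hy)
    (show (0 : ℝ) ≤ 1 / 2 by norm_num) (show (0 : ℝ) ≤ 1 / 2 by norm_num) (by norm_num)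
  simp only [smul_eq_mul, ← mul_add] at h
  rw [Real.mul_rpow (by norm_num) (by positivity)] at h
  linarith

open FieldProg in
theorem wp_elim (hmm : MulWithin mm κ θ) (hκ : 0 ≤ κ) (hθ : 0 < θ) (hθ₁ : θ ≤ 1) (n k : ℕ) :
    ∀ (m : ℕ) (_ : m ≤ 2 ^ k) (mem : List K) (X : AddrMatrix m n) (A : Matrix (Fin m) (Fin n) K),
      Holds mem X A → (elim mm k m n X).wp mem fun mem' d cost => HoldsElimination mem' d A ∧
        (cost : ℝ) + 1 ≤ 2 ^ k * (n + 1) *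
          (3 + (20 * κ + 12) / (2 * (1 - (1 / 2) ^ θ)) * (d.r : ℝ) ^ θ) := by
  have hhalf : ((1 : ℝ) / 2) ^ θ < 1 := Real.rpow_lt_one (by norm_num) (by norm_num) hθ
  -- This `β` solves $2\cdot2^{-\theta}\beta+(20\kappa+12)=2\beta$: the two halves, by concavity,
  -- and the update together exactly fill the bound at the next level. The denominator is positive
  -- because $\theta>0$.
  set β := (20 * κ + 12) / (2 * (1 - (1 / 2 : ℝ) ^ θ)) with hβ
  have hβ0 : 0 ≤ β := div_nonneg (by positivity) (by linarith)
  have hβ1 : 20 * κ + 12 = 2 * β - 2 * β * (1 / 2 : ℝ) ^ θ := by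
    have : 1 - (1 / 2 : ℝ) ^ θ ≠ 0 := by linarith
    rw [hβ]
    field_simp
  induction k with
  | zero =>
    intro m hm mem X A hX
    match m, hm with
    | 0, _ =>
      refine wp_pure.2 ⟨holdsElimination_empty (by ext i; exact i.elim0), ?_⟩
      simp only [Elimination.empty, Nat.cast_zero, Real.zero_rpow hθ.ne']
      have : (0 : ℝ) ≤ n := by positivity
      linarith
    | 1, _ =>
      refine (wp_elimRow hX).mono fun mem' d cost _ ⟨hd, hc⟩ => ⟨hd, ?_⟩
      have h1 : (0 : ℝ) ≤ (n + 1) * (β * (d.r : ℝ) ^ θ) := by positivity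
      have : (0 : ℝ) ≤ n := by positivity
      rw [pow_zero, one_mul, mul_add]
      linarith
  | succ k ih =>
    intro m hm mem X A hX
    rw [pow_succ] at hm
    have e : min m (2 ^ k) + (m - min m (2 ^ k)) = m := by omega
    rw [elim]
    refine (ih _ (by omega) _ _ _ (hX.submatrix (cut e ∘ Sum.inl) id)).bind
      fun mem₁ d₁ c₁ hm₁ ⟨⟨L, U, hL, hU, hd₁, hLU⟩, hc₁⟩ => ?_
    refine (wp_elimUpdate hmm hκ hθ.le (M := 2 ^ k) ((hX.mono hm₁).submatrix (cut e ∘ Sum.inr) id)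
      hU hd₁ (by omega) (by omega)).bind fun mem₂ EG c₂ hm₂ ⟨⟨E, hE, hG, h0⟩, hc₂⟩ => ?_
    refine (ih _ (by omega) _ _ _ hG).bind fun mem₃ d₂ c₃ hm₃ ⟨⟨L₂, U₂, hL₂, hU₂, hd₂⟩, hc₃⟩ => ?_
    refine (wp_exec _ _).bind fun mem₄ z c₄ hm₄ ⟨hz, hc₄⟩ => wp_pure.2 ⟨?_, ?_⟩
    · have hm₃₄ := hm₃.trans hm₄
      exact holdsElimination_stack e (hL.mono (hm₂.trans hm₃₄)) (hU.mono (hm₂.trans hm₃₄)) hd₁ hLU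
        (hE.mono hm₃₄) ⟨L₂, U₂, hL₂.mono hm₄, hU₂.mono hm₄, hd₂⟩ h0 hz
    -- The induction bounds the cost plus one, so the second of the two units from the halves pays
    -- for the constant loaded here.
    · have hr : ((d₁.stack z e EG.1 d₂).r : ℝ) = (d₁.r : ℝ) + d₂.r := by
        simp [Elimination.stack]
      rw [hr, hc₄]
      have hconc := rpow_add_rpow_le hθ hθ₁ (Nat.cast_nonneg d₁.r) (Nat.cast_nonneg d₂.r)
      have hmono : (d₁.r : ℝ) ^ θ ≤ ((d₁.r : ℝ) + d₂.r) ^ θ :=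
        Real.rpow_le_rpow (by positivity) (by simp) hθ.le
      have hn : (n : ℝ) * (d₁.r : ℝ) ^ θ ≤ (n + 1) * ((d₁.r : ℝ) + d₂.r) ^ θ := by
        gcongr
        linarith
      have h2 : (c₂ : ℝ) ≤ 2 ^ k * ((n + 1) * ((2 * β - 2 * β * (1 / 2 : ℝ) ^ θ) *
          ((d₁.r : ℝ) + d₂.r) ^ θ)) := by
        rw [← hβ1]
        refine hc₂.trans ?_
        push_cast
        calc (20 * κ + 12) * ((2 : ℝ) ^ k * n * (d₁.r : ℝ) ^ θ)
            = (20 * κ + 12) * 2 ^ k * (n * (d₁.r : ℝ) ^ θ) := by ring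
          _ ≤ (20 * κ + 12) * 2 ^ k * ((n + 1) * ((d₁.r : ℝ) + d₂.r) ^ θ) := by gcongr
          _ = _ := by ring
      have h3 := mul_le_mul_of_nonneg_left hconc (show 0 ≤ 2 ^ k * ((n : ℝ) + 1) * β by positivity)
      rw [pow_succ]
      push_cast
      linarith

/-- The PLUQ decomposition that belongs to an elimination. -/
noncomputable def Elimination.toPLUQ {α : Type v} (d : Elimination α m n) : PLUQ α m n := by
  classical exact
    if h : Function.Injective d.p ∧ Function.Injective d.q then
      let hm : d.r ≤ m := by simpa using Fintype.card_le_of_injective d.p h.1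
      let hn : d.r ≤ n := by simpa using Fintype.card_le_of_injective d.q h.2
      let P := (exists_perm_extending hm h.1).choose
      let Q := (exists_perm_extending hn h.2).choose
      ⟨d.r, hm, hn, P.symm, Q, d.L.submatrix P id, d.U.submatrix id Q⟩
    else ⟨0, Nat.zero_le _, Nat.zero_le _, 1, 1, Matrix.of fun _ t => t.elim0,
      Matrix.of fun t _ => t.elim0⟩

theorem Elimination.toPLUQ_eq {α : Type v} (d : Elimination α m n) (hp : Function.Injective d.p)
    (hq : Function.Injective d.q) (hm : d.r ≤ m) (hn : d.r ≤ n) :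
    ∃ (P : Equiv.Perm (Fin m)) (Q : Equiv.Perm (Fin n)),
      (∀ t, P (Fin.castLE hm t) = d.p t) ∧ (∀ t, Q (Fin.castLE hn t) = d.q t) ∧
      d.toPLUQ = ⟨d.r, hm, hn, P.symm, Q, d.L.submatrix P id, d.U.submatrix id Q⟩ :=
  ⟨_, _, (exists_perm_extending hm hp).choose_spec, (exists_perm_extending hn hq).choose_spec, by
    rw [Elimination.toPLUQ, dif_pos ⟨hp, hq⟩]⟩

end Elimination

/-! ### Subroutines built from square multiplication -/

section Subroutines

variable {K : Type u} [Field K]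

open FieldProg in
/-- Subroutines derived from a multiplication of square matrices. -/
noncomputable def subroutinesOfMul
    (mm : (n : ℕ) → AddrMatrix n n → AddrMatrix n n → FieldProg K (AddrMatrix n n)) :
    Subroutines K where
  mul := rectMul mm
  solveLower r c X Y := do
    let I ← lowerInv mm r X
    rectMul mm r r c I Y
  solveUpper a r X Y := do
    let I ← lowerInv mm r Yᵀ
    rectMul mm a r r X Iᵀ
  pluq m n X := do
    let d ← elim mm (Nat.clog 2 m) m n X
    pure d.toPLUQ

variable {mm : (n : ℕ) → AddrMatrix n n → AddrMatrix n n → FieldProg K (AddrMatrix n n)}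
  {κ θ : ℝ} {mem : List K}

open FieldProg in
theorem wp_solveLower (hmm : MulWithin mm κ θ) (hκ : 0 ≤ κ) (hθ : 0 ≤ θ) {r c : ℕ}
    {X : AddrMatrix r r} {Y : AddrMatrix r c} {L : Matrix (Fin r) (Fin r) K}
    {B : Matrix (Fin r) (Fin c) K} (hX : Holds mem X L) (hY : Holds mem Y B)
    (hL : ∀ i j, i < j → L i j = 0) (hd : ∀ i, L i i = 1) :
    ((subroutinesOfMul mm).solveLower r c X Y).wp mem fun mem' Z cost => Holds mem' Z (L⁻¹ * B) ∧
      (cost : ℝ) ≤ (12 * κ + 9) * ((r : ℝ) ^ θ * (r : ℝ) ^ 2) +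
        (1 + κ * (((r : ℝ) + r) * (c + r) * (r : ℝ) ^ θ)) := by
  refine (wp_lowerInv hmm hκ hθ _ _ _ L hX hL fun i => by rw [hd]; exact one_ne_zero).bind
    fun mem₁ I c₁ hm₁ ⟨hI, hc₁⟩ => ?_
  refine (wp_rectMul hmm hκ hI (hY.mono hm₁)).mono fun mem₂ Z c₂ _ ⟨hZ, hc₂⟩ => ⟨hZ, ?_⟩
  push_cast
  linarith

open FieldProg in
theorem wp_solveUpper (hmm : MulWithin mm κ θ) (hκ : 0 ≤ κ) (hθ : 0 ≤ θ) {a r : ℕ}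
    {X : AddrMatrix a r} {Y : AddrMatrix r r} {C : Matrix (Fin a) (Fin r) K}
    {U : Matrix (Fin r) (Fin r) K} (hX : Holds mem X C) (hY : Holds mem Y U)
    (hU : ∀ i j, j < i → U i j = 0) (hd : ∀ i, U i i ≠ 0) :
    ((subroutinesOfMul mm).solveUpper a r X Y).wp mem fun mem' Z cost => Holds mem' Z (C * U⁻¹) ∧
      (cost : ℝ) ≤ (12 * κ + 9) * ((r : ℝ) ^ θ * (r : ℝ) ^ 2) +
        (1 + κ * (((a : ℝ) + r) * (r + r) * (r : ℝ) ^ θ)) := by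
  refine (wp_lowerInv hmm hκ hθ _ _ _ Uᵀ hY.transpose (fun i j hij => hU j i hij) hd).bind
    fun mem₁ I c₁ hm₁ ⟨hI, hc₁⟩ => ?_
  rw [← Matrix.transpose_nonsing_inv] at hI
  refine (wp_rectMul hmm hκ (hX.mono hm₁) hI.transpose).mono fun mem₂ Z c₂ _ ⟨hZ, hc₂⟩ => ⟨hZ, ?_⟩
  push_cast
  linarith

open FieldProg in
theorem wp_pluq (hmm : MulWithin mm κ θ) (hκ : 0 ≤ κ) (hθ : 0 < θ) (hθ₁ : θ ≤ 1) {m n : ℕ}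
    {X : AddrMatrix m n} {A : Matrix (Fin m) (Fin n) K} (hX : Holds mem X A) :
    ((subroutinesOfMul mm).pluq m n X).wp mem fun mem' d cost =>
      (∃ (L : Matrix (Fin m) (Fin d.r) K) (U : Matrix (Fin d.r) (Fin n) K),
        Holds mem' d.L L ∧ Holds mem' d.U U ∧
        IsRevealingPLUQ A ⟨d.r, d.r_le_rows, d.r_le_cols, d.P, d.Q, L, U⟩) ∧
      (cost : ℝ) + 1 ≤ 2 ^ Nat.clog 2 m * (n + 1) *
        (3 + (20 * κ + 12) / (2 * (1 - (1 / 2) ^ θ)) * (d.r : ℝ) ^ θ) := by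
  refine (wp_elim hmm hκ hθ hθ₁ n _ m (Nat.le_pow_clog (by norm_num) m) mem X A hX).bind
    fun mem₁ d c₁ hm₁ ⟨⟨L, U, hL, hU, hd, hA⟩, hc₁⟩ => wp_pure.2 ?_
  have hrm : d.r ≤ m := by simpa using Fintype.card_le_of_injective d.p hd.row_inj
  have hrn : d.r ≤ n := by simpa using Fintype.card_le_of_injective d.q hd.col_inj
  obtain ⟨P, Q, hP, hQ, he⟩ := d.toPLUQ_eq hd.row_inj hd.col_inj hrm hrn
  rw [he]
  exact ⟨⟨L.submatrix P id, U.submatrix id Q, hL.submatrix P id, hU.submatrix id Q,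
    hA ▸ hd.isRevealingPLUQ hrm hrn hP hQ⟩, hc₁⟩

theorem subroutinesOfMul_correct (hmm : MulWithin mm κ θ) (hκ : 0 ≤ κ) (hθ : 0 < θ) (hθ₁ : θ ≤ 1) :
    (subroutinesOfMul mm).Correct where
  mul _ _ _ _ _ _ _ _ hX hY := (wp_rectMul hmm hκ hX hY).1
  solveLower _ _ _ _ _ _ _ hX hY hL hd := (wp_solveLower hmm hκ hθ.le hX hY hL hd).1
  solveUpper _ _ _ _ _ _ _ hX hY hU hd := (wp_solveUpper hmm hκ hθ.le hX hY hU hd).1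
  pluq _ _ _ _ _ hX := (wp_pluq hmm hκ hθ hθ₁ hX).1

end Subroutines

/-! ### Uniform cost bounds for these subroutines -/

/-- The constant in the cost of `subroutinesOfMul`. -/
noncomputable def subroutineConst (κ θ : ℝ) : ℝ :=
  16 * κ + 22 + 4 * ((20 * κ + 12) / (2 * (1 - (1 / 2) ^ θ)))

theorem half_rpow_lt_one {θ : ℝ} (hθ : 0 < θ) : (1 / 2 : ℝ) ^ θ < 1 :=
  Real.rpow_lt_one (by norm_num) (by norm_num) hθ

/-- A triangular solve needs $(12\kappa+9)+(4\kappa+1)$, an inversion and a product. The rest of the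
constant, $12+4\beta$, is for the PLUQ decomposition. -/
theorem le_subroutineConst {κ θ : ℝ} (hκ : 0 ≤ κ) (hθ : 0 < θ) :
    16 * κ + 10 ≤ subroutineConst κ θ := by
  have h := half_rpow_lt_one hθ
  have : 0 ≤ (20 * κ + 12) / (2 * (1 - (1 / 2) ^ θ)) := div_nonneg (by positivity) (by linarith)
  rw [subroutineConst]
  linarith

theorem one_le_max_rpow_mul_sq {θ : ℝ} (hθ : 0 ≤ θ) (b : ℕ) {N : ℕ} (hN : 1 ≤ N) :
    (1 : ℝ) ≤ max (b : ℝ) 1 ^ θ * (N : ℝ) ^ 2 :=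
  one_le_mul_of_one_le_of_one_le (Real.one_le_rpow (le_max_right _ _) hθ)
    (one_le_pow₀ (by exact_mod_cast hN))

theorem rectMul_cost_le {κ θ : ℝ} (hκ : 0 ≤ κ) (hθ : 0 ≤ θ) {a b c N : ℕ} (hN : 1 ≤ N)
    (ha : a ≤ N) (hb : b ≤ N) (hc : c ≤ N) :
    1 + κ * (((a : ℝ) + b) * (c + b) * (b : ℝ) ^ θ) ≤
      (4 * κ + 1) * (max (b : ℝ) 1 ^ θ * (N : ℝ) ^ 2) := by
  have h1 := one_le_max_rpow_mul_sq hθ b hN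
  have h2 : ((a : ℝ) + b) * (c + b) * (b : ℝ) ^ θ ≤
      (N + N) * (N + N) * max (b : ℝ) 1 ^ θ := by
    gcongr
    exact le_max_left _ _
  have h3 := mul_le_mul_of_nonneg_left h2 hκ
  linarith

theorem rpow_mul_sq_le {θ : ℝ} (hθ : 0 ≤ θ) {r N : ℕ} (hr : r ≤ N) :
    (r : ℝ) ^ θ * (r : ℝ) ^ 2 ≤ max (r : ℝ) 1 ^ θ * (N : ℝ) ^ 2 := by
  gcongr
  exact le_max_left _ _

section CostBound

variable {K : Type u} [Field K]
  {mm : (n : ℕ) → AddrMatrix n n → AddrMatrix n n → FieldProg K (AddrMatrix n n)} {κ θ : ℝ}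

theorem subroutinesOfMul_costBound (hmm : MulWithin mm κ θ) (hκ : 0 ≤ κ) (hθ : 0 < θ)
    (hθ₁ : θ ≤ 1) : (subroutinesOfMul mm).CostBound (subroutineConst κ θ) θ where
  mul a b c N mem X Y A B hN ha hb hc hX hY := by
    refine (wp_rectMul hmm hκ hX hY).2.trans ((rectMul_cost_le hκ hθ.le hN ha hb hc).trans ?_)
    gcongr
    linarith [le_subroutineConst hκ hθ]
  solveLower r c N mem X Y L B hN hr hc hX hY hL hd := by
    refine (wp_solveLower hmm hκ hθ.le hX hY hL hd).2.trans ?_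
    have h1 := rectMul_cost_le hκ hθ.le hN hr hr hc
    have h2 := mul_le_mul_of_nonneg_left (rpow_mul_sq_le hθ.le hr)
      (show 0 ≤ 12 * κ + 9 by positivity)
    have h3 := mul_le_mul_of_nonneg_right (le_subroutineConst hκ hθ)
      (show 0 ≤ max (r : ℝ) 1 ^ θ * (N : ℝ) ^ 2 by positivity)
    linarith
  solveUpper a r N mem X Y C U hN ha hr hX hY hU hd := by
    refine (wp_solveUpper hmm hκ hθ.le hX hY hU hd).2.trans ?_
    have h1 := rectMul_cost_le hκ hθ.le hN ha hr hr
    have h2 := mul_le_mul_of_nonneg_left (rpow_mul_sq_le hθ.le hr)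
      (show 0 ≤ 12 * κ + 9 by positivity)
    have h3 := mul_le_mul_of_nonneg_right (le_subroutineConst hκ hθ)
      (show 0 ≤ max (r : ℝ) 1 ^ θ * (N : ℝ) ^ 2 by positivity)
    linarith
  pluq m n N mem X A hN hm hn hX := by
    have hc := (wp_pluq hmm hκ hθ hθ₁ hX).2
    set r := (((subroutinesOfMul mm).pluq m n X).run mem).val.r
    set T := max (r : ℝ) 1 ^ θ
    have hT : 1 ≤ T := Real.one_le_rpow (le_max_right _ _) hθ.le
    have hrT : (r : ℝ) ^ θ ≤ T := Real.rpow_le_rpow (by positivity) (le_max_left _ _) hθ.le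
    -- Rounding the number of rows up to a power of two at most doubles it.
    have hpow : (2 : ℝ) ^ Nat.clog 2 m ≤ 2 * N := by
      have h1 : 2 ^ Nat.clog 2 m ≤ 2 * N := by
        rcases Nat.lt_or_ge 1 m with h | h
        · have := Nat.pow_pred_clog_lt_self (b := 2) (by norm_num) h
          have h2 : 2 ^ Nat.clog 2 m = 2 * 2 ^ (Nat.clog 2 m).pred := by
            rw [← pow_succ', ← Nat.succ_eq_add_one,
              Nat.succ_pred (Nat.clog_pos (by norm_num) h).ne']
          omega
        · rw [Nat.clog_of_right_le_one h]
          omega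
      exact_mod_cast h1
    have hn1 : (n : ℝ) + 1 ≤ 2 * N := by
      have : n + 1 ≤ 2 * N := by omega
      exact_mod_cast this
    have hβ : 0 ≤ (20 * κ + 12) / (2 * (1 - (1 / 2) ^ θ)) :=
      div_nonneg (by positivity) (by linarith [half_rpow_lt_one hθ])
    set β := (20 * κ + 12) / (2 * (1 - (1 / 2) ^ θ)) with hβ'
    calc _ ≤ 2 ^ Nat.clog 2 m * (n + 1) * (3 + β * (r : ℝ) ^ θ) := by linarith
      _ ≤ (2 * N) * (2 * N) * (3 * T + β * T) := by
        gcongr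
        linarith
      _ = (12 + 4 * β) * (T * (N : ℝ) ^ 2) := by ring
      _ ≤ subroutineConst κ θ * (T * (N : ℝ) ^ 2) := by
        gcongr
        rw [subroutineConst, ← hβ']
        linarith

theorem exists_mulWithin {ω c : ℝ} (hω : 0 < ω) (h : MatMulCost K ω c) :
    ∃ mm : (n : ℕ) → AddrMatrix n n → AddrMatrix n n → FieldProg K (AddrMatrix n n),
      MulWithin mm (max c 0) (ω - 2) := by
  choose mm hmm using h
  refine ⟨mm, fun n mem X Y A B hX hY => ⟨(hmm n mem X Y A B hX hY).1,
    (hmm n mem X Y A B hX hY).2.trans ?_⟩⟩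
  -- Splitting the exponent $\omega=(\omega-2)+2$ needs a positive base, so size zero is treated
  -- separately.
  rcases Nat.eq_zero_or_pos n with rfl | hn
  · simp [Real.zero_rpow hω.ne']
  · have h1 : (n : ℝ) ^ ω = (n : ℝ) ^ (ω - 2) * (n : ℝ) ^ 2 := by
      rw [← Real.rpow_natCast (n : ℝ) 2, ← Real.rpow_add (by exact_mod_cast hn)]
      norm_num
    rw [h1]
    gcongr
    exact le_max_left _ _

end CostBound

/-! ### Conclusion -/

theorem mainTheorem3 (ω c : ℝ) (hω₂ : 2 < ω) (hω₃ : ω ≤ 3) :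
    ∃ C : ℝ, ∀ (K : Type u) [Field K],
      -- correctness, for every correct choice of the subroutines
      (∀ S : Subroutines K, S.Correct →
        ∀ (n : ℕ) (A : Matrix (Fin n) (Fin n) K) (mem : List K) (X : AddrMatrix n n),
          Holds mem X A →
            let res := (ltBruhat S n X).run mem
            ∃ t : Triple K n,
              Holds res.mem res.val.L t.L ∧ Holds res.mem res.val.R t.R ∧
              Holds res.mem res.val.U t.U ∧ IsBruhatGenerator (leftPart A) t) ∧
      -- number of field operations
      (MatMulCost K ω c →
        ∃ S : Subroutines K, S.Correct ∧
          ∀ (n s : ℕ) (A : Matrix (Fin n) (Fin n) K) (mem : List K) (X : AddrMatrix n n),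
            Holds mem X A → quasisepOrder (leftPart A) = s →
              (((ltBruhat S n X).run mem).cost : ℝ) ≤
                C * (max (s : ℝ) 1) ^ (ω - 2) * (n : ℝ) ^ 2) := by
  refine ⟨3 * (5 * subroutineConst (max c 0) (ω - 2) + 6), fun K _ =>
    ⟨fun S hS n A mem X hX => ?_, fun hmm => ?_⟩⟩
  -- For correctness alone the parameters of the cost clause are irrelevant; `le_rfl` sets both to
  -- zero.
  · obtain ⟨t, hL, hR, hU, ht, -⟩ := wp_ltBruhat hS le_rfl le_rfl n A mem X hX
    exact ⟨t, hL, hR, hU, ht⟩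
  · obtain ⟨mm, hmm⟩ := exists_mulWithin (by linarith) hmm
    have hκ : 0 ≤ max c 0 := le_max_right _ _
    have hθ : 0 < ω - 2 := by linarith
    have hθ₁ : ω - 2 ≤ 1 := by linarith
    have hS := subroutinesOfMul_correct hmm hκ hθ hθ₁
    refine ⟨subroutinesOfMul mm, hS, fun n s A mem X hX hs => ?_⟩
    have hκ' : 0 ≤ subroutineConst (max c 0) (ω - 2) := by
      linarith [le_subroutineConst hκ hθ]
    obtain ⟨t, -, -, -, -, hcost⟩ := wp_ltBruhat hS hκ' hθ.le n A mem X hX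
    rw [mul_assoc]
    exact hcost (subroutinesOfMul_costBound hmm hκ hθ hθ₁) s hs.le
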